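/- Conventions. Everything is complex analytic. Let $n\ge 3$. If $D$ is a rank-$n$ distribution on a manifold $Z$, its prolongation is $\mathbb{P}D=\{(z,\ell): z\in Z,\ \ell\subset D(z)\text{ a line}\}$ with the rank-$n$ distribution $D^1(z,\ell)=d\pi^{-1}(\ell)$, where $\pi:\mathbb{P}D\to Z$ is the projection. The Monster tower is $\mathcal P^0(n)=\mathbb C^n$ with $\Delta_0=T\mathbb C^n$, and $(\mathcal P^{k+1}(n),\Delta_{k+1})=(\mathbb P\Delta_k,\Delta_k^1)$. The prolongation of a non-constant integral curve germ $\sigma$ is the analytic curve germ $\sigma^1$ with $\sigma^1(t)=(\sigma(t),\operatorname{span}\sigma'(t))$ for $t\ne 0$; the $k$-th prolongation of a curve germ $\gamma$ in $\mathbb C^n$ is denoted $\gamma^k$. The baby Monster of a fibre $F$ of $\mathcal P^i(n)\to\mathcal P^{i-1}(n)$, $i\ge 1$, is the sequence of submanifolds $\mathcal P^0(F)=F$, $\mathcal P^{j+1}(F)=\mathbb P(\Delta_{i+j}\cap T\mathcal P^j(F))\subset\mathcal P^{i+j+1}(n)$. A critical hyperplane at $p\in\mathcal P^k(n)$ is a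 hyperplane $\Delta_k(p)\cap T_p\mathcal P^j(F)$ of $\Delta_k(p)$, where $i+j=k$ and $p\in \mathcal P^j(F)$; the one with $j=0$ (for $k\ge 1$) is the vertical hyperplane. A line in $\Delta_k(p)$ is regular if it lies in no critical hyperplane. A point $(p,\ell)\in\mathcal P^{k+1}(n)$ has the letter $V$ if $\ell$ lies in the vertical hyperplane at $p$, the letter $T$ if $\ell$ lies in a critical hyperplane but not in the vertical one, and the letter $R$ if $\ell$ is regular; it is an $L$ point if $\ell$ lies in the vertical hyperplane and in another critical hyperplane. The RVT code of $p\in \mathcal P^k(n)$ is the word of the $k$ letters of its projections to levels $1,\dots,k$, and the RVT class of a word is the set of all points with that code. $R^sVL$ is the set of $L$ points in the class $R^sVV$. For $p\in\mathcal P^k(n)$ let $\mathrm{Germ}(p)$ be the set of analytic curve germs $\gamma:(\mathbb C,0)\to\mathbb C^n$ such that $\gamma^k(0)=p$, $\gamma^k$ is immersed at $0$, and the direction of $\gamma^k$ at $0$ is regular. The embedding dimension of a curve germ in $\mathbb C^n$ is the least $d$ such that the germ lies in a smooth $d$-dimensional submanifold. A point $p$ is spatial if every curve in $\mathrm{Germ}(p)$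 has embedding dimension at least $3$ and some curve in it has embedding dimension $3$; it is purely spatial if every curve in $\mathrm{Germ}(p)$ has embedding dimension $3$. Theorem. Let $n\ge 3$ and $s\ge 1$. 1. Every point of $R^sVL$ is spatial. 2. There is a dense open subset of $R^sVT$ all of whose points are purely spatial. 3. There is a dense open subset of $R^sVVR$ all of whose points are purely spatial. 4. For every $m\ge 1$ there is a dense open subset $U$ of $R^sVR^mVRR$ such that for every $p\in U$ all curves in $\mathrm{Germ}(p)$ have embedding dimension at least $3$; if $n=3$, all points of $U$ are purely spatial. (Open and dense refer to the topology of the class as a subspace of the Monster tower.) -/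

import Mathlib

open Filter Topology
open scoped LinearAlgebra.Projectivization

noncomputable section

namespace MonsterTower

/-! ### Manifolds with a rank `n` distribution, and Cartan prolongation -/

/-- Data presenting a complex manifold with a rank `n` distribution `D`: a point set `Pt`,
a family of charts `chart i : Coord i → Pt`, each defined on a whole complex vector space, and
in each chart a frame of `D`: `frame i x` sends the `b`-th basis vector of `ℂⁿ` to the value at
`x` of the `b`-th vector field of the frame. Only the instances `base` and
`prolong (… (prolong base))` built below are ever used. -/
structure DistAtlas (n : ℕ) where
  Pt : Type
  Chart : Type
  Coord : Chart → Type
  [instNormed : ∀ i, NormedAddCommGroup (Coord i)]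
  [instSpace : ∀ i, NormedSpace ℂ (Coord i)]
  chart : ∀ i, Coord i → Pt
  frame : ∀ i, Coord i → ((Fin n → ℂ) →ₗ[ℂ] Coord i)

attribute [instance] DistAtlas.instNormed DistAtlas.instSpace

/-- The manifold topology: a set is open iff its preimage under every chart is open. -/
instance {n : ℕ} (Z : DistAtlas n) : TopologicalSpace Z.Pt :=
  ⨆ i, TopologicalSpace.coinduced (Z.chart i) inferInstance

/-- The vector of `ℂⁿ` with `a`-th entry `1` and the other entries given by the affine
coordinates `u`. -/
def dir {n : ℕ} (a : Fin n) (u : {b : Fin n // b ≠ a} → ℂ) : Fin n → ℂ :=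
  fun b => if h : b = a then 1 else u ⟨b, h⟩

theorem dir_ne_zero {n : ℕ} (a : Fin n) (u : {b : Fin n // b ≠ a} → ℂ) : dir a u ≠ 0 := by
  intro h
  have := congrFun h a
  simp [dir] at this

namespace DistAtlas

variable {n : ℕ}

/-- The distribution at `x`, as a subspace of the tangent space in the chart `i`. -/
def dist (Z : DistAtlas n) (i : Z.Chart) (x : Z.Coord i) : Submodule ℂ (Z.Coord i) :=
  LinearMap.range (Z.frame i x)

/-- The line in the distribution at `x` whose homogeneous coordinates in the frame are `l`. -/
def line (Z : DistAtlas n) (i : Z.Chart) (x : Z.Coord i) (l : ℙ ℂ (Fin n → ℂ)) :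
    Submodule ℂ (Z.Coord i) :=
  l.submodule.map (Z.frame i x)

/-- The change of coordinates from the chart `i` to the chart `j` (meaningful on the overlap). -/
def transition (Z : DistAtlas n) (i j : Z.Chart) : Z.Coord i → Z.Coord j :=
  fun x => Function.invFun (Z.chart j) (Z.chart i x)

/-- A point and a line of the distribution at that point, both written in a chart. -/
structure LineRep (Z : DistAtlas n) where
  i : Z.Chart
  x : Z.Coord i
  l : ℙ ℂ (Fin n → ℂ)

/-- Two chart descriptions give the same pair (point, line): the points agree and the
derivative of the change of coordinates carries one line to the other. -/
def SameLine (Z : DistAtlas n) (p q : Z.LineRep) : Prop :=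
  Z.chart p.i p.x = Z.chart q.i q.x ∧
    (Z.line p.i p.x p.l).map
      (fderiv ℂ (Z.transition p.i q.i) p.x : Z.Coord p.i →ₗ[ℂ] Z.Coord q.i) = Z.line q.i q.x q.l

/-- Cartan prolongation `(ℙD, D¹)` of `(Z, D)`. A point is a pair (point `z` of `Z`, line in
`D z`). The chart `(i, a)` covers the lines on which the `a`-th frame coordinate is non-zero,
with fibre coordinates the ratios of the other frame coordinates to it. The frame spans
`D¹ (z, ℓ) = dπ⁻¹ ℓ`: its `a`-th vector projects onto a generator of `ℓ`, the other ones are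
the coordinate fields of the fibre. -/
def prolong (Z : DistAtlas n) : DistAtlas n where
  Pt := Quot Z.SameLine
  Chart := Z.Chart × Fin n
  Coord c := Z.Coord c.1 × ({b : Fin n // b ≠ c.2} → ℂ)
  chart c y := Quot.mk _ ⟨c.1, y.1, Projectivization.mk ℂ (dir c.2 y.2) (dir_ne_zero c.2 y.2)⟩
  frame c y :=
    LinearMap.prod
      ((LinearMap.toSpanSingleton ℂ (Z.Coord c.1) (Z.frame c.1 y.1 (dir c.2 y.2))).comp
        (LinearMap.proj c.2))
      (LinearMap.pi fun b => LinearMap.proj b.1)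

/-- The pair (point, line) as a point of the prolongation. -/
def mkPt (Z : DistAtlas n) (i : Z.Chart) (x : Z.Coord i) (l : ℙ ℂ (Fin n → ℂ)) : Z.prolong.Pt :=
  Quot.mk Z.SameLine ⟨i, x, l⟩

/-- The projection `ℙD → Z`. -/
def proj (Z : DistAtlas n) (p : Z.prolong.Pt) : Z.Pt :=
  Quot.lift (fun q : Z.LineRep => Z.chart q.i q.x) (fun _ _ h => h.1) p

/-- The vectors tangent at the point `x` of the chart `i` to the submanifold `S`: velocities of
analytic curves lying in `S`. -/
def tangent (Z : DistAtlas n) (S : Set Z.Pt) (i : Z.Chart) (x : Z.Coord i) : Set (Z.Coord i) :=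
  {v | ∃ c : ℂ → Z.Coord i, AnalyticAt ℂ c 0 ∧ c 0 = x ∧ deriv c 0 = v ∧
    ∀ᶠ t in 𝓝 (0 : ℂ), Z.chart i (c t) ∈ S}

/-- `D ∩ TS` at the point `x` of the chart `i`. -/
def plane (Z : DistAtlas n) (S : Set Z.Pt) (i : Z.Chart) (x : Z.Coord i) : Set (Z.Coord i) :=
  (Z.dist i x : Set (Z.Coord i)) ∩ Z.tangent S i x

/-- The prolongation `ℙ(D ∩ TS) ⊆ ℙD` of a submanifold `S` of `Z`. -/
def prolongSet (Z : DistAtlas n) (S : Set Z.Pt) : Set Z.prolong.Pt :=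
  {p | ∃ i x l, p = Z.mkPt i x l ∧ Z.chart i x ∈ S ∧
    (Z.line i x l : Set (Z.Coord i)) ⊆ Z.plane S i x}

/-- `F` is the coordinate expression, in the chart `i`, of the analytic curve germ `σ` at `0`. -/
def Represents (Z : DistAtlas n) (σ : ℂ → Z.Pt) (i : Z.Chart) (F : ℂ → Z.Coord i) : Prop :=
  AnalyticAt ℂ F 0 ∧ ∀ᶠ t in 𝓝 (0 : ℂ), σ t = Z.chart i (F t)

/-- The germ at `0` of `τ` is the prolongation `σ¹` of the germ at `0` of the non-constant
integral curve `σ`: it is analytic, and `τ t = (σ t, span σ'(t))` for all `t ≠ 0` near `0`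
(so that `τ 0` is the limit of these as `t → 0`). -/
def IsProlongation (Z : DistAtlas n) (σ : ℂ → Z.Pt) (τ : ℂ → Z.prolong.Pt) : Prop :=
  (∃ c G, Z.prolong.Represents τ c G) ∧
  ∃ i F, Z.Represents σ i F ∧
    ∀ᶠ t in 𝓝[≠] (0 : ℂ), deriv F t ≠ 0 ∧
      ∃ l, Z.line i (F t) l = Submodule.span ℂ {deriv F t} ∧ τ t = Z.mkPt i (F t) l

end DistAtlas

/-! ### The Monster tower -/

/-- `ℂⁿ` with its tangent bundle as distribution. -/
def base (n : ℕ) : DistAtlas n where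
  Pt := Fin n → ℂ
  Chart := Unit
  Coord _ := Fin n → ℂ
  chart _ x := x
  frame _ _ := LinearMap.id

/-- The `k`-th level `(𝒫ᵏ(n), Δₖ)` of the Monster tower. -/
def monster (n : ℕ) : ℕ → DistAtlas n
  | 0 => base n
  | k + 1 => (monster n k).prolong

/-- The points of `𝒫ᵏ(n)`. -/
abbrev Point (n k : ℕ) : Type := (monster n k).Pt

/-- The projection `𝒫ᵏ⁺¹(n) → 𝒫ᵏ(n)`. -/
def down {n k : ℕ} (p : Point n (k + 1)) : Point n k := (monster n k).proj p

/-- The fibre of `𝒫ᵏ⁺¹(n) → 𝒫ᵏ(n)` through `p`. -/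
def fiber {n k : ℕ} (p : Point n (k + 1)) : Set (Point n (k + 1)) := {q | down q = down p}

/-- `S` is a member `𝒫ʲ(F)`, at level `k = i + j`, of the baby Monster of some fibre `F` at some
level `i ≥ 1`. -/
inductive IsBaby (n : ℕ) : (k : ℕ) → Set (Point n k) → Prop
  | fiber {k : ℕ} (p : Point n (k + 1)) : IsBaby n (k + 1) (fiber p)
  | prolong {k : ℕ} (S : Set (Point n k)) :
      IsBaby n k S → IsBaby n (k + 1) ((monster n k).prolongSet S)

/-- `P` is a critical hyperplane of `Δₖ` at the point `x` of the chart `i`: the hyperplane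
`Δₖ ∩ TS` for a baby Monster `S` passing through that point. -/
def IsCriticalPlane {n k : ℕ} (i : (monster n k).Chart) (x : (monster n k).Coord i)
    (P : Set ((monster n k).Coord i)) : Prop :=
  ∃ S, IsBaby n k S ∧ (monster n k).chart i x ∈ S ∧ P = (monster n k).plane S i x

/-- `P` is the vertical hyperplane `Vₖ` at the point `x` of the chart `i` (there is none at
level `0`). -/
def IsVerticalPlane {n : ℕ} : {k : ℕ} → (i : (monster n k).Chart) →
    (x : (monster n k).Coord i) → Set ((monster n k).Coord i) → Prop
  | 0, _, _, _ => False
  | k + 1, i, x, P =>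
      P = (monster n (k + 1)).plane (fiber ((monster n (k + 1)).chart i x)) i x

/-- The point `(p, ℓ)` is vertical: `ℓ` lies in the vertical hyperplane at `p`. -/
def IsVertical {n k : ℕ} (q : Point n (k + 1)) : Prop :=
  ∃ i x l P, q = (monster n k).mkPt i x l ∧ IsVerticalPlane i x P ∧
    ((monster n k).line i x l : Set _) ⊆ P

/-- The point `(p, ℓ)` is critical: `ℓ` lies in some critical hyperplane at `p`. -/
def IsCritical {n k : ℕ} (q : Point n (k + 1)) : Prop :=
  ∃ i x l P, q = (monster n k).mkPt i x l ∧ IsCriticalPlane i x P ∧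
    ((monster n k).line i x l : Set _) ⊆ P

/-- `(p, ℓ)` is an `L` point: `ℓ` lies in the vertical hyperplane at `p` and in another
critical hyperplane at `p`. -/
def IsLPoint {n : ℕ} : {k : ℕ} → Point n k → Prop
  | 0, _ => False
  | k + 1, q => ∃ i x l P Q, q = (monster n k).mkPt i x l ∧
      IsVerticalPlane i x P ∧ IsCriticalPlane i x Q ∧ Q ≠ P ∧
      ((monster n k).line i x l : Set _) ⊆ P ∩ Q

/-! ### RVT codes -/

/-- The letters of an RVT code. -/
inductive Letter
  | R
  | V
  | T

open Classical in
/-- The last letter of the code of a point: `V` if the point is vertical, `T` if it is critical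
but not vertical, `R` if it is regular. -/
def letter {n k : ℕ} (q : Point n (k + 1)) : Letter :=
  if IsVertical q then Letter.V else if IsCritical q then Letter.T else Letter.R

/-- The RVT code of a point of level `k`, a word of length `k`. -/
def code {n : ℕ} : {k : ℕ} → Point n k → List Letter
  | 0, _ => []
  | _ + 1, q => code (down q) ++ [letter q]

/-- The RVT class of a word `w` at level `k` (empty unless `w` has length `k`). -/
def rvtClass (n k : ℕ) (w : List Letter) : Set (Point n k) := {p | code p = w}

/-- The word `R ⋯ R` (`s` letters). -/
def Rs (s : ℕ) : List Letter := List.replicate s Letter.R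

/-- The class `RˢVL`: the `L` points of `RˢVV`. -/
def classRVL (n s : ℕ) : Set (Point n (s + 2)) :=
  {p ∈ rvtClass n (s + 2) (Rs s ++ [Letter.V, Letter.V]) | IsLPoint p}

/-! ### Points and curves -/

/-- The germ at `0` of `σ` is the `k`-th prolongation `γᵏ` of the curve germ `γ`. -/
def IsIteratedProlongation {n : ℕ} (γ : ℂ → Fin n → ℂ) : {k : ℕ} → (ℂ → Point n k) → Prop
  | 0, σ => ∀ᶠ t in 𝓝 (0 : ℂ), σ t = γ t
  | k + 1, τ => ∃ σ : ℂ → Point n k, IsIteratedProlongation γ σ ∧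
      (monster n k).IsProlongation σ τ

/-- The curve germ `σ` is immersed, and its tangent direction at `0` is regular, that is, lies in
no critical hyperplane. -/
def IsRegularCurve {n k : ℕ} (σ : ℂ → Point n k) : Prop :=
  ∃ i F, (monster n k).Represents σ i F ∧ deriv F 0 ≠ 0 ∧
    ∀ P, IsCriticalPlane i (F 0) P → deriv F 0 ∉ P

/-- `Germ(p)`: the analytic curve germs in `ℂⁿ` whose `k`-th prolongation is regular and passes
through `p`. -/
def Germ {n k : ℕ} (p : Point n k) : Set (ℂ → Fin n → ℂ) :=
  {γ | AnalyticAt ℂ γ 0 ∧ ∃ σ : ℂ → Point n k,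
    IsIteratedProlongation γ σ ∧ σ 0 = p ∧ IsRegularCurve σ}

/-- Near `t = 0` the curve `γ` lies in a smooth (complex analytic) `d`-dimensional submanifold
of `ℂⁿ`, which an analytic coordinate system `ψ` at `γ 0` straightens to the vanishing of the
coordinates with index at least `d`. -/
def LiesInSubmanifold {n : ℕ} (γ : ℂ → Fin n → ℂ) (d : ℕ) : Prop :=
  d ≤ n ∧ ∃ ψ : (Fin n → ℂ) → (Fin n → ℂ), AnalyticAt ℂ ψ (γ 0) ∧
    Function.Bijective (fderiv ℂ ψ (γ 0)) ∧
    ∀ᶠ t in 𝓝 (0 : ℂ), ∀ j : Fin n, d ≤ j.1 → ψ (γ t) j = 0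

/-- The embedding dimension of a curve germ (the set below contains `n`). -/
def embDim {n : ℕ} (γ : ℂ → Fin n → ℂ) : ℕ := sInf {d | LiesInSubmanifold γ d}

/-- Spatial points: every curve in `Germ(p)` has embedding dimension at least `3`, and some curve
in it has embedding dimension `3`. -/
def IsSpatial {n k : ℕ} (p : Point n k) : Prop :=
  (∀ γ ∈ Germ p, 3 ≤ embDim γ) ∧ ∃ γ ∈ Germ p, embDim γ = 3

/-- Purely spatial points: every curve in `Germ(p)` has embedding dimension `3`. -/
def IsPurelySpatial {n k : ℕ} (p : Point n k) : Prop := ∀ γ ∈ Germ p, embDim γ = 3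

end MonsterTower

end

open MonsterTower

noncomputable section

namespace MonsterTower

/-! ### Good atlases: transition maps, frame matrices and equality of points -/

section

/-! Coordinates. In the affine charts of the tower a point of level `k` is a sequence of blocks `U
0, …, U k` with chart indices `a 1, …, a k`. For `j ≥ 1` the block `U j` is a homogeneous vector
spanning the line chosen at that step, scaled to have entry `1` at `a j`. A baby Monster meeting
such a chart is an affine subspace of it, and it cuts the distribution in a hyperplane on which one
frame coordinate vanishes. So the critical hyperplanes at a point are indexed by a recursively
computed set of active indices (`IsBaby.exists_isSlice`, `exists_isBaby_of_mem_active`), and RVT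
letters become equations and inequations between entries. In all four classes the indices can be
taken to be `a` (`s` times), then `b` (`m + 1` times, with `m = 0` in the first three), then a
constant `c`. The dense open sets are cut out by one more inequation, which holds after perturbing
one entry or two.

Curves. The blocks of a prolonged curve are quotients of successive velocities (`Jet`,
`exists_jet`), and regularity says that the velocities at the active indices do not vanish
(`IsRegularCurve.vel_ne_zero`).

Lower bound. A smooth submanifold containing a curve has a tangent space that contains every vector
killed by the differentials of all functions vanishing on the curve. Hence three independent such
vectors force embedding dimension at least 3 (`three_le_embDim`). To find them, let `g` vanish on
the curve and differentiate repeatedly with respect to the coordinate `a`, whose velocity is `X`.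
The first derivative kills `U 1 0`. After `s` further steps, with `w = U (s + 1)` and `X = η * w a`,
there remains a relation saying that the sum over `b ≠ a` of `∂_b g * w b` is `w a * k`
(`Tangency.exists_relation`). Since `w a` vanishes at the origin, `w 0` is killed too.
Differentiating the relation once or several more times gives a third vector, in three variants
according to the class: `fderiv_deriv_last`, `fderiv_deriv_quotient`, `fderiv_iterated`. What makes
this work is that `k` is again divisible in the right sense: its derivative is a multiple of `η`,
repeatedly. The rings `tower` record exactly this.

Upper bound. On the generic points of `RˢVT` and `RˢVVR`, the coordinate `a` of every curve has a
critical point of order exactly two, so a change of parameter makes it a constant plus `t³`.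
Analytic functions of `t` form a free module with basis `1, t, t²` over those of `t³`. Passing from
block `l + 1` to block `l` is integration with respect to `t³`, which raises the orders of the `t`
and `t²` parts by one and multiplies their leading coefficients by fixed non-zero constants
(`HasParts.iterate_integrate`). If two entries of block `s` have independent leading parts, so do
the corresponding two coordinates of the curve. Cramer's rule then writes every other coordinate as
a combination of `1` and these two with coefficients analytic in the coordinate `a`, so the curve
lies in the graph of a map of three coordinates (`Tangency.embDim_le_three`).

For `RˢVL` a single curve of dimension at most 3 is enough, and it is written down explicitly
(`exists_mem_Germ_embDim_le_three`). In the last class the upper bound is asked only for `n = 3`,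
where it is automatic. -/

theorem dir_self {n : ℕ} (a : Fin n) (u : {b : Fin n // b ≠ a} → ℂ) : dir a u a = 1 := by
  simp [dir]

theorem dir_of_ne {n : ℕ} {a b : Fin n} (u : {b : Fin n // b ≠ a} → ℂ) (h : b ≠ a) :
    dir a u b = u ⟨b, h⟩ := by
  simp [dir, h]

theorem dir_div {n : ℕ} {a : Fin n} {v : Fin n → ℂ} (h : v a ≠ 0) :
    dir a (fun b => v b.1 / v a) = (v a)⁻¹ • v := by
  ext b
  by_cases hb : b = a
  · subst hb; simp [dir_self, h]
  · simp [dir_of_ne _ hb, div_eq_inv_mul]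

theorem dir_restrict {n : ℕ} {a : Fin n} {v : Fin n → ℂ} (h : v a = 1) :
    dir a (fun b => v b.1) = v := by
  ext b
  by_cases hb : b = a
  · subst hb; simp [dir_self, h]
  · simp [dir_of_ne _ hb]

theorem mk_dir_div {n : ℕ} {a : Fin n} {v : Fin n → ℂ} (hv : v ≠ 0) (h : v a ≠ 0) :
    Projectivization.mk ℂ v hv =
      Projectivization.mk ℂ (dir a (fun b => v b.1 / v a)) (dir_ne_zero _ _) := by
  rw [Projectivization.mk_eq_mk_iff']
  exact ⟨v a, by rw [dir_div h, smul_smul, mul_inv_cancel₀ h, one_smul]⟩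

theorem dir_injective {n : ℕ} (a : Fin n) : Function.Injective (dir a) := by
  intro u w h
  ext ⟨b, hb⟩
  have := congrFun h b
  rwa [dir_of_ne _ hb, dir_of_ne _ hb] at this

theorem analyticAt_dir {n : ℕ} {E : Type*} [NormedAddCommGroup E] [NormedSpace ℂ E] (a : Fin n)
    {u : E → {b : Fin n // b ≠ a} → ℂ} {x : E} (hu : AnalyticAt ℂ u x) :
    AnalyticAt ℂ (fun y => dir a (u y)) x := by
  rw [analyticAt_pi_iff] at hu ⊢
  intro b
  by_cases hb : b = a
  · subst hb; simpa [dir_self] using analyticAt_const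
  · simpa [dir_of_ne _ hb] using hu ⟨b, hb⟩

theorem analyticAt_apply_of_linear {n : ℕ} {E F : Type*} [NormedAddCommGroup E] [NormedSpace ℂ E]
    [NormedAddCommGroup F] [NormedSpace ℂ F]
    {A : E → (Fin n → ℂ) →ₗ[ℂ] F} {v : E → Fin n → ℂ} {x : E}
    (hA : ∀ w, AnalyticAt ℂ (fun y => A y w) x) (hv : AnalyticAt ℂ v x) :
    AnalyticAt ℂ (fun y => A y (v y)) x := by
  have h : (fun y => A y (v y)) = fun y => ∑ c, v y c • A y (Pi.single c 1) := by
    ext y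
    conv_lhs => rw [LinearMap.pi_apply_eq_sum_univ (A y) (v y)]
    refine Finset.sum_congr rfl fun c _ => ?_
    congr 2
    ext d
    simp [Pi.single_apply, eq_comm]
  rw [h]
  refine Finset.analyticAt_fun_sum _ fun c _ => ?_
  exact (analyticAt_pi_iff.1 hv c).smul (hA _)

namespace DistAtlas

variable {n : ℕ} {Z : DistAtlas n}

/-- The part of the chart `i` covered by the chart `j`. -/
def overlap (Z : DistAtlas n) (i j : Z.Chart) : Set (Z.Coord i) :=
  {x | Z.chart i x ∈ Set.range (Z.chart j)}

/-- The charts form a Hausdorff analytic atlas, and the frames are analytic, pointwise linearly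
independent, and related by analytic matrices on the overlaps. -/
structure IsGood (Z : DistAtlas n) : Prop where
  complete : ∀ i, CompleteSpace (Z.Coord i)
  inj : ∀ i, Function.Injective (Z.chart i)
  surj : ∀ p, ∃ i x, Z.chart i x = p
  frame_inj : ∀ i x, Function.Injective (Z.frame i x)
  frame_an : ∀ i x v, AnalyticAt ℂ (fun y => Z.frame i y v) x
  isOpen_overlap : ∀ i j, IsOpen (Z.overlap i j)
  isClosed_eq : ∀ i j, IsClosed {p : Z.Coord i × Z.Coord j | Z.chart i p.1 = Z.chart j p.2}
  transition_an : ∀ i j, ∀ x ∈ Z.overlap i j, AnalyticAt ℂ (Z.transition i j) x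
  exists_frameChange : ∀ i j, ∃ A : Z.Coord i → (Fin n → ℂ) →ₗ[ℂ] (Fin n → ℂ),
    ∀ x ∈ Z.overlap i j, (∀ v, AnalyticAt ℂ (fun y => A y v) x) ∧
      ∀ v, fderiv ℂ (Z.transition i j) x (Z.frame i x v) =
        Z.frame j (Z.transition i j x) (A x v)

theorem mem_overlap {i j : Z.Chart} {x : Z.Coord i} {y : Z.Coord j}
    (h : Z.chart i x = Z.chart j y) : x ∈ Z.overlap i j := ⟨y, h.symm⟩

theorem chart_transition {i j : Z.Chart} {x : Z.Coord i} (hx : x ∈ Z.overlap i j) :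
    Z.chart j (Z.transition i j x) = Z.chart i x :=
  Function.invFun_eq hx

theorem line_mk (i : Z.Chart) (x : Z.Coord i) {v : Fin n → ℂ} (hv : v ≠ 0) :
    Z.line i x (Projectivization.mk ℂ v hv) = Submodule.span ℂ {Z.frame i x v} := by
  rw [line, Projectivization.submodule_mk, LinearMap.map_span, Set.image_singleton]

namespace IsGood

variable (hZ : Z.IsGood)
include hZ

theorem transition_eq {i j : Z.Chart} {x : Z.Coord i} {y : Z.Coord j}
    (h : Z.chart i x = Z.chart j y) : Z.transition i j x = y :=
  hZ.inj j ((chart_transition (mem_overlap h)).trans h)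

theorem eventually_overlap {i j : Z.Chart} {x : Z.Coord i} (hx : x ∈ Z.overlap i j) :
    ∀ᶠ y in 𝓝 x, Z.chart j (Z.transition i j y) = Z.chart i y := by
  filter_upwards [(hZ.isOpen_overlap i j).mem_nhds hx] with y hy using chart_transition hy

theorem hasFDerivAt_transition {i j : Z.Chart} {x : Z.Coord i} (hx : x ∈ Z.overlap i j) :
    HasFDerivAt (Z.transition i j) (fderiv ℂ (Z.transition i j) x) x :=
  (hZ.transition_an i j x hx).differentiableAt.hasFDerivAt

theorem fderiv_transition_self (i : Z.Chart) (x : Z.Coord i) :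
    fderiv ℂ (Z.transition i i) x = ContinuousLinearMap.id ℂ (Z.Coord i) := by
  have : Z.transition i i = id := by
    ext y; exact hZ.transition_eq rfl
  rw [this, fderiv_id]

theorem fderiv_transition_comp {i j k : Z.Chart} {x : Z.Coord i} {y : Z.Coord j} {z : Z.Coord k}
    (h : Z.chart i x = Z.chart j y) (h' : Z.chart j y = Z.chart k z) :
    (fderiv ℂ (Z.transition j k) y).comp (fderiv ℂ (Z.transition i j) x) =
      fderiv ℂ (Z.transition i k) x := by
  have hy := hZ.transition_eq h
  have h1 := hZ.hasFDerivAt_transition (mem_overlap h)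
  have h2 := hZ.hasFDerivAt_transition (mem_overlap h')
  rw [← hy] at h2
  have h3 := h2.comp x h1
  have h4 : Z.transition i k =ᶠ[𝓝 x] Z.transition j k ∘ Z.transition i j := by
    filter_upwards [hZ.eventually_overlap (mem_overlap h),
      hZ.eventually_overlap (mem_overlap (h.trans h'))] with w hw hw'
    refine (hZ.transition_eq ?_).symm
    rw [hw, hw']
  have h5 := h3.congr_of_eventuallyEq h4
  rw [h5.fderiv, hy]

theorem fderiv_transition_symm {i j : Z.Chart} {x : Z.Coord i} {y : Z.Coord j}
    (h : Z.chart i x = Z.chart j y) (v : Z.Coord i) :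
    fderiv ℂ (Z.transition j i) y (fderiv ℂ (Z.transition i j) x v) = v := by
  have := hZ.fderiv_transition_comp h h.symm
  rw [hZ.fderiv_transition_self] at this
  exact congrArg (fun f => f v) this

/-- The cocycle identity for derivatives of transition maps. It lets equality in the quotient
defining the prolongation be read as `SameLine` itself rather than as the relation it generates. -/
theorem sameLine_equivalence : Equivalence Z.SameLine where
  refl p := ⟨rfl, by
    rw [hZ.fderiv_transition_self]; exact Submodule.map_id _⟩
  symm := by
    rintro p q ⟨h, h'⟩
    refine ⟨h.symm, ?_⟩
    rw [← h', ← Submodule.map_comp]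
    convert Submodule.map_id _
    ext v
    exact hZ.fderiv_transition_symm h v
  trans := by
    rintro p q r ⟨h1, h2⟩ ⟨h3, h4⟩
    refine ⟨h1.trans h3, ?_⟩
    rw [← h4, ← h2, ← Submodule.map_comp, ← hZ.fderiv_transition_comp h1 h3]
    rfl

theorem mkPt_eq_iff_sameLine {i j : Z.Chart} {x : Z.Coord i} {y : Z.Coord j}
    {l l' : ℙ ℂ (Fin n → ℂ)} :
    Z.mkPt i x l = Z.mkPt j y l' ↔ Z.SameLine ⟨i, x, l⟩ ⟨j, y, l'⟩ :=
  hZ.sameLine_equivalence.quot_mk_eq_iff _ _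

theorem line_injective (i : Z.Chart) (x : Z.Coord i) : Function.Injective (Z.line i x) := by
  intro l l' h
  exact Projectivization.submodule_injective (Submodule.map_injective_of_injective (hZ.frame_inj i x) h)

theorem mkPt_inj {i : Z.Chart} {x y : Z.Coord i} {l l' : ℙ ℂ (Fin n → ℂ)} :
    Z.mkPt i x l = Z.mkPt i y l' ↔ x = y ∧ l = l' := by
  constructor
  · intro h
    obtain ⟨h1, h2⟩ := hZ.mkPt_eq_iff_sameLine.1 h
    have hxy : x = y := hZ.inj i h1
    subst hxy
    refine ⟨rfl, hZ.line_injective i x ?_⟩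
    dsimp only at h2
    rw [hZ.fderiv_transition_self] at h2
    rw [← h2]
    exact (Submodule.map_id _).symm
  · rintro ⟨rfl, rfl⟩; rfl

/-- The matrix relating the frames of two charts on their overlap. -/
def frameChange (i j : Z.Chart) : Z.Coord i → (Fin n → ℂ) →ₗ[ℂ] (Fin n → ℂ) :=
  (hZ.exists_frameChange i j).choose

theorem frameChange_an {i j : Z.Chart} {x : Z.Coord i} (hx : x ∈ Z.overlap i j)
    (v : Fin n → ℂ) : AnalyticAt ℂ (fun y => hZ.frameChange i j y v) x :=
  ((hZ.exists_frameChange i j).choose_spec x hx).1 v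

theorem fderiv_frame {i j : Z.Chart} {x : Z.Coord i} {y : Z.Coord j}
    (h : Z.chart i x = Z.chart j y) (v : Fin n → ℂ) :
    fderiv ℂ (Z.transition i j) x (Z.frame i x v) = Z.frame j y (hZ.frameChange i j x v) := by
  rw [((hZ.exists_frameChange i j).choose_spec x (mem_overlap h)).2 v, hZ.transition_eq h]
  rfl

theorem frameChange_symm {i j : Z.Chart} {x : Z.Coord i} {y : Z.Coord j}
    (h : Z.chart i x = Z.chart j y) (v : Fin n → ℂ) :
    hZ.frameChange j i y (hZ.frameChange i j x v) = v := by
  apply hZ.frame_inj i x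
  rw [← hZ.fderiv_frame h.symm, ← hZ.fderiv_frame h, hZ.fderiv_transition_symm h]

theorem frameChange_ne_zero {i j : Z.Chart} {x : Z.Coord i} {y : Z.Coord j}
    (h : Z.chart i x = Z.chart j y) {v : Fin n → ℂ} (hv : v ≠ 0) :
    hZ.frameChange i j x v ≠ 0 := by
  intro h0
  apply hv
  rw [← hZ.frameChange_symm h v, h0, map_zero]

/-- Gluing of lines expressed by the frame matrix alone. All computations with transition maps of
the prolongation go through this form. -/
theorem mkPt_eq_iff {i j : Z.Chart} {x : Z.Coord i} {y : Z.Coord j}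
    {v w : Fin n → ℂ} (hv : v ≠ 0) (hw : w ≠ 0) :
    Z.mkPt i x (Projectivization.mk ℂ v hv) = Z.mkPt j y (Projectivization.mk ℂ w hw) ↔
      Z.chart i x = Z.chart j y ∧ ∃ c : ℂ, c ≠ 0 ∧ hZ.frameChange i j x v = c • w := by
  rw [hZ.mkPt_eq_iff_sameLine]
  refine and_congr_right fun h => ?_
  dsimp only at h ⊢
  rw [line_mk, line_mk, LinearMap.map_span, Set.image_singleton]
  have : (fderiv ℂ (Z.transition i j) x : Z.Coord i →ₗ[ℂ] Z.Coord j) (Z.frame i x v) =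
      Z.frame j y (hZ.frameChange i j x v) := hZ.fderiv_frame h v
  rw [this, eq_comm, Submodule.span_singleton_eq_span_singleton]
  constructor
  · rintro ⟨z, hz⟩
    refine ⟨z, z.ne_zero, hZ.frame_inj j y ?_⟩
    rw [← hz, map_smul]; rfl
  · rintro ⟨c, hc, h⟩
    exact ⟨Units.mk0 c hc, by rw [h, map_smul]; rfl⟩

end IsGood

theorem proj_mkPt (i : Z.Chart) (x : Z.Coord i) (l : ℙ ℂ (Fin n → ℂ)) :
    Z.proj (Z.mkPt i x l) = Z.chart i x := rfl

theorem prolong_chart (i : Z.Chart) (a : Fin n) (x : Z.Coord i) (u : {b : Fin n // b ≠ a} → ℂ) :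
    Z.prolong.chart (i, a) (x, u) = Z.mkPt i x (Projectivization.mk ℂ (dir a u) (dir_ne_zero a u)) :=
  rfl

theorem prolong_frame (i : Z.Chart) (a : Fin n) (x : Z.Coord i) (u : {b : Fin n // b ≠ a} → ℂ)
    (e : Fin n → ℂ) :
    Z.prolong.frame (i, a) (x, u) e = (e a • Z.frame i x (dir a u), fun b => e b.1) :=
  rfl

end DistAtlas

end

/-! ### Good atlases are preserved by prolongation -/

section

namespace DistAtlas
namespace IsGood

variable {n : ℕ} {Z : DistAtlas n} (hZ : Z.IsGood)
include hZ

theorem exists_mkPt_of_proj {i : Z.Chart} {x : Z.Coord i} {p : Z.prolong.Pt}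
    (h : Z.proj p = Z.chart i x) :
    ∃ (v : Fin n → ℂ) (hv : v ≠ 0), p = Z.mkPt i x (Projectivization.mk ℂ v hv) := by
  induction p using Quot.ind with
  | mk q =>
    obtain ⟨j, y, l⟩ := q
    induction l using Projectivization.ind with
    | h w hw =>
      have h' : Z.chart j y = Z.chart i x := h
      refine ⟨hZ.frameChange j i y w, hZ.frameChange_ne_zero h' hw, ?_⟩
      exact (hZ.mkPt_eq_iff hw (hZ.frameChange_ne_zero h' hw)).2 ⟨h', 1, one_ne_zero, by simp⟩

theorem prolong_inj (c : Z.prolong.Chart) : Function.Injective (Z.prolong.chart c) := by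
  obtain ⟨i, a⟩ := c
  rintro ⟨x, u⟩ ⟨y, w⟩ h
  rw [prolong_chart, prolong_chart, hZ.mkPt_inj] at h
  obtain ⟨rfl, h⟩ := h
  rw [Projectivization.mk_eq_mk_iff'] at h
  obtain ⟨c, hc⟩ := h
  have : c = 1 := by simpa [dir_self] using congrFun hc a
  rw [this, one_smul] at hc
  rw [dir_injective a hc]

theorem prolong_surj (p : Z.prolong.Pt) : ∃ c y, Z.prolong.chart c y = p := by
  obtain ⟨i, x, hx⟩ := hZ.surj (Z.proj p)
  obtain ⟨v, hv, rfl⟩ := hZ.exists_mkPt_of_proj hx.symm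
  obtain ⟨a, ha⟩ := Function.ne_iff.1 hv
  exact ⟨(i, a), (x, _), by rw [prolong_chart, ← mk_dir_div hv ha]⟩

theorem prolong_frame_inj (c : Z.prolong.Chart) (y : Z.prolong.Coord c) :
    Function.Injective (Z.prolong.frame c y) := by
  obtain ⟨i, a⟩ := c
  obtain ⟨x, u⟩ := y
  intro e f h
  have h1 : e a • Z.frame i x (dir a u) = f a • Z.frame i x (dir a u) := congrArg Prod.fst h
  have h2 : (fun b : {b : Fin n // b ≠ a} => e b.1) = fun b => f b.1 := congrArg Prod.snd h
  have ha : e a = f a := by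
    rw [← map_smul, ← map_smul] at h1
    simpa [dir_self] using congrFun (hZ.frame_inj i x h1) a
  ext b
  by_cases hb : b = a
  · rw [hb, ha]
  · exact congrFun h2 ⟨b, hb⟩

theorem analyticAt_prolong_frame (i : Z.Chart) (a : Fin n) (x : Z.Coord i)
    (u : {b : Fin n // b ≠ a} → ℂ) (v : Fin n → ℂ) :
    AnalyticAt ℂ (fun y : Z.Coord i × ({b : Fin n // b ≠ a} → ℂ) =>
      (v a • Z.frame i y.1 (dir a y.2), fun b : {b : Fin n // b ≠ a} => v b.1)) (x, u) := by
  have h1 : AnalyticAt ℂ (fun y : Z.Coord i × ({b : Fin n // b ≠ a} → ℂ) =>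
      Z.frame i y.1 (dir a y.2)) (x, u) :=
    analyticAt_apply_of_linear (fun w => (hZ.frame_an i x w).comp_of_eq analyticAt_fst rfl)
      (analyticAt_dir a analyticAt_snd)
  exact (analyticAt_const.smul h1).prod analyticAt_const

theorem prolong_frame_an (c : Z.prolong.Chart) (y : Z.prolong.Coord c) (v : Fin n → ℂ) :
    AnalyticAt ℂ (fun y => Z.prolong.frame c y v) y := by
  obtain ⟨i, a⟩ := c
  obtain ⟨x, u⟩ := y
  have h := hZ.analyticAt_prolong_frame i a x u v
  exact h

theorem mem_overlap_prolong {i j : Z.Chart} {a b : Fin n} {x : Z.Coord i}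
    {u : {b : Fin n // b ≠ a} → ℂ} :
    Z.prolong.chart (i, a) (x, u) ∈ Set.range (Z.prolong.chart (j, b)) ↔
      x ∈ Z.overlap i j ∧ hZ.frameChange i j x (dir a u) b ≠ 0 := by
  constructor
  · rintro ⟨⟨y, w⟩, h⟩
    rw [prolong_chart, prolong_chart, eq_comm, hZ.mkPt_eq_iff] at h
    obtain ⟨h1, c, hc, h2⟩ := h
    exact ⟨mem_overlap h1, by rw [h2]; simpa [dir_self] using hc⟩
  · rintro ⟨⟨y, hy⟩, h⟩
    have h0 := hZ.frameChange_ne_zero hy.symm (dir_ne_zero a u)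
    refine ⟨(y, fun c => hZ.frameChange i j x (dir a u) c.1 /
      hZ.frameChange i j x (dir a u) b), ?_⟩
    rw [prolong_chart, prolong_chart, ← mk_dir_div h0 h, eq_comm, hZ.mkPt_eq_iff]
    exact ⟨hy.symm, 1, one_ne_zero, by simp⟩

theorem transition_prolong {i j : Z.Chart} {a b : Fin n} {x : Z.Coord i}
    {u : {b : Fin n // b ≠ a} → ℂ} (hx : x ∈ Z.overlap i j)
    (h : hZ.frameChange i j x (dir a u) b ≠ 0) :
    Z.prolong.transition (i, a) (j, b) (x, u) = (Z.transition i j x,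
      fun c : {c : Fin n // c ≠ b} => hZ.frameChange i j x (dir a u) c.1 /
      hZ.frameChange i j x (dir a u) b) := by
  apply hZ.prolong_inj
  have hx' := chart_transition hx
  have h0 := hZ.frameChange_ne_zero hx'.symm (dir_ne_zero a u)
  rw [chart_transition (hZ.mem_overlap_prolong.2 ⟨hx, h⟩)]
  rw [prolong_chart, prolong_chart, ← mk_dir_div h0 h, hZ.mkPt_eq_iff]
  exact ⟨hx'.symm, 1, one_ne_zero, by simp⟩

theorem analyticAt_frameChange_dir {i j : Z.Chart} (a : Fin n) {x : Z.Coord i}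
    (u : {b : Fin n // b ≠ a} → ℂ) (hx : x ∈ Z.overlap i j) :
    AnalyticAt ℂ (fun y : Z.Coord i × ({b : Fin n // b ≠ a} → ℂ) =>
      hZ.frameChange i j y.1 (dir a y.2)) (x, u) :=
  analyticAt_apply_of_linear (fun w => (hZ.frameChange_an hx w).comp_of_eq analyticAt_fst rfl)
      (analyticAt_dir a analyticAt_snd)

theorem prolong_eventually_overlap {i j : Z.Chart} {a b : Fin n} {x : Z.Coord i}
    {u : {b : Fin n // b ≠ a} → ℂ} (hx : x ∈ Z.overlap i j)
    (h : hZ.frameChange i j x (dir a u) b ≠ 0) :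
    ∀ᶠ y : Z.Coord i × ({b : Fin n // b ≠ a} → ℂ) in 𝓝 (x, u), y.1 ∈ Z.overlap i j ∧
      hZ.frameChange i j y.1 (dir a y.2) b ≠ 0 := by
  have h1 := (analyticAt_pi_iff.1 (hZ.analyticAt_frameChange_dir a u hx) b).continuousAt
  have h2 : ∀ᶠ y : Z.Coord i × ({b : Fin n // b ≠ a} → ℂ) in 𝓝 (x, u), y.1 ∈ Z.overlap i j :=
    continuousAt_fst ((hZ.isOpen_overlap i j).mem_nhds hx)
  exact h2.and (h1.eventually_ne h)

theorem prolong_isOpen_overlap (c d : Z.prolong.Chart) : IsOpen (Z.prolong.overlap c d) := by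
  obtain ⟨i, a⟩ := c
  obtain ⟨j, b⟩ := d
  have key : IsOpen {y : Z.Coord i × ({b : Fin n // b ≠ a} → ℂ) |
      Z.prolong.chart (i, a) y ∈ Set.range (Z.prolong.chart (j, b))} := by
    rw [isOpen_iff_mem_nhds]
    rintro ⟨x, u⟩ hx
    obtain ⟨h1, h2⟩ := hZ.mem_overlap_prolong.1 hx
    refine mem_of_superset (hZ.prolong_eventually_overlap h1 h2) ?_
    rintro ⟨y, w⟩ hy
    exact hZ.mem_overlap_prolong.2 hy
  exact key

/-- The Hausdorff property. Base points are handled by the closed graph below. For the lines,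
proportionality is written without division, as equations that survive passage to the closure. -/
theorem prolong_isClosed_eq (c d : Z.prolong.Chart) : IsClosed {p : Z.prolong.Coord c ×
    Z.prolong.Coord d | Z.prolong.chart c p.1 = Z.prolong.chart d p.2} := by
  obtain ⟨i, a⟩ := c
  obtain ⟨j, b⟩ := d
  suffices key : closure {p : (Z.Coord i × ({b : Fin n // b ≠ a} → ℂ)) ×
      (Z.Coord j × ({c : Fin n // c ≠ b} → ℂ)) |
      Z.prolong.chart (i, a) p.1 = Z.prolong.chart (j, b) p.2} ⊆
      {p | Z.prolong.chart (i, a) p.1 = Z.prolong.chart (j, b) p.2} by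
    have h := isClosed_of_closure_subset key
    exact h
  rintro ⟨⟨x, u⟩, ⟨y, w⟩⟩ hp
  change Z.prolong.chart (i, a) (x, u) = Z.prolong.chart (j, b) (y, w)
  let f : (Z.Coord i × ({b : Fin n // b ≠ a} → ℂ)) × (Z.Coord j × ({c : Fin n // c ≠ b} → ℂ)) →
    Z.Coord i × Z.Coord j := fun p => (p.1.1, p.2.1)
  have hf : Continuous f := by fun_prop
  have h1 : Z.chart i x = Z.chart j y := by
    have h2 : f ((x, u), (y, w)) ∈ {p : Z.Coord i × Z.Coord j | Z.chart i p.1 = Z.chart j p.2} := by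
      have := hf.continuousAt.continuousWithinAt.mem_closure_image hp
      refine (hZ.isClosed_eq i j).closure_subset_iff.2 ?_ this
      rintro _ ⟨⟨⟨x', u'⟩, ⟨y', w'⟩⟩, hq, rfl⟩
      exact congrArg Z.proj hq
    exact h2
  have hx := mem_overlap h1
  rw [prolong_chart, prolong_chart, hZ.mkPt_eq_iff]
  refine ⟨h1, ?_⟩
  have key : ∀ c, hZ.frameChange i j x (dir a u) c =
      hZ.frameChange i j x (dir a u) b * dir b w c := by
    intro c
    let A : (Z.Coord i × ({b : Fin n // b ≠ a} → ℂ)) × (Z.Coord j × ({c : Fin n // c ≠ b} → ℂ)) →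
      ℂ := fun p => hZ.frameChange i j p.1.1 (dir a p.1.2) c -
        hZ.frameChange i j p.1.1 (dir a p.1.2) b * dir b p.2.2 c
    have hA : ContinuousAt A ((x, u), (y, w)) := by
      have e := (hZ.analyticAt_frameChange_dir a u hx).continuousAt
      have e1 : ∀ c, ContinuousAt (fun p : (Z.Coord i × ({b : Fin n // b ≠ a} → ℂ)) ×
          (Z.Coord j × ({c : Fin n // c ≠ b} → ℂ)) =>
          hZ.frameChange i j p.1.1 (dir a p.1.2) c) ((x, u), (y, w)) := fun c =>
        ContinuousAt.comp' (g := fun q : Z.Coord i × ({b : Fin n // b ≠ a} → ℂ) =>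
          hZ.frameChange i j q.1 (dir a q.2) c) (f := Prod.fst)
          ((continuous_apply c).continuousAt.comp e) continuousAt_fst
      have e2 : ContinuousAt (fun p : (Z.Coord i × ({b : Fin n // b ≠ a} → ℂ)) ×
          (Z.Coord j × ({c : Fin n // c ≠ b} → ℂ)) => dir b p.2.2 c) ((x, u), (y, w)) := by
        have := (analyticAt_pi_iff.1 (analyticAt_dir b
          (analyticAt_snd (𝕜 := ℂ) (p := (y, w)))) c).continuousAt
        exact ContinuousAt.comp' (g := fun q : Z.Coord j × ({c : Fin n // c ≠ b} → ℂ) =>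
          dir b q.2 c) (f := Prod.snd) this continuousAt_snd
      exact (e1 c).sub ((e1 b).mul e2)
    have h0 : A ((x, u), (y, w)) ∈ ({0} : Set ℂ) := by
      have := hA.continuousWithinAt.mem_closure_image hp
      refine isClosed_singleton.closure_subset_iff.2 ?_ this
      rintro _ ⟨⟨⟨x', u'⟩, ⟨y', w'⟩⟩, hq, rfl⟩
      have hq' : Z.prolong.chart (i, a) (x', u') = Z.prolong.chart (j, b) (y', w') := hq
      rw [prolong_chart, prolong_chart, hZ.mkPt_eq_iff] at hq'
      obtain ⟨-, d, hd, e⟩ := hq'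
      simp [A, e, dir_self]
    exact sub_eq_zero.1 h0
  -- The factor of proportionality is the `b`-th entry. Were it zero, `key` would make the whole
  -- transported vector vanish.
  refine ⟨hZ.frameChange i j x (dir a u) b, ?_, funext key⟩
  intro h0
  refine hZ.frameChange_ne_zero h1 (dir_ne_zero a u) (funext fun c => ?_)
  rw [key c, h0, zero_mul]; rfl

/-- The fibre part of the transition map between two charts of the prolongation. -/
def fiberTransition (i j : Z.Chart) (a b : Fin n)
    (y : Z.Coord i × ({b : Fin n // b ≠ a} → ℂ)) : {c : Fin n // c ≠ b} → ℂ :=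
  fun c => hZ.frameChange i j y.1 (dir a y.2) c.1 / hZ.frameChange i j y.1 (dir a y.2) b

theorem analyticAt_fiberTransition {i j : Z.Chart} {a b : Fin n} {x : Z.Coord i}
    {u : {b : Fin n // b ≠ a} → ℂ} (hx : x ∈ Z.overlap i j)
    (h : hZ.frameChange i j x (dir a u) b ≠ 0) :
    AnalyticAt ℂ (hZ.fiberTransition i j a b) (x, u) := by
  have h1 := analyticAt_pi_iff.1 (hZ.analyticAt_frameChange_dir a u hx)
  rw [analyticAt_pi_iff]
  exact fun c => (h1 c.1).div (h1 b) h

theorem transition_prolong_eventuallyEq {i j : Z.Chart} {a b : Fin n} {x : Z.Coord i}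
    {u : {b : Fin n // b ≠ a} → ℂ} (hx : x ∈ Z.overlap i j)
    (h : hZ.frameChange i j x (dir a u) b ≠ 0) :
    (fun y : Z.Coord i × ({b : Fin n // b ≠ a} → ℂ) => Z.prolong.transition (i, a) (j, b) y)
      =ᶠ[𝓝 (x, u)] fun y => (Z.transition i j y.1, hZ.fiberTransition i j a b y) := by
  filter_upwards [hZ.prolong_eventually_overlap hx h] with y hy
  exact hZ.transition_prolong hy.1 hy.2

theorem prolong_transition_an (c d : Z.prolong.Chart) (y : Z.prolong.Coord c)
    (hy : y ∈ Z.prolong.overlap c d) : AnalyticAt ℂ (Z.prolong.transition c d) y := by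
  obtain ⟨i, a⟩ := c
  obtain ⟨j, b⟩ := d
  obtain ⟨x, u⟩ := y
  obtain ⟨hx, h⟩ := hZ.mem_overlap_prolong.1 hy
  have h1 : AnalyticAt ℂ (fun y : Z.Coord i × ({b : Fin n // b ≠ a} → ℂ) =>
      (Z.transition i j y.1, hZ.fiberTransition i j a b y)) (x, u) :=
    ((hZ.transition_an i j x hx).comp_of_eq analyticAt_fst rfl).prod
      (hZ.analyticAt_fiberTransition hx h)
  have h2 := h1.congr (hZ.transition_prolong_eventuallyEq hx h).symm
  exact h2

/-- The matrix relating the frames of two charts of the prolongation. -/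
def prolongFrameChange (i j : Z.Chart) (a b : Fin n)
    (y : Z.Coord i × ({b : Fin n // b ≠ a} → ℂ)) : (Fin n → ℂ) →ₗ[ℂ] (Fin n → ℂ) :=
  LinearMap.pi fun c =>
    if h : c = b then hZ.frameChange i j y.1 (dir a y.2) b • LinearMap.proj a
    else (LinearMap.proj ⟨c, h⟩).comp
      ((fderiv ℂ (hZ.fiberTransition i j a b) y).toLinearMap.comp
        (Z.prolong.frame (i, a) y))

/-- The entry `b` of the matrix is forced by the projection to `Z`, under which only the `a`-th
frame vector survives and goes to a generator of the line. The other entries are the fibre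
components of the derivative of the transition map. -/
theorem prolong_exists_frameChange (c d : Z.prolong.Chart) :
    ∃ A : Z.prolong.Coord c → (Fin n → ℂ) →ₗ[ℂ] (Fin n → ℂ),
    ∀ x ∈ Z.prolong.overlap c d, (∀ v, AnalyticAt ℂ (fun y => A y v) x) ∧
      ∀ v, fderiv ℂ (Z.prolong.transition c d) x (Z.prolong.frame c x v) =
        Z.prolong.frame d (Z.prolong.transition c d x) (A x v) := by
  obtain ⟨i, a⟩ := c
  obtain ⟨j, b⟩ := d
  refine ⟨hZ.prolongFrameChange i j a b, ?_⟩
  rintro ⟨x, u⟩ hy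
  obtain ⟨hx, h⟩ := hZ.mem_overlap_prolong.1 hy
  constructor
  · intro v
    have key : ∀ c, AnalyticAt ℂ (fun y : Z.Coord i × ({b : Fin n // b ≠ a} → ℂ) =>
        hZ.prolongFrameChange i j a b y v c) (x, u) := by
      intro c
      by_cases hc : c = b
      · have : (fun y : Z.Coord i × ({b : Fin n // b ≠ a} → ℂ) =>
            hZ.prolongFrameChange i j a b y v c) =
            fun y => hZ.frameChange i j y.1 (dir a y.2) b * v a := by
          ext y; simp [prolongFrameChange, hc]
        rw [this]
        exact (analyticAt_pi_iff.1 (hZ.analyticAt_frameChange_dir a u hx) b).mul analyticAt_const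
      · have : (fun y : Z.Coord i × ({b : Fin n // b ≠ a} → ℂ) =>
            hZ.prolongFrameChange i j a b y v c) =
            fun y => fderiv ℂ (hZ.fiberTransition i j a b) y
              (v a • Z.frame i y.1 (dir a y.2), fun b : {b : Fin n // b ≠ a} => v b.1)
              ⟨c, hc⟩ := by
          ext y; simp only [prolongFrameChange, LinearMap.pi_apply, dif_neg hc]; rfl
        rw [this]
        have h3 := (hZ.analyticAt_fiberTransition hx h).fderiv
        have h4 := hZ.analyticAt_prolong_frame i a x u v
        have h5 := AnalyticAt.comp_of_eq ((ContinuousLinearMap.id ℂ ((Z.Coord i ×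
          ({b : Fin n // b ≠ a} → ℂ)) →L[ℂ] ({c : Fin n // c ≠ b} → ℂ))).analyticAt_bilinear
          (_, _)) (h3.prod h4) rfl
        exact analyticAt_pi_iff.1 h5 ⟨c, hc⟩
    have h := analyticAt_pi_iff.2 key
    exact h
  · intro v
    have h1 : HasFDerivAt (fun y : Z.Coord i × ({b : Fin n // b ≠ a} → ℂ) =>
        (Z.transition i j y.1, hZ.fiberTransition i j a b y))
        (((fderiv ℂ (Z.transition i j) x).comp (ContinuousLinearMap.fst ℂ _ _)).prod
          (fderiv ℂ (hZ.fiberTransition i j a b) (x, u))) (x, u) := by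
      refine HasFDerivAt.prodMk ?_ ?_
      · exact HasFDerivAt.comp (f := Prod.fst) (g := Z.transition i j) (x, u)
          (hZ.hasFDerivAt_transition hx) hasFDerivAt_fst
      · exact (hZ.analyticAt_fiberTransition hx h).differentiableAt.hasFDerivAt
    have h2 := h1.congr_of_eventuallyEq (hZ.transition_prolong_eventuallyEq hx h)
    refine (DFunLike.congr_fun h2.fderiv _).trans ?_
    have h4 : Z.prolong.transition (i, a) (j, b) (x, u) =
      (Z.transition i j x, hZ.fiberTransition i j a b (x, u)) := hZ.transition_prolong hx h
    rw [h4, prolong_frame (a := b)]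
    have hx' := (chart_transition hx).symm
    have h0 := hZ.frameChange_ne_zero hx' (dir_ne_zero a u)
    refine Prod.ext ?_ ?_
    · change fderiv ℂ (Z.transition i j) x (v a • Z.frame i x (dir a u)) = _
      have h5 : dir b (hZ.fiberTransition i j a b (x, u)) = _ := dir_div h
      rw [map_smul, hZ.fderiv_frame hx', h5, ← map_smul, ← map_smul]
      simp [prolongFrameChange, smul_smul]
      rw [mul_right_comm, mul_inv_cancel₀ h, one_mul]
    · change fderiv ℂ (hZ.fiberTransition i j a b) (x, u) (Z.prolong.frame (i, a) (x, u) v) = _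
      ext ⟨c, hc⟩
      simp only [prolongFrameChange, LinearMap.pi_apply, dif_neg hc]
      rfl

theorem prolong : Z.prolong.IsGood where
  complete c := by
    have := hZ.complete c.1
    have h : CompleteSpace (Z.Coord c.1 × ({b : Fin n // b ≠ c.2} → ℂ)) := inferInstance
    exact h
  inj := hZ.prolong_inj
  surj := hZ.prolong_surj
  frame_inj := hZ.prolong_frame_inj
  frame_an := hZ.prolong_frame_an
  isOpen_overlap := hZ.prolong_isOpen_overlap
  isClosed_eq := hZ.prolong_isClosed_eq
  transition_an := hZ.prolong_transition_an
  exists_frameChange := hZ.prolong_exists_frameChange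

end IsGood
end DistAtlas

theorem base_transition (n : ℕ) (i j : (base n).Chart) (y : (base n).Coord i) :
    (base n).transition i j y = y :=
  DistAtlas.chart_transition (Z := base n) (i := i) (j := j) ⟨y, rfl⟩

theorem base_isGood (n : ℕ) : (base n).IsGood where
  complete _ := inferInstanceAs (CompleteSpace (Fin n → ℂ))
  inj _ := fun _ _ h => h
  surj p := ⟨(), p, rfl⟩
  frame_inj _ _ := fun _ _ h => h
  frame_an _ _ _ := analyticAt_const
  isOpen_overlap i j := by
    convert isOpen_univ
    ext x
    exact ⟨fun _ => trivial, fun _ => ⟨x, rfl⟩⟩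
  isClosed_eq i j :=
    isClosed_eq (f := fun p : (Fin n → ℂ) × (Fin n → ℂ) => p.1) continuous_fst continuous_snd
  transition_an i j x _ := by
    have h : (base n).transition i j = fun y => y := funext (base_transition n i j)
    rw [h]
    exact analyticAt_id (𝕜 := ℂ) (E := Fin n → ℂ)
  exists_frameChange i j := by
    refine ⟨fun _ => LinearMap.id, fun x _ => ⟨fun v => analyticAt_const, fun v => ?_⟩⟩
    have h : (base n).transition i j = fun y => y := funext (base_transition n i j)
    rw [h]
    exact DFunLike.congr_fun (fderiv_id (𝕜 := ℂ) (E := Fin n → ℂ)) v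

theorem monster_isGood (n : ℕ) : ∀ k, (monster n k).IsGood
  | 0 => base_isGood n
  | k + 1 => (monster_isGood n k).prolong

end

/-! ### Critical hyperplanes in the charts -/

section

namespace DistAtlas

variable {n : ℕ} {Z : DistAtlas n}

namespace IsGood

variable (hZ : Z.IsGood)
include hZ

theorem mem_tangent_transition {S : Set Z.Pt} {i j : Z.Chart} {x : Z.Coord i} {y : Z.Coord j}
    (h : Z.chart i x = Z.chart j y) {v : Z.Coord i} (hv : v ∈ Z.tangent S i x) :
    fderiv ℂ (Z.transition i j) x v ∈ Z.tangent S j y := by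
  obtain ⟨c, hc, rfl, rfl, hS⟩ := hv
  have hx := mem_overlap h
  refine ⟨fun t => Z.transition i j (c t), ?_, hZ.transition_eq h, ?_, ?_⟩
  · exact (hZ.transition_an i j _ hx).comp hc
  · exact ((hZ.hasFDerivAt_transition hx).comp_hasDerivAt 0
      hc.differentiableAt.hasDerivAt).deriv
  · filter_upwards [hS, hc.continuousAt.eventually (hZ.eventually_overlap hx)] with t h1 h2
    rwa [h2]

theorem mem_plane_transition {S : Set Z.Pt} {i j : Z.Chart} {x : Z.Coord i} {y : Z.Coord j}
    (h : Z.chart i x = Z.chart j y) {v : Z.Coord i} :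
    fderiv ℂ (Z.transition i j) x v ∈ Z.plane S j y ↔ v ∈ Z.plane S i x := by
  have key : ∀ {i j : Z.Chart} {x : Z.Coord i} {y : Z.Coord j}
      (_ : Z.chart i x = Z.chart j y) {v : Z.Coord i}, v ∈ Z.plane S i x →
      fderiv ℂ (Z.transition i j) x v ∈ Z.plane S j y := by
    intro i j x y h v hv
    refine ⟨?_, hZ.mem_tangent_transition h hv.2⟩
    obtain ⟨e, rfl⟩ := hv.1
    exact ⟨_, (hZ.fderiv_frame h e).symm⟩
  refine ⟨fun hv => ?_, key h⟩
  have := key h.symm hv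
  rwa [hZ.fderiv_transition_symm h] at this

/-- The definition allows membership to be witnessed in some chart only. Invariance of `plane` under
transition maps allows testing it in any prescribed one. -/
theorem mkPt_mem_prolongSet {S : Set Z.Pt} {i : Z.Chart} {x : Z.Coord i}
    {l : ℙ ℂ (Fin n → ℂ)} :
    Z.mkPt i x l ∈ Z.prolongSet S ↔ Z.chart i x ∈ S ∧
      (Z.line i x l : Set (Z.Coord i)) ⊆ Z.plane S i x := by
  refine ⟨?_, fun h => ⟨i, x, l, rfl, h⟩⟩
  rintro ⟨j, y, l', h, hS, hl⟩
  obtain ⟨h1, h2⟩ := hZ.mkPt_eq_iff_sameLine.1 h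
  dsimp only at h1 h2
  refine ⟨by rwa [h1], fun v hv => ?_⟩
  rw [← hZ.mem_plane_transition h1]
  apply hl
  rw [← h2]
  exact ⟨v, hv, rfl⟩

end IsGood

/-- In the chart `i` the set `S` is an affine subspace whose tangent space cuts the
distribution in the hyperplane where the `c`-th frame coordinate vanishes. -/
def IsSlice (Z : DistAtlas n) (S : Set Z.Pt) (i : Z.Chart) (c : Fin n) : Prop :=
  ∃ (E : Type) (_ : NormedAddCommGroup E) (_ : NormedSpace ℂ E) (L : Z.Coord i →L[ℂ] E)
    (y₀ : Z.Coord i), (∀ y, Z.chart i y ∈ S ↔ L y = L y₀) ∧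
      ∀ y, Z.chart i y ∈ S → ∀ e, L (Z.frame i y e) = 0 ↔ e c = 0

/-- The defining linear map is constant along a curve in `S`, so it kills velocities. Conversely a
straight segment in a direction it kills stays inside `S`. -/
theorem IsSlice.mem_plane {S : Set Z.Pt} {i : Z.Chart} {c : Fin n} (hS : Z.IsSlice S i c)
    {y : Z.Coord i} (hy : Z.chart i y ∈ S) {w : Z.Coord i} :
    w ∈ Z.plane S i y ↔ ∃ e, e c = 0 ∧ Z.frame i y e = w := by
  obtain ⟨E, _, _, L, y₀, h1, h2⟩ := hS
  constructor
  · rintro ⟨⟨e, rfl⟩, ⟨γ, hγ, h0, hd, hγS⟩⟩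
    refine ⟨e, (h2 y hy e).1 ?_, rfl⟩
    have h3 : HasDerivAt (fun t => L (γ t)) (L (deriv γ 0)) 0 :=
      L.hasFDerivAt.comp_hasDerivAt 0 hγ.differentiableAt.hasDerivAt
    have h4 : (fun t => L (γ t)) =ᶠ[𝓝 0] fun _ => L y₀ := by
      filter_upwards [hγS] with t ht using (h1 _).1 ht
    rw [← hd, ← h3.deriv, h4.deriv_eq, deriv_const]
  · rintro ⟨e, he, rfl⟩
    refine ⟨⟨e, rfl⟩, fun t => y + t • Z.frame i y e, ?_, by simp, ?_, ?_⟩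
    · exact analyticAt_const.add (analyticAt_id.smul analyticAt_const)
    · have : HasDerivAt (fun t : ℂ => y + t • Z.frame i y e) ((1 : ℂ) • Z.frame i y e) 0 :=
        ((hasDerivAt_id (0 : ℂ)).smul_const _).const_add _
      rw [this.deriv, one_smul]
    · filter_upwards with t
      rw [h1, map_add, map_smul, (h2 y hy e).2 he, smul_zero, add_zero, (h1 y).1 hy]

theorem IsSlice.line_subset (hZ : Z.IsGood) {S : Set Z.Pt} {i : Z.Chart} {c : Fin n}
    (hS : Z.IsSlice S i c) {y : Z.Coord i} (hy : Z.chart i y ∈ S) {v : Fin n → ℂ} (hv : v ≠ 0) :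
    (Z.line i y (Projectivization.mk ℂ v hv) : Set (Z.Coord i)) ⊆ Z.plane S i y ↔ v c = 0 := by
  rw [line_mk]
  constructor
  · intro h
    obtain ⟨e, he, h'⟩ := (hS.mem_plane hy).1 (h (Submodule.mem_span_singleton_self _))
    rwa [← hZ.frame_inj i y h']
  · intro h w hw
    obtain ⟨a, rfl⟩ := Submodule.mem_span_singleton.1 hw
    exact (hS.mem_plane hy).2 ⟨a • v, by simp [h], by rw [map_smul]⟩

theorem IsSlice.mkPt_mem (hZ : Z.IsGood) {S : Set Z.Pt} {i : Z.Chart} {c : Fin n}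
    (hS : Z.IsSlice S i c) {y : Z.Coord i} {v : Fin n → ℂ} (hv : v ≠ 0) :
    Z.mkPt i y (Projectivization.mk ℂ v hv) ∈ Z.prolongSet S ↔ Z.chart i y ∈ S ∧ v c = 0 := by
  rw [hZ.mkPt_mem_prolongSet]
  exact and_congr_right fun hy => hS.line_subset hZ hy hv

theorem isSlice_fiber (hZ : Z.IsGood) (p : Z.Pt) (i : Z.Chart) (a : Fin n)
    (hp : p ∈ Set.range (Z.chart i)) : Z.prolong.IsSlice {q | Z.proj q = p} (i, a) a := by
  obtain ⟨x₀, rfl⟩ := hp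
  refine ⟨Z.Coord i, inferInstance, inferInstance,
    ContinuousLinearMap.fst ℂ (Z.Coord i) ({b : Fin n // b ≠ a} → ℂ), (x₀, 0), ?_, ?_⟩
  · rintro ⟨x, u⟩
    exact ⟨fun h => hZ.inj i h, fun h => congrArg (Z.chart i) h⟩
  · rintro ⟨x, u⟩ - e
    change e a • Z.frame i x (dir a u) = 0 ↔ _
    rw [← map_smul, map_eq_zero_iff _ (hZ.frame_inj i x), smul_eq_zero,
      or_iff_left (dir_ne_zero a u)]

/-- Prolonging adds the single equation `u c = 0`, and the distinguished coordinate is still `c`.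
The assumption `c ≠ a` costs nothing: the chart `(i, a)` contains only lines with non-zero `a`-th
entry, so for `c = a` it misses the prolonged set. -/
theorem IsSlice.prolong (hZ : Z.IsGood) {S : Set Z.Pt} {i : Z.Chart} {c : Fin n}
    (hS : Z.IsSlice S i c) {a : Fin n} (hac : c ≠ a) :
    Z.prolong.IsSlice (Z.prolongSet S) (i, a) c := by
  have hS' := hS
  obtain ⟨E, _, _, L, y₀, h1, h2⟩ := hS
  have hmem : ∀ (x : Z.Coord i) (u : {b : Fin n // b ≠ a} → ℂ),
      Z.prolong.chart (i, a) (x, u) ∈ Z.prolongSet S ↔ Z.chart i x ∈ S ∧ u ⟨c, hac⟩ = 0 := by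
    intro x u
    rw [prolong_chart, hS'.mkPt_mem hZ, dir_of_ne _ hac]
  refine ⟨E × ℂ, inferInstance, inferInstance,
    (L.comp (ContinuousLinearMap.fst ℂ (Z.Coord i) ({b : Fin n // b ≠ a} → ℂ))).prod
    ((ContinuousLinearMap.proj (R := ℂ) (φ := fun _ : {b : Fin n // b ≠ a} => ℂ) ⟨c, hac⟩).comp
      (ContinuousLinearMap.snd ℂ (Z.Coord i) ({b : Fin n // b ≠ a} → ℂ))), (y₀, 0), ?_, ?_⟩
  · rintro ⟨x, u⟩
    rw [hmem, h1]
    change _ ↔ (L x, u ⟨c, hac⟩) = (L y₀, (0 : ℂ))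
    rw [Prod.mk.injEq]
  · rintro ⟨x, u⟩ hx e
    obtain ⟨hx, hu⟩ := (hmem x u).1 hx
    change (L (e a • Z.frame i x (dir a u)), e c) = ((0 : E), (0 : ℂ)) ↔ _
    -- The line at the point is already tangent to `S`, so the lifted frame vector contributes
    -- nothing to the first component and only the fibre equation remains.
    have : L (Z.frame i x (dir a u)) = 0 := (h2 x hx _).2 (by rw [dir_of_ne _ hac, hu])
    rw [map_smul, this, smul_zero, Prod.mk.injEq]
    exact and_iff_right rfl

end DistAtlas

open DistAtlas

variable {n : ℕ}

/-- The frame coordinates whose vanishing defines a critical hyperplane. -/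
def active : {k : ℕ} → (i : (monster n k).Chart) → (monster n k).Coord i → Set (Fin n)
  | 0, _, _ => ∅
  | _ + 1, i, y => {c | c = i.2 ∨ (c ∈ active i.1 y.1 ∧ dir i.2 y.2 c = 0)}

/-- With the converse `exists_isBaby_of_mem_active`, this identifies the critical hyperplanes at a
point with the coordinate hyperplanes of its active indices. -/
theorem IsBaby.exists_isSlice {k : ℕ} {S : Set (Point n k)} (hS : IsBaby n k S) :
    ∀ (i : (monster n k).Chart) (y : (monster n k).Coord i), (monster n k).chart i y ∈ S →
      ∃ c ∈ active i y, (monster n k).IsSlice S i c := by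
  induction hS with
  | @fiber k p =>
    rintro ⟨i, a⟩ ⟨x, u⟩ hy
    exact ⟨a, Or.inl rfl, isSlice_fiber (monster_isGood n k) (down p) i a ⟨x, hy⟩⟩
  | @prolong k S _ ih =>
    rintro ⟨i, a⟩ ⟨x, u⟩ hy
    have hy' : (monster n k).mkPt i x (Projectivization.mk ℂ (dir a u) (dir_ne_zero a u)) ∈
      (monster n k).prolongSet S := hy
    have hx := ((monster_isGood n k).mkPt_mem_prolongSet.1 hy').1
    obtain ⟨c, hc, hs⟩ := ih i x hx
    have h0 := ((hs.mkPt_mem (monster_isGood n k) _).1 hy').2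
    refine ⟨c, Or.inr ⟨hc, h0⟩, hs.prolong (monster_isGood n k) ?_⟩
    rintro rfl
    simp [dir_self] at h0

theorem exists_isBaby_of_mem_active : ∀ {k : ℕ} (i : (monster n k).Chart)
    (y : (monster n k).Coord i) (c : Fin n), c ∈ active i y →
      ∃ S, IsBaby n k S ∧ (monster n k).chart i y ∈ S ∧ (monster n k).IsSlice S i c
  | 0, _, _, _, h => h.elim
  | k + 1, ⟨i, a⟩, ⟨x, u⟩, c, h => by
    by_cases hca : c = a
    · subst hca
      exact ⟨_, IsBaby.fiber ((monster n (k + 1)).chart (i, c) (x, u)), rfl,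
        isSlice_fiber (monster_isGood n k) _ i c ⟨x, rfl⟩⟩
    · obtain ⟨h1, h2⟩ := h.resolve_left hca
      obtain ⟨S, hS, hxS, hs⟩ := exists_isBaby_of_mem_active i x c h1
      exact ⟨_, hS.prolong, (hs.mkPt_mem (monster_isGood n k) (dir_ne_zero a u)).2 ⟨hxS, h2⟩,
        hs.prolong (monster_isGood n k) hca⟩

theorem isCritical_iff {k : ℕ} {i : (monster n k).Chart} {x : (monster n k).Coord i}
    {v : Fin n → ℂ} (hv : v ≠ 0) :
    IsCritical ((monster n k).mkPt i x (Projectivization.mk ℂ v hv)) ↔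
      ∃ c ∈ active i x, v c = 0 := by
  constructor
  · rintro ⟨j, y, l, P, h, ⟨S, hS, hyS, rfl⟩, hl⟩
    have h1 := (monster_isGood n k).mkPt_mem_prolongSet.2 ⟨hyS, hl⟩
    rw [← h] at h1
    obtain ⟨c, hc, hs⟩ := hS.exists_isSlice i x ((monster_isGood n k).mkPt_mem_prolongSet.1 h1).1
    exact ⟨c, hc, ((hs.mkPt_mem (monster_isGood n k) hv).1 h1).2⟩
  · rintro ⟨c, hc, h0⟩
    obtain ⟨S, hS, hxS, hs⟩ := exists_isBaby_of_mem_active i x c hc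
    exact ⟨i, x, _, _, rfl, ⟨S, hS, hxS, rfl⟩, (hs.line_subset (monster_isGood n k) hxS hv).2 h0⟩

theorem not_isVertical_zero (q : Point n 1) : ¬ IsVertical q := by
  rintro ⟨i, x, l, P, -, h, -⟩
  exact h

theorem isSlice_fiber_chart {k : ℕ} (i : (monster n k).Chart) (a : Fin n)
    (y : (monster n (k + 1)).Coord (i, a)) :
    (monster n (k + 1)).IsSlice (fiber ((monster n (k + 1)).chart (i, a) y)) (i, a) a :=
  isSlice_fiber (monster_isGood n k) _ i a ⟨y.1, rfl⟩

theorem isVertical_iff {k : ℕ} {i : (monster n k).Chart} {a : Fin n}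
    {x : (monster n (k + 1)).Coord (i, a)} {v : Fin n → ℂ} (hv : v ≠ 0) :
    IsVertical ((monster n (k + 1)).mkPt (i, a) x (Projectivization.mk ℂ v hv)) ↔ v a = 0 := by
  have hs := isSlice_fiber_chart i a x
  constructor
  · rintro ⟨j, y, l, P, h, rfl, hl⟩
    have h1 := (monster_isGood n (k + 1)).mkPt_mem_prolongSet
      (S := fiber ((monster n (k + 1)).chart j y)).2 ⟨rfl, hl⟩
    rw [← h, ← ((monster_isGood n (k + 1)).mkPt_eq_iff_sameLine.1 h).1] at h1
    exact ((hs.mkPt_mem (monster_isGood n (k + 1)) hv).1 h1).2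
  · intro h0
    exact ⟨_, x, _, _, rfl, rfl, (hs.line_subset (monster_isGood n (k + 1)) rfl hv).2 h0⟩

theorem exists_of_isLPoint {k : ℕ} {i : (monster n k).Chart} {a : Fin n}
    {x : (monster n (k + 1)).Coord (i, a)} {v : Fin n → ℂ} (hv : v ≠ 0)
    (h : IsLPoint (k := k + 2) ((monster n (k + 1)).mkPt (i, a) x (Projectivization.mk ℂ v hv))) :
    v a = 0 ∧ ∃ c ∈ active (k := k + 1) (i, a) x, c ≠ a ∧ v c = 0 := by
  obtain ⟨j, y, l, P, Q, h, rfl, ⟨S, hS, hyS, rfl⟩, hne, hl⟩ := h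
  have hs := isSlice_fiber_chart i a x
  have hG := monster_isGood n (k + 1)
  have hxy := (hG.mkPt_eq_iff_sameLine.1 h).1
  dsimp only at hxy
  have h1 := hG.mkPt_mem_prolongSet (S := fiber ((monster n (k + 1)).chart j y)).2
    ⟨rfl, fun w hw => (hl hw).1⟩
  have h2 := hG.mkPt_mem_prolongSet.2 ⟨hyS, fun w hw => (hl hw).2⟩
  rw [← h, ← hxy] at h1
  rw [← h] at h2
  have hxS : (monster n (k + 1)).chart (i, a) x ∈ S := by rwa [hxy]
  obtain ⟨c, hc, hs'⟩ := hS.exists_isSlice _ x hxS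
  refine ⟨((hs.mkPt_mem hG hv).1 h1).2, c, hc, ?_, ((hs'.mkPt_mem hG hv).1 h2).2⟩
  -- If the second slice had the coordinate `a` as well, its plane would coincide with the vertical
  -- one, against `Q ≠ P`.
  rintro rfl
  apply hne
  ext w
  rw [← hG.mem_plane_transition hxy.symm, ← hG.mem_plane_transition hxy.symm, ← hxy,
    hs.mem_plane rfl, hs'.mem_plane hxS]

end

section

open DistAtlas

variable {n : ℕ}

/-! ### Points given by sequences of indices and blocks -/

/-- The chart of level `k` with indices `a 1, …, a k`. -/
def chartOf : (k : ℕ) → (ℕ → Fin n) → (monster n k).Chart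
  | 0, _ => ()
  | k + 1, a => (chartOf k a, a (k + 1))

/-- The coordinates in the chart `chartOf k a` whose `j`-th block has the entries of `U j` (the
entry with index `a j` is left out for `j ≥ 1`). -/
def coordOf : (k : ℕ) → (a : ℕ → Fin n) → (ℕ → Fin n → ℂ) → (monster n k).Coord (chartOf k a)
  | 0, _, U => U 0
  | k + 1, a, U => (coordOf k a U, fun b : {b : Fin n // b ≠ a (k + 1)} => U (k + 1) b.1)

/-- The point of level `k` with the given indices and blocks. -/
def pt (k : ℕ) (a : ℕ → Fin n) (U : ℕ → Fin n → ℂ) : Point n k :=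
  (monster n k).chart (chartOf k a) (coordOf k a U)

/-- The blocks of levels `1, …, k` have the entry `1` at the index of the chart. -/
def Normalized (k : ℕ) (a : ℕ → Fin n) (U : ℕ → Fin n → ℂ) : Prop :=
  ∀ j, 1 ≤ j → j ≤ k → U j (a j) = 1

/-- The active indices at the point `pt k a U`. -/
def act : ℕ → (ℕ → Fin n) → (ℕ → Fin n → ℂ) → Set (Fin n)
  | 0, _, _ => ∅
  | k + 1, a, U => {c | c = a (k + 1) ∨ (c ∈ act k a U ∧ U (k + 1) c = 0)}

theorem mem_act_succ {k : ℕ} {a : ℕ → Fin n} {U : ℕ → Fin n → ℂ} {c : Fin n} :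
    c ∈ act (k + 1) a U ↔ c = a (k + 1) ∨ (c ∈ act k a U ∧ U (k + 1) c = 0) := Iff.rfl

theorem Normalized.mono {k l : ℕ} {a : ℕ → Fin n} {U : ℕ → Fin n → ℂ} (h : Normalized k a U)
    (hl : l ≤ k) : Normalized l a U := fun j h1 h2 => h j h1 (h2.trans hl)

theorem Normalized.ne_zero {k : ℕ} {a : ℕ → Fin n} {U : ℕ → Fin n → ℂ} (h : Normalized k a U)
    {j : ℕ} (h1 : 1 ≤ j) (h2 : j ≤ k) : U j ≠ 0 := fun h0 => by
  simpa [h0] using h j h1 h2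

theorem active_coordOf : ∀ {k : ℕ} {a : ℕ → Fin n} {U : ℕ → Fin n → ℂ}, Normalized k a U →
    active (chartOf k a) (coordOf k a U) = act k a U
  | 0, _, _, _ => rfl
  | k + 1, a, U, h => by
    ext c
    change (c = a (k + 1) ∨ c ∈ active (chartOf k a) (coordOf k a U) ∧
      dir (a (k + 1)) (fun b : {b : Fin n // b ≠ a (k + 1)} => U (k + 1) b.1) c = 0) ↔ _
    rw [active_coordOf (h.mono k.le_succ), dir_restrict (h _ (by omega) le_rfl)]
    rfl

theorem pt_congr {k : ℕ} {a a' : ℕ → Fin n} {U U' : ℕ → Fin n → ℂ}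
    (ha : ∀ j, 1 ≤ j → j ≤ k → a j = a' j) (hU : ∀ j ≤ k, U j = U' j) :
    pt k a U = pt k a' U' := by
  -- The type of the coordinates depends on the chart, so chart and coordinates have to be rewritten
  -- together, as one element of a sigma type.
  have key : ∀ k, (∀ j, 1 ≤ j → j ≤ k → a j = a' j) → (∀ j ≤ k, U j = U' j) →
      (⟨chartOf k a, coordOf k a U⟩ : Σ i, (monster n k).Coord i) =
        ⟨chartOf k a', coordOf k a' U'⟩ := by
    intro k
    induction k with
    | zero => intro _ hU; rw [coordOf, coordOf, hU 0 le_rfl]; rfl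
    | succ k ih =>
      intro ha hU
      have h1 := ih (fun j h h' => ha j h (h'.trans k.le_succ))
        (fun j h => hU j (h.trans k.le_succ))
      let f : (Σ i, (monster n k).Coord i) → Fin n → (Fin n → ℂ) →
          Σ i, (monster n (k + 1)).Coord i := fun s b w =>
        ⟨(s.1, b), (s.2, fun c : {c : Fin n // c ≠ b} => w c.1)⟩
      change f ⟨chartOf k a, coordOf k a U⟩ (a (k + 1)) (U (k + 1)) =
        f ⟨chartOf k a', coordOf k a' U'⟩ (a' (k + 1)) (U' (k + 1))
      rw [h1, ha (k + 1) (by omega) le_rfl, hU (k + 1) le_rfl]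
  exact congrArg (fun s : Σ i, (monster n k).Coord i => (monster n k).chart s.1 s.2) (key k ha hU)

theorem act_congr {k : ℕ} {a a' : ℕ → Fin n} {U U' : ℕ → Fin n → ℂ}
    (ha : ∀ j, 1 ≤ j → j ≤ k → a j = a' j) (hU : ∀ j ≤ k, U j = U' j) :
    act k a U = act k a' U' := by
  induction k with
  | zero => rfl
  | succ k ih =>
    ext c
    rw [mem_act_succ, mem_act_succ, ih (fun j h h' => ha j h (h'.trans k.le_succ))
      (fun j h => hU j (h.trans k.le_succ)), ha (k + 1) (by omega) le_rfl, hU (k + 1) le_rfl]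

theorem Normalized.congr {k : ℕ} {a a' : ℕ → Fin n} {U U' : ℕ → Fin n → ℂ}
    (h : Normalized k a U) (ha : ∀ j, 1 ≤ j → j ≤ k → a j = a' j) (hU : ∀ j ≤ k, U j = U' j) :
    Normalized k a' U' := fun j h1 h2 => by rw [← ha j h1 h2, ← hU j h2, h j h1 h2]

theorem down_pt (k : ℕ) (a : ℕ → Fin n) (U : ℕ → Fin n → ℂ) :
    down (pt (k + 1) a U) = pt k a U := rfl

/-- The point `(pt k a U, ℓ)` where `l` spans the line `ℓ` in frame coordinates. -/
def linePt (k : ℕ) (a : ℕ → Fin n) (U : ℕ → Fin n → ℂ) (l : Fin n → ℂ) (hl : l ≠ 0) :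
    Point n (k + 1) :=
  (monster n k).mkPt (chartOf k a) (coordOf k a U) (Projectivization.mk ℂ l hl)

theorem pt_succ {k : ℕ} {a : ℕ → Fin n} {U : ℕ → Fin n → ℂ} (h : Normalized (k + 1) a U) :
    pt (k + 1) a U = linePt k a U (U (k + 1)) (h.ne_zero (by omega) le_rfl) := by
  change (monster n k).mkPt _ _ (Projectivization.mk ℂ (dir (a (k + 1))
    (fun b : {b : Fin n // b ≠ a (k + 1)} => U (k + 1) b.1)) _) = _
  simp only [dir_restrict (h (k + 1) (by omega) le_rfl)]
  rfl

/-- Any index at which the line has a non-zero entry may serve as the next chart index. The normal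
forms below are obtained by choosing it well at each level. -/
theorem linePt_eq_pt {k : ℕ} {a a' : ℕ → Fin n} {U : ℕ → Fin n → ℂ} {l : Fin n → ℂ} (hl : l ≠ 0)
    (h : Normalized k a U) (ha : ∀ j, 1 ≤ j → j ≤ k → a' j = a j) (hb : l (a' (k + 1)) ≠ 0) :
    ∃ U' : ℕ → Fin n → ℂ, (∀ j ≤ k, U' j = U j) ∧ Normalized (k + 1) a' U' ∧
      linePt k a U l hl = pt (k + 1) a' U' ∧ U' (k + 1) = (l (a' (k + 1)))⁻¹ • l := by
  set U' : ℕ → Fin n → ℂ := Function.update U (k + 1) ((l (a' (k + 1)))⁻¹ • l) with hU'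
  have h1 : ∀ j ≤ k, U' j = U j := fun j hj => Function.update_of_ne (by omega) _ _
  have h2 : U' (k + 1) = (l (a' (k + 1)))⁻¹ • l := Function.update_self _ _ _
  have h3 : Normalized (k + 1) a' U' := by
    intro j hj hj'
    rcases hj'.lt_or_eq with h' | rfl
    · rw [h1 j (by omega), ha j hj (by omega), h j hj (by omega)]
    · rw [h2]; simp [hb]
  refine ⟨U', h1, h3, ?_, h2⟩
  set a'' : ℕ → Fin n := Function.update a (k + 1) (a' (k + 1)) with ha''
  have h4 : ∀ j, 1 ≤ j → j ≤ k + 1 → a' j = a'' j := by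
    intro j hj hj'
    rcases hj'.lt_or_eq with h' | rfl
    · rw [ha'', Function.update_of_ne (by omega), ha j hj (by omega)]
    · rw [ha'', Function.update_self]
  rw [pt_congr h4 fun _ _ => rfl, pt_succ (h3.congr h4 fun _ _ => rfl)]
  have h5 : (⟨chartOf k a'', coordOf k a'' U'⟩ : Σ i, (monster n k).Coord i) =
      ⟨chartOf k a, coordOf k a U⟩ := by
    have : ∀ m ≤ k, (⟨chartOf m a'', coordOf m a'' U'⟩ : Σ i, (monster n m).Coord i) =
      ⟨chartOf m a, coordOf m a U⟩ := by
      intro m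
      induction m with
      | zero => intro _; rw [coordOf, coordOf, h1 0 (by omega)]; rfl
      | succ m ih =>
        intro hm
        have h6 := ih (by omega)
        let f : (Σ i, (monster n m).Coord i) → Fin n → (Fin n → ℂ) →
            Σ i, (monster n (m + 1)).Coord i := fun s b w =>
          ⟨(s.1, b), (s.2, fun c : {c : Fin n // c ≠ b} => w c.1)⟩
        change f ⟨chartOf m a'', coordOf m a'' U'⟩ (a'' (m + 1)) (U' (m + 1)) =
          f ⟨chartOf m a, coordOf m a U⟩ (a (m + 1)) (U (m + 1))
        rw [h6, h1 (m + 1) hm, ha'', Function.update_of_ne (by omega)]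
    exact this k le_rfl
  have h7 : Projectivization.mk ℂ (U' (k + 1)) (h3.ne_zero (by omega) le_rfl) =
      Projectivization.mk ℂ l hl := by
    rw [Projectivization.mk_eq_mk_iff']
    exact ⟨_, h2.symm⟩
  exact (congrArg₂ (fun (s : Σ i, (monster n k).Coord i) l => (monster n k).mkPt s.1 s.2 l)
    h5 h7).symm

theorem exists_linePt {k : ℕ} {a : ℕ → Fin n} {U : ℕ → Fin n → ℂ} {p : Point n (k + 1)}
    (h : down p = pt k a U) : ∃ l hl, p = linePt k a U l hl :=
  (monster_isGood n k).exists_mkPt_of_proj h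

theorem surjective_pt {k : ℕ} (p : Point n k) (c : Fin n) :
    ∃ a U, Normalized k a U ∧ p = pt k a U := by
  induction k with
  -- At level `0` no index is constrained; `c` fills the unused values and also witnesses that `Fin
  -- n` is inhabited.
  | zero => exact ⟨fun _ => c, fun _ => p, fun j h h' => by omega, rfl⟩
  | succ k ih =>
    obtain ⟨a, U, hU, h⟩ := ih (down p)
    obtain ⟨l, hl, rfl⟩ := exists_linePt h
    obtain ⟨b, hb⟩ := Function.ne_iff.1 hl
    obtain ⟨U', -, h', e, -⟩ := linePt_eq_pt (a' := Function.update a (k + 1) b) hl hU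
      (fun j _ hj => Function.update_of_ne (by omega) _ _)
      (by rw [Function.update_self]; exact hb)
    exact ⟨_, U', h', e⟩

/-! ### Letters -/

theorem isCritical_linePt {k : ℕ} {a : ℕ → Fin n} {U : ℕ → Fin n → ℂ} {l : Fin n → ℂ} (hl : l ≠ 0)
    (h : Normalized k a U) : IsCritical (linePt k a U l hl) ↔ ∃ c ∈ act k a U, l c = 0 := by
  rw [← active_coordOf h]
  exact isCritical_iff hl

theorem isVertical_linePt {k : ℕ} {a : ℕ → Fin n} {U : ℕ → Fin n → ℂ} {l : Fin n → ℂ}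
    (hl : l ≠ 0) : IsVertical (linePt k a U l hl) ↔ 1 ≤ k ∧ l (a k) = 0 := by
  rcases k with _ | k
  · simp [not_isVertical_zero]
  · exact (isVertical_iff (i := chartOf k a) (a := a (k + 1)) (x := coordOf (k + 1) a U) hl).trans
      (and_iff_right (by omega)).symm

theorem isCritical_of_isVertical {k : ℕ} {a : ℕ → Fin n} {U : ℕ → Fin n → ℂ} {l : Fin n → ℂ}
    (hl : l ≠ 0) (h : Normalized k a U) (hV : IsVertical (linePt k a U l hl)) :
    IsCritical (linePt k a U l hl) := by
  obtain ⟨h1, h2⟩ := (isVertical_linePt hl).1 hV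
  obtain ⟨k, rfl⟩ := Nat.exists_eq_add_of_le' h1
  exact (isCritical_linePt hl h).2 ⟨_, Or.inl rfl, h2⟩

theorem letter_eq_V_iff {k : ℕ} (q : Point n (k + 1)) : letter q = Letter.V ↔ IsVertical q := by
  unfold letter
  split_ifs <;> simp_all

theorem letter_linePt_V {k : ℕ} {a : ℕ → Fin n} {U : ℕ → Fin n → ℂ} {l : Fin n → ℂ}
    (hl : l ≠ 0) : letter (linePt k a U l hl) = Letter.V ↔ 1 ≤ k ∧ l (a k) = 0 := by
  rw [letter_eq_V_iff, isVertical_linePt]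

theorem letter_linePt_R {k : ℕ} {a : ℕ → Fin n} {U : ℕ → Fin n → ℂ} {l : Fin n → ℂ}
    (hl : l ≠ 0) (h : Normalized k a U) :
    letter (linePt k a U l hl) = Letter.R ↔ ∀ c ∈ act k a U, l c ≠ 0 := by
  have h1 := isCritical_of_isVertical hl h
  have h2 := isCritical_linePt hl h
  have h3 : (∀ c ∈ act k a U, l c ≠ 0) ↔ ¬ ∃ c ∈ act k a U, l c = 0 := by push Not; rfl
  rw [h3, ← h2]
  unfold letter
  split_ifs with h4 h5
  · simp [h1 h4]
  · simp [h5]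
  · simp [h5]

theorem letter_linePt_T {k : ℕ} {a : ℕ → Fin n} {U : ℕ → Fin n → ℂ} {l : Fin n → ℂ}
    (hl : l ≠ 0) (h : Normalized k a U) :
    letter (linePt k a U l hl) = Letter.T ↔
      ¬ (1 ≤ k ∧ l (a k) = 0) ∧ ∃ c ∈ act k a U, l c = 0 := by
  rw [← isCritical_linePt hl h, ← isVertical_linePt (U := U) hl]
  unfold letter
  split_ifs with h4 h5 <;> simp [*]

theorem letter_pt_V {k : ℕ} {a : ℕ → Fin n} {U : ℕ → Fin n → ℂ} (h : Normalized (k + 1) a U) :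
    letter (pt (k + 1) a U) = Letter.V ↔ 1 ≤ k ∧ U (k + 1) (a k) = 0 := by
  rw [pt_succ h, letter_linePt_V]

theorem letter_pt_R {k : ℕ} {a : ℕ → Fin n} {U : ℕ → Fin n → ℂ} (h : Normalized (k + 1) a U) :
    letter (pt (k + 1) a U) = Letter.R ↔ ∀ c ∈ act k a U, U (k + 1) c ≠ 0 := by
  rw [pt_succ h, letter_linePt_R _ (h.mono k.le_succ)]

theorem letter_pt_T {k : ℕ} {a : ℕ → Fin n} {U : ℕ → Fin n → ℂ} (h : Normalized (k + 1) a U) :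
    letter (pt (k + 1) a U) = Letter.T ↔
      ¬ (1 ≤ k ∧ U (k + 1) (a k) = 0) ∧ ∃ c ∈ act k a U, U (k + 1) c = 0 := by
  rw [pt_succ h, letter_linePt_T _ (h.mono k.le_succ)]

theorem isLPoint_linePt {k : ℕ} {a : ℕ → Fin n} {U : ℕ → Fin n → ℂ} {l : Fin n → ℂ} (hl : l ≠ 0)
    (hU : Normalized (k + 1) a U) (h : IsLPoint (linePt (k + 1) a U l hl)) :
    l (a (k + 1)) = 0 ∧ ∃ c ∈ act (k + 1) a U, c ≠ a (k + 1) ∧ l c = 0 := by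
  rw [← active_coordOf hU]
  exact exists_of_isLPoint (i := chartOf k a) (a := a (k + 1)) (x := coordOf (k + 1) a U) hl h

theorem code_succ {k : ℕ} (p : Point n (k + 1)) : code p = code (down p) ++ [letter p] := rfl

theorem code_eq_append_iff {k : ℕ} (p : Point n (k + 1)) (w : List Letter) (x : Letter) :
    code p = w ++ [x] ↔ code (down p) = w ∧ letter p = x := by
  rw [code_succ]
  constructor
  · intro h
    obtain ⟨h1, h2⟩ := List.append_inj' h rfl
    exact ⟨h1, by simpa using h2⟩
  · rintro ⟨rfl, rfl⟩; rfl

/-! ### Topology -/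

theorem continuous_chart {Z : DistAtlas n} (i : Z.Chart) : Continuous (Z.chart i) := by
  rw [continuous_iff_coinduced_le]
  exact le_iSup (fun i => TopologicalSpace.coinduced (Z.chart i) inferInstance) i

/-- The topology is the finest one making all charts continuous, so the image of an open set must be
tested in every other chart. There it is open by continuity of the transition map on an open
overlap. -/
theorem isOpenMap_chart {Z : DistAtlas n} (hZ : Z.IsGood) (i : Z.Chart) :
    IsOpenMap (Z.chart i) := by
  intro O hO
  refine isOpen_iSup_iff.2 fun j => isOpen_coinduced.2 ?_
  rw [isOpen_iff_mem_nhds]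
  rintro y ⟨x, hx, hxy⟩
  have hy := mem_overlap hxy.symm
  have h1 : Z.transition j i y ∈ O := by rwa [hZ.transition_eq hxy.symm]
  filter_upwards [(hZ.transition_an j i y hy).continuousAt (hO.mem_nhds h1),
    hZ.eventually_overlap hy] with z h2 h3
  exact ⟨_, h2, h3⟩

/-- The blocks of the coordinates in the chart `chartOf k a`. -/
def blocks : (k : ℕ) → (a : ℕ → Fin n) → (monster n k).Coord (chartOf k a) → ℕ → Fin n → ℂ
  | 0, _, x => fun _ => x
  | k + 1, a, y => Function.update (blocks k a y.1) (k + 1) (dir (a (k + 1)) y.2)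

theorem coordOf_congr : ∀ {k : ℕ} {a : ℕ → Fin n} {U V : ℕ → Fin n → ℂ},
    (∀ j ≤ k, U j = V j) → coordOf k a U = coordOf k a V
  | 0, _, _, _, h => h 0 le_rfl
  | k + 1, a, U, V, h => by
    rw [coordOf, coordOf, coordOf_congr fun j hj => h j (by omega), h (k + 1) le_rfl]

theorem coordOf_blocks : ∀ {k : ℕ} {a : ℕ → Fin n} (y : (monster n k).Coord (chartOf k a)),
    coordOf k a (blocks k a y) = y
  | 0, _, _ => rfl
  | k + 1, a, ⟨y, u⟩ => by
    refine Prod.ext ?_ ?_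
    · refine Eq.trans (coordOf_congr fun j hj => ?_) (coordOf_blocks y)
      exact Function.update_of_ne (by omega) _ _
    · ext ⟨b, hb⟩
      change Function.update (blocks k a y) (k + 1) (dir (a (k + 1)) u) (k + 1) b = u ⟨b, hb⟩
      rw [Function.update_self]
      exact dir_of_ne _ hb

theorem normalized_blocks : ∀ {k : ℕ} {a : ℕ → Fin n} (y : (monster n k).Coord (chartOf k a)),
    Normalized k a (blocks k a y)
  | 0, _, _ => fun j h h' => by omega
  | k + 1, a, y => by
    intro j hj hj'
    rcases hj'.lt_or_eq with h' | rfl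
    · have := normalized_blocks y.1 j hj (by omega)
      rw [← this]
      exact congrFun (Function.update_of_ne (by omega) _ _) _
    · exact (congrFun (Function.update_self _ _ _) _).trans (dir_self _ _)

theorem blocks_coordOf : ∀ {k : ℕ} {a : ℕ → Fin n} {U : ℕ → Fin n → ℂ}, Normalized k a U →
    ∀ j ≤ k, blocks k a (coordOf k a U) j = U j
  | 0, _, _, _, j, hj => by
    obtain rfl : j = 0 := by omega
    rfl
  | k + 1, a, U, h, j, hj => by
    rcases hj.lt_or_eq with h' | rfl
    · refine Eq.trans ?_ (blocks_coordOf (h.mono k.le_succ) j (by omega))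
      exact Function.update_of_ne (by omega) _ _
    · refine (Function.update_self _ _ _).trans ?_
      exact dir_restrict (h (k + 1) (by omega) le_rfl)

theorem continuous_dir (a : Fin n) : Continuous (dir a) := by
  refine continuous_pi fun b => ?_
  by_cases hb : b = a
  · subst hb; simpa [dir_self] using continuous_const
  · simpa [dir_of_ne _ hb] using continuous_apply _

theorem continuous_blocks : ∀ (k : ℕ) (a : ℕ → Fin n), Continuous (blocks k a)
  | 0, _ => continuous_pi fun _ => continuous_id (X := Fin n → ℂ)
  | k + 1, a => by
    have h : Continuous (fun y : (monster n k).Coord (chartOf k a) ×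
        ({b : Fin n // b ≠ a (k + 1)} → ℂ) =>
        Function.update (blocks k a y.1) (k + 1) (dir (a (k + 1)) y.2)) :=
      ((continuous_blocks k a).comp continuous_fst).update _
        ((continuous_dir _).comp continuous_snd)
    exact h

theorem continuous_coordOf : ∀ (k : ℕ) (a : ℕ → Fin n), Continuous (coordOf k a)
  | 0, _ => continuous_apply (A := fun _ : ℕ => Fin n → ℂ) 0
  | k + 1, a => by
    have h : Continuous (fun U : ℕ → Fin n → ℂ => ((coordOf k a U, fun b => U (k + 1) b.1) :
        (monster n k).Coord (chartOf k a) × ({b : Fin n // b ≠ a (k + 1)} → ℂ))) :=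
      (continuous_coordOf k a).prodMk (by fun_prop)
    exact h

/-- A chart is an open map, so an open condition on blocks defines an open set of points. The
condition may look only at the blocks up to `k`, the others being invisible to `pt`. -/
theorem isOpen_setOf_pt (k : ℕ) (a : ℕ → Fin n) {C : (ℕ → Fin n → ℂ) → Prop}
    (hC : IsOpen {U | C U}) (hC' : ∀ U V, (∀ j ≤ k, U j = V j) → C U → C V) :
    IsOpen {p : Point n k | ∃ U, Normalized k a U ∧ C U ∧ p = pt k a U} := by
  have h := isOpenMap_chart (monster_isGood n k) (chartOf k a) _
    (hC.preimage (continuous_blocks k a))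
  convert h using 1
  ext p
  constructor
  · rintro ⟨U, h1, h2, rfl⟩
    exact ⟨_, hC' _ _ (fun j hj => (blocks_coordOf h1 j hj).symm) h2, rfl⟩
  · rintro ⟨y, hy, rfl⟩
    exact ⟨_, normalized_blocks y, hy, by rw [pt, coordOf_blocks]⟩

/-- Density is always proved through one-parameter perturbations of the blocks within a fixed chart.
-/
theorem pt_mem_closure {k : ℕ} {a : ℕ → Fin n} {f : ℂ → ℕ → Fin n → ℂ} (hf : Continuous f)
    {S : Set (Point n k)} (h : ∀ᶠ e in 𝓝[≠] 0, pt k a (f e) ∈ S) :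
    pt k a (f 0) ∈ closure S := by
  have h1 : Continuous fun e => pt k a (f e) :=
    (continuous_chart _).comp ((continuous_coordOf k a).comp hf)
  exact mem_closure_of_tendsto (h1.continuousAt.tendsto.mono_left nhdsWithin_le_nhds) h

end

section

variable {n : ℕ}

/-! ### Normal forms of the points of the classes -/

/-- The chart indices `a, …, a, b, …, b, c, c, …` with `s` letters `a` and `m + 1` letters `b`. -/
def ix (s m : ℕ) (a b c : Fin n) (j : ℕ) : Fin n :=
  if j ≤ s then a else if j ≤ s + m + 1 then b else c

theorem ix_left {s m j : ℕ} {a b c : Fin n} (h : j ≤ s) : ix s m a b c j = a := if_pos h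

theorem ix_mid {s m j : ℕ} {a b c : Fin n} (h : s < j) (h' : j ≤ s + m + 1) :
    ix s m a b c j = b := by
  rw [ix, if_neg (by omega), if_pos h']

theorem ix_right {s m j : ℕ} {a b c : Fin n} (h : s + m + 1 < j) : ix s m a b c j = c := by
  rw [ix, if_neg (by omega), if_neg (by omega)]

theorem act_succ_of_regular {k : ℕ} {a : ℕ → Fin n} {U : ℕ → Fin n → ℂ}
    (h : ∀ c ∈ act k a U, U (k + 1) c ≠ 0) : act (k + 1) a U = {a (k + 1)} := by
  ext c
  rw [mem_act_succ, Set.mem_singleton_iff]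
  exact or_iff_left fun h' => h c h'.1 h'.2

theorem Rs_succ (s : ℕ) : Rs (s + 1) = Rs s ++ [Letter.R] := List.replicate_succ'

theorem act_of_eq {k : ℕ} {a : ℕ → Fin n} {U : ℕ → Fin n → ℂ} (hU : Normalized (k + 1) a U)
    {x : Fin n} (ha : ∀ j, 1 ≤ j → j ≤ k + 1 → a j = x) : act (k + 1) a U = {x} := by
  induction k with
  | zero =>
    rw [act_succ_of_regular (by rintro c ⟨⟩), ha _ le_rfl le_rfl]
  | succ k ih =>
    have h1 := ih (hU.mono (by omega)) fun j h h' => ha j h (by omega)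
    rw [act_succ_of_regular, ha _ (by omega) le_rfl]
    rw [h1]
    rintro c rfl
    have := hU (k + 2) (by omega) le_rfl
    rw [ha _ (by omega) le_rfl] at this
    rw [this]; exact one_ne_zero

theorem code_of_eq {k : ℕ} {a : ℕ → Fin n} {U : ℕ → Fin n → ℂ} (hU : Normalized k a U)
    {x : Fin n} (ha : ∀ j, 1 ≤ j → j ≤ k → a j = x) : code (pt k a U) = Rs k := by
  induction k with
  | zero => rfl
  | succ k ih =>
    rw [Rs_succ, code_eq_append_iff]
    refine ⟨ih (hU.mono (by omega)) fun j h h' => ha j h (by omega), (letter_pt_R hU).2 ?_⟩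
    rcases k with _ | k
    · rintro c ⟨⟩
    · rw [act_of_eq (hU.mono (by omega)) fun j h h' => ha j h (by omega)]
      rintro c rfl
      have := hU (k + 2) (by omega) le_rfl
      rw [ha _ (by omega) le_rfl] at this
      rw [this]; exact one_ne_zero

theorem exists_pt_of_code_R {k : ℕ} {p : Point n (k + 1)} (hp : code p = Rs (k + 1)) (c : Fin n) :
    ∃ a U, Normalized (k + 1) (fun _ => a) U ∧ p = pt (k + 1) (fun _ => a) U := by
  induction k with
  | zero =>
    obtain ⟨a, U, hU, rfl⟩ := surjective_pt p c
    have h : ∀ j, 1 ≤ j → j ≤ 1 → a j = a 1 := fun j h h' => by rw [le_antisymm h' h]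
    exact ⟨a 1, U, hU.congr h fun _ _ => rfl, pt_congr h fun _ _ => rfl⟩
  | succ k ih =>
    rw [Rs_succ, code_eq_append_iff] at hp
    obtain ⟨a, U, hU, h⟩ := ih hp.1
    obtain ⟨l, hl, rfl⟩ := exists_linePt h
    have h1 := (letter_linePt_R hl hU).1 hp.2 a (Or.inl rfl)
    obtain ⟨U', -, hU', h2, -⟩ := linePt_eq_pt (a' := fun _ => a) hl hU (fun _ _ _ => rfl) h1
    exact ⟨a, U', hU', h2⟩

/-- At a vertical step the previous index `a` has entry zero, so its hyperplane persists beside the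
new vertical one. -/
theorem act_ix_zero {s : ℕ} (hs : 1 ≤ s) {a b c : Fin n} {U : ℕ → Fin n → ℂ}
    (hU : Normalized (s + 1) (ix s 0 a b c) U) (h : U (s + 1) a = 0) :
    act (s + 1) (ix s 0 a b c) U = {b, a} := by
  obtain ⟨s, rfl⟩ := Nat.exists_eq_add_of_le' hs
  ext x
  rw [mem_act_succ, act_of_eq (hU.mono (by omega)) (x := a) fun j _ h => ix_left h,
    ix_mid (by omega) (by omega)]
  simp only [Set.mem_singleton_iff, Set.mem_insert_iff]
  refine or_congr_right ⟨fun h => h.1, fun hx => ⟨hx, hx ▸ h⟩⟩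

theorem code_ix_zero {s : ℕ} (hs : 1 ≤ s) {a b c : Fin n} {U : ℕ → Fin n → ℂ}
    (hU : Normalized (s + 1) (ix s 0 a b c) U) :
    code (pt (s + 1) (ix s 0 a b c) U) = Rs s ++ [Letter.V] ↔ U (s + 1) a = 0 := by
  rw [code_eq_append_iff, letter_pt_V hU, ix_left le_rfl, down_pt]
  constructor
  · exact fun h => h.2.2
  · exact fun h => ⟨code_of_eq (hU.mono (by omega)) (x := a) fun j _ h => ix_left h, hs, h⟩

/-- The code and the active set determine each other inductively, hence the joint statement. The
first `R` after `V` kills the surviving index `a`; from then on only `b` is active, and its entry is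
`1` in this chart, so the later `R`s impose nothing. -/
theorem act_code_ix {s : ℕ} (hs : 1 ≤ s) (m : ℕ) {a b c : Fin n}
    {U : ℕ → Fin n → ℂ} (hU : Normalized (s + (m + 1) + 1) (ix s (m + 1) a b c) U) :
    (code (pt (s + (m + 1) + 1) (ix s (m + 1) a b c) U) = Rs s ++ [Letter.V] ++ Rs (m + 1) ↔
      U (s + 1) a = 0 ∧ U (s + 2) a ≠ 0) ∧
    (U (s + 1) a = 0 → U (s + 2) a ≠ 0 →
      act (s + (m + 1) + 1) (ix s (m + 1) a b c) U = {b}) := by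
  induction m with
  | zero =>
    have h0 : ∀ j, 1 ≤ j → j ≤ s + 1 → ix s 0 a b b j = ix s (0 + 1) a b c j := by
      intro j _ hj
      rcases hj.lt_or_eq with h | rfl
      · rw [ix_left (by omega), ix_left (by omega)]
      · rw [ix_mid (by omega) (by omega), ix_mid (by omega) (by omega)]
    have hU' : Normalized (s + 1) (ix s 0 a b b) U :=
      (hU.mono (by omega)).congr (fun j h h' => (h0 j h h').symm) fun _ _ => rfl
    have h1 : U (s + 2) b ≠ 0 := by
      have := hU (s + 2) (by omega) le_rfl
      rw [ix_mid (by omega) (by omega)] at this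
      rw [this]; exact one_ne_zero
    have h2 : U (s + 1) a = 0 → act (s + 1) (ix s (0 + 1) a b c) U = {b, a} := fun h => by
      rw [← act_ix_zero hs hU' h, act_congr h0 fun _ _ => rfl]
    constructor
    · rw [Rs_succ, ← List.append_assoc, code_eq_append_iff, letter_pt_R hU, down_pt]
      have h3 : code (pt (s + 1) (ix s (0 + 1) a b c) U) = Rs s ++ [Letter.V] ↔
          U (s + 1) a = 0 := by
        rw [← code_ix_zero hs hU', pt_congr h0 fun _ _ => rfl]
      have h4 : Rs s ++ [Letter.V] ++ Rs 0 = Rs s ++ [Letter.V] := by simp [Rs]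
      rw [h4]
      refine (and_congr_left' h3).trans (and_congr_right fun h => ?_)
      rw [h2 h]
      simp [h1]
    · intro h h'
      rw [act_succ_of_regular, ix_mid (by omega) (by omega)]
      rw [h2 h]
      simp [h1, h']
  | succ m ih =>
    have h0 : ∀ j, 1 ≤ j → j ≤ s + (m + 1) + 1 →
        ix s (m + 1) a b c j = ix s (m + 1 + 1) a b c j := by
      intro j _ hj
      by_cases h : j ≤ s
      · rw [ix_left h, ix_left h]
      · rw [ix_mid (by omega) (by omega), ix_mid (by omega) (by omega)]
    have hU' : Normalized (s + (m + 1) + 1) (ix s (m + 1) a b c) U :=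
      (hU.mono (by omega)).congr (fun j h h' => (h0 j h h').symm) fun _ _ => rfl
    obtain ⟨ih1, ih2⟩ := ih hU'
    rw [act_congr h0 fun _ _ => rfl] at ih2
    rw [pt_congr h0 fun _ _ => rfl] at ih1
    have h1 : U (s + (m + 1) + 1 + 1) b ≠ 0 := by
      have := hU (s + (m + 1) + 1 + 1) (by omega) le_rfl
      rw [ix_mid (by omega) (by omega)] at this
      rw [this]; exact one_ne_zero
    constructor
    · rw [Rs_succ, ← List.append_assoc, code_eq_append_iff]
      refine (and_congr_left' ih1).trans (and_iff_left_of_imp fun h => ?_)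
      refine (letter_pt_R (k := s + (m + 1) + 1) hU).2 ?_
      rw [ih2 h.1 h.2]
      simpa using h1
    · intro h h'
      refine (act_succ_of_regular (k := s + (m + 1) + 1) ?_).trans ?_
      · rw [ih2 h h']
        simpa using h1
      · rw [ix_mid (by omega) (by omega)]

/-- The last chart index is always active, so an `R` allows it to be kept, while a `V` forces it to
change. The index `c` is irrelevant up to this level and is left free for the next step. -/
theorem exists_pt_of_code_RVR {s : ℕ} (hs : 1 ≤ s) (m : ℕ) {p : Point n (s + m + 1)}
    (hp : code p = Rs s ++ [Letter.V] ++ Rs m) (c₀ : Fin n) :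
    ∃ a b, a ≠ b ∧ ∃ U, ∀ c, Normalized (s + m + 1) (ix s m a b c) U ∧
      p = pt (s + m + 1) (ix s m a b c) U := by
  induction m with
  | zero =>
    have h4 : Rs s ++ [Letter.V] ++ Rs 0 = Rs s ++ [Letter.V] := by simp [Rs]
    rw [h4, code_eq_append_iff] at hp
    obtain ⟨s, rfl⟩ := Nat.exists_eq_add_of_le' hs
    obtain ⟨a, U, hU, h⟩ := exists_pt_of_code_R hp.1 c₀
    obtain ⟨l, hl, rfl⟩ := exists_linePt h
    have h1 := ((letter_linePt_V hl).1 hp.2).2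
    obtain ⟨b, hb⟩ := Function.ne_iff.1 hl
    have hab : a ≠ b := by rintro rfl; exact hb h1
    obtain ⟨U', -, hU', h2, -⟩ := linePt_eq_pt (a' := ix (s + 1) 0 a b a) hl hU
      (fun j _ hj => ix_left hj) (by rw [ix_mid (by omega) (by omega)]; exact hb)
    refine ⟨a, b, hab, U', fun c => ?_⟩
    have h0 : ∀ j, 1 ≤ j → j ≤ s + 1 + 1 → ix (s + 1) 0 a b a j = ix (s + 1) 0 a b c j := by
      intro j _ hj
      rcases hj.lt_or_eq with h | rfl
      · rw [ix_left (by omega), ix_left (by omega)]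
      · rw [ix_mid (by omega) (by omega), ix_mid (by omega) (by omega)]
    exact ⟨hU'.congr h0 fun _ _ => rfl, h2.trans (pt_congr h0 fun _ _ => rfl)⟩
  | succ m ih =>
    rw [Rs_succ, ← List.append_assoc, code_eq_append_iff] at hp
    obtain ⟨a, b, hab, U, h⟩ := ih hp.1
    refine ⟨a, b, hab, ?_⟩
    obtain ⟨hU, h⟩ := h a
    obtain ⟨l, hl, h5⟩ := exists_linePt h
    have h1 : l b ≠ 0 := by
      have := (letter_linePt_R hl hU).1 (h5 ▸ hp.2) b
      exact this (Or.inl (ix_mid (by omega) (by omega)).symm)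
    have e0 : ∀ j, 1 ≤ j → j ≤ s + m + 1 → ix s (m + 1) a b a j = ix s m a b a j := by
      intro j _ hj
      by_cases h : j ≤ s
      · rw [ix_left h, ix_left h]
      · rw [ix_mid (by omega) (by omega), ix_mid (by omega) (by omega)]
    obtain ⟨U', -, hU', h2, -⟩ := linePt_eq_pt (a' := ix s (m + 1) a b a) hl hU e0
      (by rw [ix_mid (by omega) (by omega)]; exact h1)
    refine ⟨U', fun c => ?_⟩
    have h0 : ∀ j, 1 ≤ j → j ≤ s + m + 1 + 1 → ix s (m + 1) a b a j = ix s (m + 1) a b c j := by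
      intro j _ hj
      by_cases h : j ≤ s
      · rw [ix_left h, ix_left h]
      · rw [ix_mid (by omega) (by omega), ix_mid (by omega) (by omega)]
    exact ⟨hU'.congr h0 fun _ _ => rfl, h5.trans (h2.trans (pt_congr h0 fun _ _ => rfl))⟩

theorem ix_succ_eq {s m j : ℕ} {a b c c' : Fin n} (hj : j ≤ s + m + 1) :
    ix s m a b c j = ix s m a b c' j := by
  by_cases h : j ≤ s
  · rw [ix_left h, ix_left h]
  · rw [ix_mid (by omega) (by omega), ix_mid (by omega) (by omega)]

theorem ix_self {s m j : ℕ} {a b : Fin n} (h : s < j) : ix s m a b b j = b := by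
  by_cases h' : j ≤ s + m + 1
  · exact ix_mid h h'
  · exact ix_right (by omega)

theorem exists_pt_of_code_RV {s : ℕ} (hs : 1 ≤ s) {p : Point n (s + 1)}
    (hp : code p = Rs s ++ [Letter.V]) (c₀ : Fin n) :
    ∃ a b, a ≠ b ∧ ∃ U, ∀ c, Normalized (s + 1) (ix s 0 a b c) U ∧
      p = pt (s + 1) (ix s 0 a b c) U :=
  exists_pt_of_code_RVR hs 0 (by rw [hp]; simp [Rs]) c₀

theorem exists_pt_of_mem_classRVL {s : ℕ} (hs : 1 ≤ s) {p : Point n (s + 2)}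
    (hp : p ∈ classRVL n s) (c₀ : Fin n) :
    ∃ a b c U, a ≠ b ∧ c ≠ a ∧ c ≠ b ∧ Normalized (s + 2) (ix s 0 a b c) U ∧
      U (s + 1) a = 0 ∧ U (s + 2) a = 0 ∧ U (s + 2) b = 0 ∧ p = pt (s + 2) (ix s 0 a b c) U := by
  obtain ⟨hp, hL⟩ := hp
  have hp' : code p = Rs s ++ [Letter.V] ++ [Letter.V] := by
    rw [List.append_assoc]; exact hp
  rw [code_eq_append_iff] at hp'
  obtain ⟨a, b, hab, U, h⟩ := exists_pt_of_code_RV hs hp'.1 c₀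
  obtain ⟨hU, h1⟩ := h a
  obtain ⟨l, hl, rfl⟩ := exists_linePt h1
  have h2 : U (s + 1) a = 0 := (code_ix_zero hs hU).1 (h1 ▸ hp'.1)
  obtain ⟨h3, x, hx, hxb, h4⟩ := isLPoint_linePt hl hU hL
  rw [act_ix_zero hs hU h2] at hx
  rw [ix_mid (by omega) (by omega)] at h3 hxb
  have h5 : l a = 0 := by
    rcases hx with rfl | hx
    · exact absurd rfl hxb
    · rwa [← Set.mem_singleton_iff.1 hx]
  obtain ⟨c, hc⟩ := Function.ne_iff.1 hl
  obtain ⟨U', h6, hU', h7, h8⟩ := linePt_eq_pt (a' := ix s 0 a b c) hl hU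
    (fun j _ hj => ix_succ_eq hj) (by rw [ix_right (by omega)]; exact hc)
  refine ⟨a, b, c, U', hab, ?_, ?_, hU', ?_, ?_, ?_, h7⟩
  · rintro rfl; exact hc h5
  · rintro rfl; exact hc h3
  · rw [h6 _ le_rfl, h2]
  · rw [h8]; simp [h5]
  · rw [h8]; simp [h3]

theorem code_ix_VT {s : ℕ} (hs : 1 ≤ s) {a b : Fin n} {U : ℕ → Fin n → ℂ}
    (hU : Normalized (s + 2) (ix s 0 a b b) U) :
    code (pt (s + 2) (ix s 0 a b b) U) = Rs s ++ [Letter.V, Letter.T] ↔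
      U (s + 1) a = 0 ∧ U (s + 2) a = 0 := by
  have h0 : Rs s ++ [Letter.V, Letter.T] = Rs s ++ [Letter.V] ++ [Letter.T] := by simp
  have hb : U (s + 2) b = 1 := by
    have := hU (s + 2) (by omega) le_rfl
    rwa [ix_right (by omega)] at this
  rw [h0, code_eq_append_iff, down_pt, code_ix_zero hs (hU.mono (by omega)), letter_pt_T hU,
    ix_mid (by omega) (by omega), hb]
  refine and_congr_right fun h => ?_
  rw [act_ix_zero hs (hU.mono (by omega)) h]
  simp [hb]

theorem exists_pt_of_code_VT {s : ℕ} (hs : 1 ≤ s) {p : Point n (s + 2)}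
    (hp : code p = Rs s ++ [Letter.V, Letter.T]) (c₀ : Fin n) :
    ∃ a b U, a ≠ b ∧ Normalized (s + 2) (ix s 0 a b b) U ∧ p = pt (s + 2) (ix s 0 a b b) U := by
  have h0 : Rs s ++ [Letter.V, Letter.T] = Rs s ++ [Letter.V] ++ [Letter.T] := by simp
  rw [h0, code_eq_append_iff] at hp
  obtain ⟨a, b, hab, U, h⟩ := exists_pt_of_code_RV hs hp.1 c₀
  obtain ⟨hU, h1⟩ := h b
  obtain ⟨l, hl, rfl⟩ := exists_linePt h1
  have h2 := ((letter_linePt_T hl hU).1 hp.2).1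
  rw [ix_mid (by omega) (by omega)] at h2
  obtain ⟨U', -, hU', h7, -⟩ := linePt_eq_pt (a' := ix s 0 a b b) hl hU
    (fun _ _ _ => rfl) (by rw [ix_right (by omega)]; exact fun h => h2 ⟨by omega, h⟩)
  exact ⟨a, b, U', hab, hU', h7⟩

/-- After the second `V` the index `b` is active, and `a` stays active only if its entry vanishes
again. This is why the last condition is conditional. -/
theorem code_ix_VVR {s : ℕ} (hs : 1 ≤ s) {a b c : Fin n} {U : ℕ → Fin n → ℂ}
    (hU : Normalized (s + 3) (ix s 0 a b c) U) :
    code (pt (s + 3) (ix s 0 a b c) U) = Rs s ++ [Letter.V, Letter.V, Letter.R] ↔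
      U (s + 1) a = 0 ∧ U (s + 2) b = 0 ∧ U (s + 3) b ≠ 0 ∧ (U (s + 2) a = 0 → U (s + 3) a ≠ 0) := by
  have h0 : Rs s ++ [Letter.V, Letter.V, Letter.R] =
    Rs s ++ [Letter.V] ++ [Letter.V] ++ [Letter.R] := by simp
  have hc : U (s + 3) c = 1 := by
    have := hU (s + 3) (by omega) le_rfl
    rwa [ix_right (by omega)] at this
  rw [h0, code_eq_append_iff, code_eq_append_iff, down_pt, down_pt,
    code_ix_zero hs (hU.mono (by omega)), letter_pt_R hU, letter_pt_V (hU.mono (by omega)),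
    ix_mid (by omega) (by omega), and_assoc, and_assoc]
  refine and_congr_right fun h => ?_
  have h1 : ∀ x, x ∈ act (s + 2) (ix s 0 a b c) U ↔
      x = c ∨ ((x = b ∨ x = a) ∧ U (s + 2) x = 0) := by
    intro x
    rw [mem_act_succ, act_ix_zero hs (hU.mono (by omega)) h, ix_right (by omega)]
    simp
  simp only [h1]
  constructor
  · rintro ⟨-, h2, h3⟩
    exact ⟨h2, h3 b (Or.inr ⟨Or.inl rfl, h2⟩), fun h4 => h3 a (Or.inr ⟨Or.inr rfl, h4⟩)⟩
  · rintro ⟨h2, h3, h4⟩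
    refine ⟨by omega, h2, ?_⟩
    rintro x (rfl | ⟨rfl | rfl, h5⟩)
    · rw [hc]; exact one_ne_zero
    · exact h3
    · exact h4 h5

theorem exists_pt_of_code_VVR {s : ℕ} (hs : 1 ≤ s) {p : Point n (s + 3)}
    (hp : code p = Rs s ++ [Letter.V, Letter.V, Letter.R]) (c₀ : Fin n) :
    ∃ a b c U, a ≠ b ∧ c ≠ b ∧ (c = a ∨ U (s + 2) a = 0) ∧ Normalized (s + 3) (ix s 0 a b c) U ∧
      p = pt (s + 3) (ix s 0 a b c) U := by
  have h0 : Rs s ++ [Letter.V, Letter.V, Letter.R] =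
    Rs s ++ [Letter.V] ++ [Letter.V] ++ [Letter.R] := by simp
  rw [h0, code_eq_append_iff, code_eq_append_iff] at hp
  obtain ⟨⟨hp1, hp2⟩, hp3⟩ := hp
  obtain ⟨a, b, hab, U, h⟩ := exists_pt_of_code_RV hs hp1 c₀
  obtain ⟨hU, h1⟩ := h b
  obtain ⟨l, hl, h2⟩ := exists_linePt h1
  rw [h2] at hp2
  have h3 := ((letter_linePt_V hl).1 hp2).2
  rw [ix_mid (by omega) (by omega)] at h3
  -- The index `a` is preferred whenever its entry is non-zero. The remaining points are exceptional
  -- and are dealt with later by perturbing that entry.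
  have h4 : ∃ c, l c ≠ 0 ∧ (c = a ∨ l a = 0) := by
    by_cases h : l a = 0
    · obtain ⟨c, hc⟩ := Function.ne_iff.1 hl
      exact ⟨c, hc, Or.inr h⟩
    · exact ⟨a, h, Or.inl rfl⟩
  obtain ⟨c, hc, hca⟩ := h4
  obtain ⟨U', -, hU', h5, h6⟩ := linePt_eq_pt (a' := ix s 0 a b c) hl hU
    (fun j _ hj => ix_succ_eq hj) (by rw [ix_right (by omega)]; exact hc)
  obtain ⟨l', hl', rfl⟩ := exists_linePt (h2.trans h5)
  have h7 := (letter_linePt_R hl' hU').1 hp3 c (Or.inl (ix_right (by omega)).symm)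
  obtain ⟨U'', h8, hU'', h9, -⟩ := linePt_eq_pt (a' := ix s 0 a b c) hl' hU'
    (fun _ _ _ => rfl) (by rw [ix_right (by omega)]; exact h7)
  refine ⟨a, b, c, U'', hab, ?_, ?_, hU'', h9⟩
  · rintro rfl; exact hc h3
  · refine hca.imp_right fun h => ?_
    rw [h8 _ le_rfl, h6]; simp [h]

theorem code_ix_VRVRR {s m : ℕ} (hs : 1 ≤ s) (hm : 1 ≤ m) {a b c : Fin n}
    {U : ℕ → Fin n → ℂ} (hU : Normalized (s + m + 4) (ix s m a b c) U) :
    code (pt (s + m + 4) (ix s m a b c) U) =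
      Rs s ++ [Letter.V] ++ Rs m ++ [Letter.V, Letter.R, Letter.R] ↔
      U (s + 1) a = 0 ∧ U (s + 2) a ≠ 0 ∧ U (s + m + 2) b = 0 ∧ U (s + m + 3) b ≠ 0 := by
  have h0 : Rs s ++ [Letter.V] ++ Rs m ++ [Letter.V, Letter.R, Letter.R] =
    Rs s ++ [Letter.V] ++ Rs m ++ [Letter.V] ++ [Letter.R] ++ [Letter.R] := by simp
  have hc : ∀ j, s + m + 1 < j → j ≤ s + m + 4 → U j c = 1 := by
    intro j h h'
    simpa [ix_right h] using hU j (by omega) h'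
  obtain ⟨m, rfl⟩ := Nat.exists_eq_add_of_le' hm
  obtain ⟨e1, e2⟩ := act_code_ix hs m (hU.mono (by omega))
  rw [h0, code_eq_append_iff, code_eq_append_iff, code_eq_append_iff, down_pt, down_pt, down_pt,
    e1, letter_pt_R hU, letter_pt_R (hU.mono (by omega)), letter_pt_V (hU.mono (by omega)),
    ix_mid (by omega) (by omega), and_assoc, and_assoc, and_assoc]
  refine and_congr_right fun h => and_congr_right fun h' => ?_
  have h1 : ∀ x, x ∈ act (s + (m + 1) + 2) (ix s (m + 1) a b c) U ↔
      x = c ∨ (x = b ∧ U (s + (m + 1) + 2) x = 0) := by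
    intro x
    rw [mem_act_succ, e2 h h', ix_right (by omega)]
    simp
  have h2 : (∀ x ∈ act (s + (m + 1) + 2) (ix s (m + 1) a b c) U, U (s + (m + 1) + 2 + 1) x ≠ 0) →
      act (s + (m + 1) + 3) (ix s (m + 1) a b c) U = {c} := by
    intro h
    rw [act_succ_of_regular h, ix_right (by omega)]
  constructor
  · rintro ⟨⟨-, h3⟩, h4, -⟩
    exact ⟨h3, h4 b ((h1 b).2 (Or.inr ⟨rfl, h3⟩))⟩
  · rintro ⟨h3, h4⟩
    have h5 : ∀ x ∈ act (s + (m + 1) + 2) (ix s (m + 1) a b c) U,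
        U (s + (m + 1) + 2 + 1) x ≠ 0 := by
      intro x hx
      rcases (h1 x).1 hx with rfl | ⟨rfl, -⟩
      · rw [hc _ (by omega) (by omega)]; exact one_ne_zero
      · exact h4
    refine ⟨⟨by omega, h3⟩, h5, ?_⟩
    rw [h2 h5]
    rintro x rfl
    rw [hc _ (by omega) (by omega)]; exact one_ne_zero

theorem exists_pt_of_code_VRVRR {s m : ℕ} (hs : 1 ≤ s) {p : Point n (s + m + 4)}
    (hp : code p = Rs s ++ [Letter.V] ++ Rs m ++ [Letter.V, Letter.R, Letter.R]) (c₀ : Fin n) :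
    ∃ a b c U, a ≠ b ∧ c ≠ b ∧ (c = a ∨ U (s + m + 2) a = 0) ∧
      Normalized (s + m + 4) (ix s m a b c) U ∧ p = pt (s + m + 4) (ix s m a b c) U := by
  have h0 : Rs s ++ [Letter.V] ++ Rs m ++ [Letter.V, Letter.R, Letter.R] =
    Rs s ++ [Letter.V] ++ Rs m ++ [Letter.V] ++ [Letter.R] ++ [Letter.R] := by simp
  rw [h0, code_eq_append_iff, code_eq_append_iff, code_eq_append_iff] at hp
  obtain ⟨⟨⟨hp1, hp2⟩, hp3⟩, hp4⟩ := hp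
  obtain ⟨a, b, hab, U, h⟩ := exists_pt_of_code_RVR hs m hp1 c₀
  obtain ⟨hU, h1⟩ := h b
  obtain ⟨l, hl, h2⟩ := exists_linePt h1
  rw [h2] at hp2
  have h3 := ((letter_linePt_V hl).1 hp2).2
  rw [ix_mid (by omega) (by omega)] at h3
  have h4 : ∃ c, l c ≠ 0 ∧ (c = a ∨ l a = 0) := by
    by_cases h : l a = 0
    · obtain ⟨c, hc⟩ := Function.ne_iff.1 hl
      exact ⟨c, hc, Or.inr h⟩
    · exact ⟨a, h, Or.inl rfl⟩
  obtain ⟨c, hc, hca⟩ := h4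
  obtain ⟨U', -, hU', h5, h6⟩ := linePt_eq_pt (a' := ix s m a b c) hl hU
    (fun j _ hj => ix_succ_eq hj) (by rw [ix_right (by omega)]; exact hc)
  obtain ⟨l', hl', h10⟩ := exists_linePt (h2.trans h5)
  rw [h10] at hp3
  have h7 := (letter_linePt_R hl' hU').1 hp3 c (Or.inl (ix_right (by omega)).symm)
  obtain ⟨U'', h8, hU'', h9, -⟩ := linePt_eq_pt (a' := ix s m a b c) hl' hU'
    (fun _ _ _ => rfl) (by rw [ix_right (by omega)]; exact h7)
  obtain ⟨l'', hl'', rfl⟩ := exists_linePt (h10.trans h9)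
  have h11 := (letter_linePt_R hl'' hU'').1 hp4 c (Or.inl (ix_right (by omega)).symm)
  obtain ⟨U₃, h12, hU₃, h13, -⟩ := linePt_eq_pt (a' := ix s m a b c) hl'' hU''
    (fun _ _ _ => rfl) (by rw [ix_right (by omega)]; exact h11)
  refine ⟨a, b, c, U₃, hab, ?_, ?_, hU₃, h13⟩
  · rintro rfl; exact hc h3
  · refine hca.imp_right fun h => ?_
    rw [h12 _ (by omega), h8 _ le_rfl, h6]; simp [h]

end

section

variable {n : ℕ}

/-! ### Open dense subsets of the classes -/

theorem exists_ne_ne (hn : 3 ≤ n) (a b : Fin n) : ∃ d : Fin n, d ≠ a ∧ d ≠ b := by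
  have h : ({a, b} : Finset (Fin n)).card < (Finset.univ : Finset (Fin n)).card := by
    rw [Finset.card_univ, Fintype.card_fin]
    exact lt_of_le_of_lt Finset.card_le_two (by omega)
  obtain ⟨d, -, hd⟩ := Finset.exists_mem_notMem_of_card_lt_card h
  simp only [Finset.mem_insert, Finset.mem_singleton, not_or] at hd
  exact ⟨d, hd⟩

/-- The blocks `U` with `e` added to the entry `d` of the block `k`. -/
def bump (U : ℕ → Fin n → ℂ) (k : ℕ) (d : Fin n) (e : ℂ) : ℕ → Fin n → ℂ :=
  Function.update U k (Function.update (U k) d (U k d + e))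

theorem bump_of_ne {U : ℕ → Fin n → ℂ} {k j : ℕ} {d : Fin n} {e : ℂ} (h : j ≠ k) :
    bump U k d e j = U j := Function.update_of_ne h _ _

theorem bump_apply_of_ne {U : ℕ → Fin n → ℂ} {k j : ℕ} {d x : Fin n} {e : ℂ} (h : x ≠ d) :
    bump U k d e j x = U j x := by
  by_cases hj : j = k
  · subst hj
    rw [bump, Function.update_self, Function.update_of_ne h]
  · rw [bump_of_ne hj]

theorem bump_self (U : ℕ → Fin n → ℂ) (k : ℕ) (d : Fin n) (e : ℂ) :
    bump U k d e k d = U k d + e := by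
  rw [bump, Function.update_self, Function.update_self]

theorem bump_zero (U : ℕ → Fin n → ℂ) (k : ℕ) (d : Fin n) : bump U k d 0 = U := by
  simp [bump]

theorem continuous_bump (U : ℕ → Fin n → ℂ) (k : ℕ) (d : Fin n) : Continuous (bump U k d) :=
  continuous_const.update _ (continuous_const.update _ (continuous_const.add continuous_id))

theorem Normalized.bump {k l : ℕ} {α : ℕ → Fin n} {U : ℕ → Fin n → ℂ} (h : Normalized k α U)
    {d : Fin n} (hd : α l ≠ d) (e : ℂ) : Normalized k α (bump U l d e) := by
  intro j h1 h2
  by_cases hj : j = l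
  · subst hj
    rw [bump_apply_of_ne hd, h j h1 h2]
  · rw [bump_of_ne hj, h j h1 h2]

theorem eventually_add_ne (z w : ℂ) : ∀ᶠ e in 𝓝[≠] (0 : ℂ), z + e ≠ w := by
  by_cases h : z = w
  · subst h
    filter_upwards [self_mem_nhdsWithin] with e he
    simpa using he
  · refine nhdsWithin_le_nhds ?_
    have : ContinuousAt (fun e : ℂ => z + e) 0 := by fun_prop
    exact this.eventually_ne (by simpa using h)

theorem exists_open_dense {k : ℕ} {X W : Set (Point n k)} (hW : IsOpen W)
    (hX : ∀ p ∈ X, p ∈ closure (X ∩ W)) :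
    ∃ U : Set X, IsOpen U ∧ Dense U ∧ ∀ p ∈ U, p.1 ∈ W := by
  refine ⟨Subtype.val ⁻¹' W, hW.preimage continuous_subtype_val, ?_, fun p hp => hp⟩
  rw [Subtype.dense_iff, Subtype.image_preimage_coe]
  exact hX

theorem isOpen_entry_ne (k : ℕ) (d : Fin n) {f : (ℕ → Fin n → ℂ) → ℂ} (hf : Continuous f) :
    IsOpen {U : ℕ → Fin n → ℂ | U k d ≠ f U} :=
  isOpen_ne_fun (by fun_prop) hf

theorem exists_generic_VT (hn : 3 ≤ n) {s : ℕ} (hs : 1 ≤ s) :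
    ∃ O : Set (rvtClass n (s + 2) (Rs s ++ [Letter.V, Letter.T])), IsOpen O ∧ Dense O ∧
      ∀ p ∈ O, ∃ a b d U, a ≠ b ∧ d ≠ a ∧ d ≠ b ∧ Normalized (s + 2) (ix s 0 a b b) U ∧
        U (s + 1) a = 0 ∧ U (s + 2) a = 0 ∧ U (s + 2) d ≠ 0 ∧
        p.1 = pt (s + 2) (ix s 0 a b b) U := by
  let W : Set (Point n (s + 2)) := {p | ∃ a b d, a ≠ b ∧ d ≠ a ∧ d ≠ b ∧
    ∃ U, Normalized (s + 2) (ix s 0 a b b) U ∧ U (s + 2) d ≠ 0 ∧ p = pt (s + 2) (ix s 0 a b b) U}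
  have hW : IsOpen W := by
    refine isOpen_iff_forall_mem_open.2 ?_
    rintro p ⟨a, b, d, h1, h2, h3, hp⟩
    refine ⟨_, fun q hq => ⟨a, b, d, h1, h2, h3, hq⟩, isOpen_setOf_pt (s + 2) (ix s 0 a b b)
      (isOpen_entry_ne (s + 2) d continuous_const) ?_, hp⟩
    intro U V h hU
    rwa [← h (s + 2) le_rfl]
  have hD : ∀ p ∈ rvtClass n (s + 2) (Rs s ++ [Letter.V, Letter.T]),
      p ∈ closure (rvtClass n (s + 2) (Rs s ++ [Letter.V, Letter.T]) ∩ W) := by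
    intro p hp
    obtain ⟨a, b, U, hab, hU, rfl⟩ := exists_pt_of_code_VT hs hp ⟨0, by omega⟩
    obtain ⟨d, hda, hdb⟩ := exists_ne_ne hn a b
    have hc := (code_ix_VT hs hU).1 hp
    rw [← bump_zero U (s + 2) d]
    refine pt_mem_closure (continuous_bump U (s + 2) d) ?_
    filter_upwards [eventually_add_ne (U (s + 2) d) 0] with e he
    have hN : Normalized (s + 2) (ix s 0 a b b) (bump U (s + 2) d e) :=
      hU.bump (by rw [ix_self (by omega)]; exact hdb.symm) e
    refine ⟨(code_ix_VT hs hN).2 ?_, a, b, d, hab, hda, hdb, _, hN, ?_, rfl⟩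
    · rwa [bump_apply_of_ne hda.symm, bump_apply_of_ne hda.symm]
    · rwa [bump_self]
  obtain ⟨O, h1, h2, h3⟩ := exists_open_dense hW hD
  refine ⟨O, h1, h2, fun p hp => ?_⟩
  obtain ⟨a, b, d, h4, h5, h6, U, h7, h8, h9⟩ := h3 p hp
  have h10 : code p.1 = _ := p.2
  rw [h9, code_ix_VT hs h7] at h10
  exact ⟨a, b, d, U, h4, h5, h6, h7, h10.1, h10.2, h8, h9⟩

theorem exists_pt_of_letter_R {k : ℕ} {α : ℕ → Fin n} {U : ℕ → Fin n → ℂ}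
    (hU : Normalized (k + 1) α U) (hα : α (k + 2) = α (k + 1)) {p : Point n (k + 2)}
    (hd : down p = pt (k + 1) α U) (hp : letter p = Letter.R) :
    ∃ U', Normalized (k + 2) α U' ∧ p = pt (k + 2) α U' := by
  obtain ⟨l, hl, rfl⟩ := exists_linePt hd
  have h := (letter_linePt_R hl hU).1 hp _ (Or.inl rfl)
  obtain ⟨U', -, h1, h2, -⟩ := linePt_eq_pt (a' := α) hl hU (fun _ _ _ => rfl) (by rwa [hα])
  exact ⟨U', h1, h2⟩

/-- The point is seen in the chart with last index `a` as soon as its entry there is non-zero. This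
brings perturbed exceptional points into the main chart. -/
theorem pt_ix_change {s m : ℕ} {a b c : Fin n} {U : ℕ → Fin n → ℂ}
    (hU : Normalized (s + m + 2) (ix s m a b c) U) (h : U (s + m + 2) a ≠ 0) :
    ∃ U', Normalized (s + m + 2) (ix s m a b a) U' ∧
      pt (s + m + 2) (ix s m a b c) U = pt (s + m + 2) (ix s m a b a) U' := by
  rw [pt_succ hU]
  obtain ⟨U', -, h1, h2, -⟩ := linePt_eq_pt (a' := ix s m a b a)
    (hU.ne_zero (j := s + m + 2) (by omega) le_rfl) (hU.mono (Nat.le_succ _))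
    (fun j _ hj => ix_succ_eq hj) (by rwa [ix_right (by omega)])
  exact ⟨U', h1, h2⟩

theorem exists_generic_VVR (hn : 3 ≤ n) {s : ℕ} (hs : 1 ≤ s) :
    ∃ O : Set (rvtClass n (s + 3) (Rs s ++ [Letter.V, Letter.V, Letter.R])), IsOpen O ∧ Dense O ∧
      ∀ p ∈ O, ∃ a b d U, a ≠ b ∧ d ≠ a ∧ d ≠ b ∧ Normalized (s + 3) (ix s 0 a b a) U ∧
        U (s + 1) a = 0 ∧ U (s + 2) b = 0 ∧ U (s + 3) b ≠ 0 ∧ U (s + 3) d ≠ 0 ∧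
        p.1 = pt (s + 3) (ix s 0 a b a) U := by
  let W : Set (Point n (s + 3)) := {p | ∃ a b d, a ≠ b ∧ d ≠ a ∧ d ≠ b ∧
    ∃ U, Normalized (s + 3) (ix s 0 a b a) U ∧ U (s + 3) d ≠ 0 ∧ p = pt (s + 3) (ix s 0 a b a) U}
  have hW : IsOpen W := by
    refine isOpen_iff_forall_mem_open.2 ?_
    rintro p ⟨a, b, d, h1, h2, h3, hp⟩
    refine ⟨_, fun q hq => ⟨a, b, d, h1, h2, h3, hq⟩, isOpen_setOf_pt (s + 3) (ix s 0 a b a)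
      (isOpen_entry_ne (s + 3) d continuous_const) ?_, hp⟩
    intro U V h hU
    rwa [← h (s + 3) le_rfl]
  have key : ∀ a b U, a ≠ b → Normalized (s + 3) (ix s 0 a b a) U →
      pt (s + 3) (ix s 0 a b a) U ∈ rvtClass n (s + 3) (Rs s ++ [Letter.V, Letter.V, Letter.R]) →
      pt (s + 3) (ix s 0 a b a) U ∈
        closure (rvtClass n (s + 3) (Rs s ++ [Letter.V, Letter.V, Letter.R]) ∩ W) := by
    intro a b U hab hU hp
    obtain ⟨d, hda, hdb⟩ := exists_ne_ne hn a b
    have hc := (code_ix_VVR hs hU).1 hp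
    rw [← bump_zero U (s + 3) d]
    refine pt_mem_closure (continuous_bump U (s + 3) d) ?_
    filter_upwards [eventually_add_ne (U (s + 3) d) 0] with e he
    have hN : Normalized (s + 3) (ix s 0 a b a) (bump U (s + 3) d e) :=
      hU.bump (by rw [ix_right (by omega)]; exact hda.symm) e
    refine ⟨(code_ix_VVR hs hN).2 ?_, a, b, d, hab, hda, hdb, _, hN, ?_, rfl⟩
    · simpa only [bump_apply_of_ne hda.symm, bump_apply_of_ne hdb.symm] using hc
    · rwa [bump_self]
  have hD : ∀ p ∈ rvtClass n (s + 3) (Rs s ++ [Letter.V, Letter.V, Letter.R]),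
      p ∈ closure (rvtClass n (s + 3) (Rs s ++ [Letter.V, Letter.V, Letter.R]) ∩ W) := by
    intro p hp
    obtain ⟨a, b, c, U, hab, hcb, hca, hU, rfl⟩ := exists_pt_of_code_VVR hs hp ⟨0, by omega⟩
    by_cases h : c = a
    · subst h; exact key c b U hab hU hp
    have h0 := hca.resolve_left h
    obtain ⟨c1, c2, c3, c4⟩ := (code_ix_VVR hs hU).1 hp
    -- Two successive perturbations: making the entry `a` non-zero moves the point into the chart
    -- handled by `key`, and the points reached there are in turn limits of generic ones.
    rw [← closure_closure, ← bump_zero U (s + 2) a]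
    refine pt_mem_closure (continuous_bump U (s + 2) a) ?_
    filter_upwards [eventually_add_ne (U (s + 2) a) 0] with e he
    have hN : Normalized (s + 3) (ix s 0 a b c) (bump U (s + 2) a e) :=
      hU.bump (by rw [ix_right (by omega)]; exact h) e
    have h4 : bump U (s + 2) a e (s + 2) a ≠ 0 := by rwa [bump_self]
    have hX := (code_ix_VVR hs hN).2 ⟨by rwa [bump_of_ne (by omega)],
      by rwa [bump_apply_of_ne hab.symm], by rwa [bump_apply_of_ne hab.symm], fun h => absurd h h4⟩
    obtain ⟨U', h5, h6⟩ := pt_ix_change (hN.mono (Nat.le_succ _)) h4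
    have h7 : letter (pt (s + 3) (ix s 0 a b c) (bump U (s + 2) a e)) = Letter.R := by
      have h0 : Rs s ++ [Letter.V, Letter.V, Letter.R] =
        Rs s ++ [Letter.V, Letter.V] ++ [Letter.R] := by simp
      rw [h0, code_eq_append_iff] at hX
      exact hX.2
    obtain ⟨U'', h8, h9⟩ := exists_pt_of_letter_R (k := s + 1)
      (p := pt (s + 3) (ix s 0 a b c) (bump U (s + 2) a e)) h5
      (by rw [ix_right (by omega), ix_right (by omega)]) h6 h7
    rw [h9] at hX ⊢
    exact key a b U'' hab h8 hX
  obtain ⟨O, h1, h2, h3⟩ := exists_open_dense hW hD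
  refine ⟨O, h1, h2, fun p hp => ?_⟩
  obtain ⟨a, b, d, h4, h5, h6, U, h7, h8, h9⟩ := h3 p hp
  have h10 : code p.1 = _ := p.2
  rw [h9, code_ix_VVR hs h7] at h10
  exact ⟨a, b, d, U, h4, h5, h6, h7, h10.1, h10.2.1, h10.2.2.1, h8, h9⟩

theorem exists_generic_VRVRR (hn : 3 ≤ n) {s m : ℕ} (hs : 1 ≤ s) (hm : 1 ≤ m) :
    ∃ O : Set (rvtClass n (s + m + 4)
        (Rs s ++ [Letter.V] ++ Rs m ++ [Letter.V, Letter.R, Letter.R])), IsOpen O ∧ Dense O ∧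
      ∀ p ∈ O, ∃ a b d U, a ≠ b ∧ d ≠ a ∧ d ≠ b ∧ Normalized (s + m + 4) (ix s m a b a) U ∧
        U (s + 1) a = 0 ∧ U (s + 2) a ≠ 0 ∧ U (s + m + 2) b = 0 ∧
        U (s + m + 2) d * U (s + 2) a ≠ U (s + 2) d ∧
        p.1 = pt (s + m + 4) (ix s m a b a) U := by
  set X := rvtClass n (s + m + 4)
    (Rs s ++ [Letter.V] ++ Rs m ++ [Letter.V, Letter.R, Letter.R]) with hX
  let W : Set (Point n (s + m + 4)) := {p | ∃ a b d, a ≠ b ∧ d ≠ a ∧ d ≠ b ∧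
    ∃ U, Normalized (s + m + 4) (ix s m a b a) U ∧ U (s + m + 2) d * U (s + 2) a ≠ U (s + 2) d ∧
      p = pt (s + m + 4) (ix s m a b a) U}
  have hW : IsOpen W := by
    refine isOpen_iff_forall_mem_open.2 ?_
    rintro p ⟨a, b, d, h1, h2, h3, hp⟩
    refine ⟨_, fun q hq => ⟨a, b, d, h1, h2, h3, hq⟩, isOpen_setOf_pt (s + m + 4) (ix s m a b a)
      (isOpen_ne_fun (by fun_prop) (by fun_prop)) ?_, hp⟩
    intro U V h hU
    rwa [← h (s + m + 2) (by omega), ← h (s + 2) (by omega)]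
  have key : ∀ a b U, a ≠ b → Normalized (s + m + 4) (ix s m a b a) U →
      pt (s + m + 4) (ix s m a b a) U ∈ X →
      pt (s + m + 4) (ix s m a b a) U ∈ closure (X ∩ W) := by
    intro a b U hab hU hp
    obtain ⟨d, hda, hdb⟩ := exists_ne_ne hn a b
    have hc := (code_ix_VRVRR hs hm hU).1 hp
    rw [← bump_zero U (s + m + 2) d]
    refine pt_mem_closure (continuous_bump U (s + m + 2) d) ?_
    -- The quotient is the only value of the entry `d` at which the generic inequality fails; it
    -- makes sense because `U (s + 2) a ≠ 0` on this class.
    filter_upwards [eventually_add_ne (U (s + m + 2) d) (U (s + 2) d / U (s + 2) a)] with e he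
    have hN : Normalized (s + m + 4) (ix s m a b a) (bump U (s + m + 2) d e) :=
      hU.bump (by rw [ix_right (by omega)]; exact hda.symm) e
    refine ⟨(code_ix_VRVRR hs hm hN).2 ?_, a, b, d, hab, hda, hdb, _, hN, ?_, rfl⟩
    · simpa only [bump_apply_of_ne hda.symm, bump_apply_of_ne hdb.symm] using hc
    · rw [bump_self, bump_of_ne (by omega)]
      exact fun h => he ((eq_div_iff hc.2.1).2 h)
  have hD : ∀ p ∈ X,
      p ∈ closure (X ∩ W) := by
    intro p hp
    obtain ⟨a, b, c, U, hab, hcb, hca, hU, rfl⟩ := exists_pt_of_code_VRVRR hs hp ⟨0, by omega⟩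
    by_cases h : c = a
    · subst h; exact key c b U hab hU hp
    have h0 := hca.resolve_left h
    obtain ⟨c1, c2, c3, c4⟩ := (code_ix_VRVRR hs hm hU).1 hp
    rw [← closure_closure, ← bump_zero U (s + m + 2) a]
    refine pt_mem_closure (continuous_bump U (s + m + 2) a) ?_
    filter_upwards [eventually_add_ne (U (s + m + 2) a) 0] with e he
    have hN : Normalized (s + m + 4) (ix s m a b c) (bump U (s + m + 2) a e) :=
      hU.bump (by rw [ix_right (by omega)]; exact h) e
    have h4 : bump U (s + m + 2) a e (s + m + 2) a ≠ 0 := by rwa [bump_self]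
    have hX' : pt (s + m + 4) (ix s m a b c) (bump U (s + m + 2) a e) ∈ X :=
      (code_ix_VRVRR hs hm hN).2 ⟨by rwa [bump_of_ne (by omega)],
        by rwa [bump_of_ne (by omega)], by rwa [bump_apply_of_ne hab.symm],
        by rwa [bump_apply_of_ne hab.symm]⟩
    obtain ⟨U', h5, h6⟩ := pt_ix_change (hN.mono (by omega)) h4
    have h7 : letter (pt (s + m + 4) (ix s m a b c) (bump U (s + m + 2) a e)) = Letter.R ∧
        letter (pt (s + m + 3) (ix s m a b c) (bump U (s + m + 2) a e)) = Letter.R := by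
      have h0 : Rs s ++ [Letter.V] ++ Rs m ++ [Letter.V, Letter.R, Letter.R] =
        Rs s ++ [Letter.V] ++ Rs m ++ [Letter.V] ++ [Letter.R] ++ [Letter.R] := by simp
      have h8 : code _ = _ := hX'
      rw [h0, code_eq_append_iff, code_eq_append_iff] at h8
      exact ⟨h8.2, h8.1.2⟩
    obtain ⟨U'', h8, h9⟩ := exists_pt_of_letter_R (k := s + m + 1)
      (p := pt (s + m + 3) (ix s m a b c) (bump U (s + m + 2) a e)) h5
      (by rw [ix_right (by omega), ix_right (by omega)]) h6 h7.2
    obtain ⟨U₃, h10, h11⟩ := exists_pt_of_letter_R (k := s + m + 2)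
      (p := pt (s + m + 4) (ix s m a b c) (bump U (s + m + 2) a e)) h8
      (by rw [ix_right (by omega), ix_right (by omega)]) h9 h7.1
    rw [h11] at hX' ⊢
    exact key a b U₃ hab h10 hX'
  obtain ⟨O, h1, h2, h3⟩ := exists_open_dense hW hD
  refine ⟨O, h1, h2, fun p hp => ?_⟩
  obtain ⟨a, b, d, h4, h5, h6, U, h7, h8, h9⟩ := h3 p hp
  have h10 : code p.1 = _ := p.2
  rw [h9, code_ix_VRVRR hs hm h7] at h10
  exact ⟨a, b, d, U, h4, h5, h6, h7, h10.1, h10.2.1, h10.2.2.1, h8, h9⟩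

end

section

open DistAtlas

variable {n : ℕ}

/-! ### Prolonged curves in coordinates -/

/-- The frame coordinates, at level `j`, of the velocity of a prolonged curve with blocks `U`. -/
def vel (a : ℕ → Fin n) (U : ℕ → ℂ → Fin n → ℂ) : ℕ → ℂ → Fin n → ℂ
  | 0, t => fun b => deriv (fun t => U 0 t b) t
  | j + 1, t => fun b =>
      if b = a (j + 1) then vel a U j t b else deriv (fun t => U (j + 1) t b) t

/-- The functions `U 0, …, U k` are the blocks of the prolongations of the curve `U 0`. -/
structure Jet (k : ℕ) (a : ℕ → Fin n) (U : ℕ → ℂ → Fin n → ℂ) : Prop where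
  an : ∀ j ≤ k, ∀ b, AnalyticAt ℂ (fun t => U j t b) 0
  norm : ∀ t, Normalized k a fun j => U j t
  rel : ∀ j < k, ∀ᶠ t in 𝓝 (0 : ℂ), vel a U j t = vel a U j t (a (j + 1)) • U (j + 1) t
  ne : ∀ j < k, ∀ᶠ t in 𝓝[≠] (0 : ℂ), vel a U j t (a (j + 1)) ≠ 0

theorem vel_succ_self (a : ℕ → Fin n) (U : ℕ → ℂ → Fin n → ℂ) (j : ℕ) (t : ℂ) :
    vel a U (j + 1) t (a (j + 1)) = vel a U j t (a (j + 1)) := by simp [vel]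

theorem vel_succ_of_ne {a : ℕ → Fin n} {U : ℕ → ℂ → Fin n → ℂ} {j : ℕ} {t : ℂ} {b : Fin n}
    (h : b ≠ a (j + 1)) : vel a U (j + 1) t b = deriv (fun t => U (j + 1) t b) t := by
  simp [vel, h]

theorem vel_congr {a : ℕ → Fin n} {U V : ℕ → ℂ → Fin n → ℂ} : ∀ {j : ℕ}, (∀ i ≤ j, U i = V i) →
    vel a U j = vel a V j
  | 0, h => by ext t b; simp only [vel, h 0 le_rfl]
  | j + 1, h => by
    ext t b
    simp only [vel, h (j + 1) le_rfl, vel_congr fun i hi => h i (Nat.le_succ_of_le hi)]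

namespace Jet

variable {k : ℕ} {a : ℕ → Fin n} {U : ℕ → ℂ → Fin n → ℂ}

theorem mono (h : Jet k a U) {l : ℕ} (hl : l ≤ k) : Jet l a U where
  an j hj := h.an j (hj.trans hl)
  norm t := (h.norm t).mono hl
  rel j hj := h.rel j (hj.trans_le hl)
  ne j hj := h.ne j (hj.trans_le hl)

theorem analyticAt_vel (h : Jet k a U) : ∀ {j : ℕ}, j ≤ k → ∀ b,
    AnalyticAt ℂ (fun t => vel a U j t b) 0
  | 0, hj, b => (h.an 0 hj b).deriv
  | j + 1, hj, b => by
    by_cases hb : b = a (j + 1)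
    · simpa [vel, hb] using analyticAt_vel h (Nat.le_of_succ_le hj) (a (j + 1))
    · simpa [vel, hb] using (h.an (j + 1) hj b).deriv

theorem analyticAt_coordOf (h : Jet k a U) {l : ℕ} (hl : l ≤ k) :
    AnalyticAt ℂ (fun t => coordOf l a fun j => U j t) 0 := by
  induction l with
  | zero =>
    have h1 : AnalyticAt ℂ (fun t => U 0 t) 0 := analyticAt_pi_iff.2 (h.an 0 hl)
    exact h1
  | succ l ih =>
    have h1 : AnalyticAt ℂ (fun t => ((coordOf l a fun j => U j t, fun b => U (l + 1) t b.1) :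
        (monster n l).Coord (chartOf l a) × ({b : Fin n // b ≠ a (l + 1)} → ℂ))) 0 :=
      (ih (Nat.le_of_succ_le hl)).prod (analyticAt_pi_iff.2 fun b => h.an (l + 1) hl b.1)
    exact h1

/-- The curve is integral: `rel` says that the velocity at level `l` is a multiple of the next
block, which is the horizontal part of the frame at level `l + 1`. -/
theorem hasDerivAt_coordOf (h : Jet k a U) {l : ℕ} (hl : l ≤ k) :
    ∀ᶠ t in 𝓝 (0 : ℂ), HasDerivAt (fun t => coordOf l a fun j => U j t)
      ((monster n l).frame (chartOf l a) (coordOf l a fun j => U j t) (vel a U l t)) t := by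
  induction l with
  | zero =>
    have h1 : ∀ᶠ t in 𝓝 (0 : ℂ), ∀ b, AnalyticAt ℂ (fun t => U 0 t b) t :=
      eventually_all.2 fun b => (h.an 0 hl b).eventually_analyticAt
    filter_upwards [h1] with t ht
    have h2 : HasDerivAt (fun t => U 0 t) (fun b => deriv (fun t => U 0 t b) t) t :=
      hasDerivAt_pi.2 fun b => (ht b).differentiableAt.hasDerivAt
    exact h2
  | succ l ih =>
    have h1 : ∀ᶠ t in 𝓝 (0 : ℂ), ∀ b, AnalyticAt ℂ (fun t => U (l + 1) t b) t :=
      eventually_all.2 fun b => (h.an (l + 1) hl b).eventually_analyticAt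
    filter_upwards [ih (Nat.le_of_succ_le hl), h1, h.rel l hl] with t h2 h3 h4
    have h5 : HasDerivAt (fun t => fun b : {b : Fin n // b ≠ a (l + 1)} => U (l + 1) t b.1)
        (fun b => vel a U (l + 1) t b.1) t :=
      hasDerivAt_pi.2 fun b => by
        rw [vel_succ_of_ne b.2]
        exact (h3 b.1).differentiableAt.hasDerivAt
    have h6 := h2.prodMk h5
    have h7 : (monster n l).frame (chartOf l a) (coordOf l a fun j => U j t) (vel a U l t) =
        vel a U (l + 1) t (a (l + 1)) • (monster n l).frame (chartOf l a)
          (coordOf l a fun j => U j t) (dir (a (l + 1))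
            fun b : {b : Fin n // b ≠ a (l + 1)} => U (l + 1) t b.1) := by
      rw [dir_restrict ((h.norm t).mono hl (l + 1) (by omega) le_rfl), ← map_smul, vel_succ_self,
        ← h4]
    rw [h7] at h6
    exact h6

end Jet

namespace DistAtlas.IsGood

variable {Z : DistAtlas n} (hZ : Z.IsGood)
include hZ

theorem exists_represents {σ : ℂ → Z.Pt} {i j : Z.Chart} {F : ℂ → Z.Coord i}
    (hF : Z.Represents σ i F) {y : Z.Coord j} (hy : σ 0 = Z.chart j y) :
    ∃ G, Z.Represents σ j G ∧ G 0 = y := by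
  have h0 : Z.chart i (F 0) = Z.chart j y := by rw [← hF.2.self_of_nhds, hy]
  refine ⟨fun t => Z.transition i j (F t), ⟨?_, ?_⟩, hZ.transition_eq h0⟩
  · exact (hZ.transition_an i j _ (mem_overlap h0)).comp hF.1
  · filter_upwards [hF.2, hF.1.continuousAt.eventually
      (hZ.eventually_overlap (mem_overlap h0))] with t h1 h2
    rw [h1, h2]

theorem fderiv_transition_deriv {i j : Z.Chart} {F : ℂ → Z.Coord i} {G : ℂ → Z.Coord j}
    (hF : AnalyticAt ℂ F 0) (h : ∀ᶠ t in 𝓝 (0 : ℂ), Z.chart i (F t) = Z.chart j (G t)) :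
    ∀ᶠ t in 𝓝 (0 : ℂ), fderiv ℂ (Z.transition i j) (F t) (deriv F t) = deriv G t := by
  have := hZ.complete i
  filter_upwards [h.eventually_nhds, hF.eventually_analyticAt] with t h1 h2
  have h3 : G =ᶠ[𝓝 t] fun s => Z.transition i j (F s) := by
    filter_upwards [h1] with s hs using (hZ.transition_eq hs).symm
  rw [h3.deriv_eq]
  exact ((hZ.hasFDerivAt_transition (mem_overlap h1.self_of_nhds)).comp_hasDerivAt t
    h2.differentiableAt.hasDerivAt).deriv.symm

/-- Prolongation controls the projection only for `t ≠ 0`. The value at `0` is recovered as a limit,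
which needs the Hausdorff property. -/
theorem proj_eq_of_isProlongation {σ : ℂ → Z.Pt} {τ : ℂ → Z.prolong.Pt}
    (h : Z.IsProlongation σ τ) {j : Z.Chart} {G : ℂ → Z.Coord j} (hG : ContinuousAt G 0)
    (hτ : ∀ᶠ t in 𝓝 (0 : ℂ), Z.proj (τ t) = Z.chart j (G t)) : σ 0 = Z.chart j (G 0) := by
  obtain ⟨-, i, F, hF, h1⟩ := h
  rw [hF.2.self_of_nhds]
  have h2 : Tendsto (fun t => (F t, G t)) (𝓝[≠] 0) (𝓝 (F 0, G 0)) :=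
    ((hF.1.continuousAt.prodMk hG).tendsto).mono_left nhdsWithin_le_nhds
  have h3 : (F 0, G 0) ∈ {p : Z.Coord i × Z.Coord j | Z.chart i p.1 = Z.chart j p.2} := by
    refine (hZ.isClosed_eq i j).mem_of_tendsto h2 ?_
    filter_upwards [h1, nhdsWithin_le_nhds hτ] with t ht ht'
    obtain ⟨-, l, -, hl⟩ := ht
    rw [hl, proj_mkPt] at ht'
    exact ht'
  exact h3

theorem mem_span_of_isProlongation {σ : ℂ → Z.Pt} {τ : ℂ → Z.prolong.Pt}
    (h : Z.IsProlongation σ τ) {j : Z.Chart} {G : ℂ → Z.Coord j} {v : ℂ → Fin n → ℂ}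
    (hv : ∀ t, v t ≠ 0) (hσ : ∀ᶠ t in 𝓝 (0 : ℂ), σ t = Z.chart j (G t))
    (hτ : ∀ᶠ t in 𝓝 (0 : ℂ), τ t = Z.mkPt j (G t) (Projectivization.mk ℂ (v t) (hv t))) :
    ∀ᶠ t in 𝓝[≠] (0 : ℂ),
      Submodule.span ℂ {deriv G t} = Submodule.span ℂ {Z.frame j (G t) (v t)} := by
  obtain ⟨-, i, F, hF, h1⟩ := h
  have h2 := hZ.fderiv_transition_deriv (G := G) hF.1 (by
    filter_upwards [hF.2, hσ] with t h1 h2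
    rw [← h1, h2])
  filter_upwards [h1, nhdsWithin_le_nhds hτ, nhdsWithin_le_nhds h2] with t h3 h4 h5
  obtain ⟨-, l, h6, h7⟩ := h3
  have h8 := (hZ.mkPt_eq_iff_sameLine.1 (h7.symm.trans h4)).2
  dsimp only at h8
  rw [h6, line_mk, LinearMap.map_span, Set.image_singleton] at h8
  rw [← h8, ← h5]
  rfl

end DistAtlas.IsGood

theorem exists_jet {γ : ℂ → Fin n → ℂ} (hγ : AnalyticAt ℂ γ 0) :
    ∀ {k : ℕ} {σ : ℂ → Point n k} {a : ℕ → Fin n} {U₀ : ℕ → Fin n → ℂ},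
      IsIteratedProlongation γ σ → Normalized k a U₀ → σ 0 = pt k a U₀ →
      ∃ U, Jet k a U ∧ (∀ᶠ t in 𝓝 (0 : ℂ), γ t = U 0 t) ∧ (∀ j ≤ k, U j 0 = U₀ j) ∧
        ∀ᶠ t in 𝓝 (0 : ℂ), σ t = pt k a fun j => U j t
  | 0, σ, a, U₀, hσ, _, h0 => by
    have hσ' : ∀ᶠ t in 𝓝 (0 : ℂ), σ t = γ t := hσ
    refine ⟨fun _ => γ, ⟨fun _ _ => analyticAt_pi_iff.1 hγ, fun t j h h' => by omega,
      fun j hj => by omega, fun j hj => by omega⟩, Eventually.of_forall fun t => rfl, ?_, hσ'⟩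
    intro j hj
    obtain rfl : j = 0 := by omega
    exact hσ'.self_of_nhds.symm.trans h0
  | k + 1, τ, a, U₀, hτ, hU₀, h0 => by
    obtain ⟨σ, hσ, hP⟩ := hτ
    have hZ := monster_isGood n k
    obtain ⟨⟨c, G₀, hG₀⟩, -⟩ := id hP
    obtain ⟨G, hG, hG0⟩ := (monster_isGood n (k + 1)).exists_represents
      (j := chartOf (k + 1) a) hG₀ h0
    have hGan : AnalyticAt ℂ (fun t => (G t : (monster n k).Coord (chartOf k a) ×
      ({b : Fin n // b ≠ a (k + 1)} → ℂ))) 0 := hG.1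
    have hG1 : AnalyticAt ℂ (fun t => (G t).1) 0 := analyticAt_fst.comp hGan
    have hG2 : AnalyticAt ℂ (fun t => (G t).2) 0 := analyticAt_snd.comp hGan
    have hσ0 : σ 0 = pt k a U₀ := by
      rw [hZ.proj_eq_of_isProlongation hP hG1.continuousAt (by
        filter_upwards [hG.2] with t ht
        rw [ht]; rfl), hG0]
      rfl
    obtain ⟨U, hU, hγU, hU0, hσU⟩ := exists_jet hγ hσ (hU₀.mono k.le_succ) hσ0
    set V : ℕ → ℂ → Fin n → ℂ :=
      Function.update U (k + 1) (fun t => dir (a (k + 1)) (G t).2) with hV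
    have hVU : ∀ j ≤ k, V j = U j := fun j hj => Function.update_of_ne (by omega) _ _
    have hVk : V (k + 1) = fun t => dir (a (k + 1)) (G t).2 := Function.update_self _ _ _
    -- The projected chart expression and the blocks already found agree off the origin, hence
    -- everywhere near it by the identity principle.
    have hGU : ∀ᶠ t in 𝓝 (0 : ℂ), (G t).1 = coordOf k a fun j => U j t := by
      have h1 : ∀ᶠ t in 𝓝[≠] (0 : ℂ), (G t).1 = coordOf k a fun j => U j t := by
        obtain ⟨-, i, F, hF, h2⟩ := hP
        filter_upwards [h2, nhdsWithin_le_nhds hσU, nhdsWithin_le_nhds hG.2,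
          nhdsWithin_le_nhds hF.2] with t h3 h4 h5 h6
        obtain ⟨-, l, -, h7⟩ := h3
        apply hZ.inj
        have h8 : (monster n k).proj (τ t) = (monster n k).chart i (F t) := by rw [h7]; rfl
        rw [h5] at h8
        exact h8.trans (h6.symm.trans h4)
      have h2 : (fun t => (G t).1) =ᶠ[𝓝 0] fun t => coordOf k a fun j => U j t :=
        (hG1.frequently_eq_iff_eventually_eq (hU.analyticAt_coordOf le_rfl)).1 h1.frequently
      exact h2
    have hτV : ∀ᶠ t in 𝓝 (0 : ℂ), τ t = pt (k + 1) a fun j => V j t := by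
      filter_upwards [hG.2, hGU] with t h1 h2
      rw [h1]
      refine congrArg ((monster n (k + 1)).chart (chartOf (k + 1) a)) (Prod.ext ?_ ?_)
      · rw [h2]
        exact coordOf_congr fun j hj => congrFun (hVU j hj).symm t
      · funext b
        refine Eq.trans ?_ (congrFun (congrFun hVk t) b.1).symm
        exact (dir_of_ne _ b.2).symm
    have hspan := hZ.mem_span_of_isProlongation hP (j := chartOf k a)
      (G := fun t => coordOf k a fun j => U j t) (v := fun t => dir (a (k + 1)) (G t).2)
      (fun t => dir_ne_zero _ _) hσU (by
        filter_upwards [hG.2, hGU] with t h1 h2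
        rw [h1, ← h2]
        rfl)
    -- Equality of spans gives a factor between velocity and block. Since the block has entry `1` at
    -- `a (k + 1)`, that factor is the velocity entry there, and it is a unit.
    have hkey : ∀ᶠ t in 𝓝[≠] (0 : ℂ), vel a U k t (a (k + 1)) ≠ 0 ∧
        vel a U k t = vel a U k t (a (k + 1)) • dir (a (k + 1)) (G t).2 := by
      filter_upwards [hspan, nhdsWithin_le_nhds (hU.hasDerivAt_coordOf le_rfl)] with t h1 h2
      rw [h2.deriv, eq_comm, Submodule.span_singleton_eq_span_singleton] at h1
      obtain ⟨z, hz⟩ := h1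
      have h3 : (z : ℂ) • dir (a (k + 1)) (G t).2 = vel a U k t := by
        apply hZ.frame_inj _ _
        rw [map_smul]
        exact hz
      have h4 : vel a U k t (a (k + 1)) = z := by
        rw [← h3]
        exact (congrArg ((z : ℂ) * ·) (dir_self _ _)).trans (mul_one _)
      rw [h4]
      exact ⟨z.ne_zero, h3.symm⟩
    refine ⟨V, ⟨?_, ?_, ?_, ?_⟩, ?_, ?_, hτV⟩
    · intro j hj b
      rcases hj.lt_or_eq with h | rfl
      · rw [hVU j (by omega)]
        exact hU.an j (by omega) b
      · rw [hVk]
        exact analyticAt_pi_iff.1 (analyticAt_dir _ hG2) b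
    · intro t j h1 h2
      rcases h2.lt_or_eq with h | rfl
      · dsimp only
        rw [hVU j (by omega)]
        exact hU.norm t j h1 (by omega)
      · dsimp only
        rw [hVk]
        exact dir_self _ _
    · intro j hj
      rw [vel_congr fun i hi => hVU i (by omega)]
      rcases (Nat.lt_succ_iff.1 hj).lt_or_eq with h | rfl
      · rw [hVU (j + 1) (by omega)]
        exact hU.rel j h
      · have h1 : ∀ b, (fun t => vel a U j t b) =ᶠ[𝓝 0]
            fun t => vel a U j t (a (j + 1)) * dir (a (j + 1)) (G t).2 b := by
          intro b
          refine ((hU.analyticAt_vel le_rfl b).frequently_eq_iff_eventually_eq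
            ((hU.analyticAt_vel le_rfl _).mul
              (analyticAt_pi_iff.1 (analyticAt_dir _ hG2) b))).1 (Eventually.frequently ?_)
          filter_upwards [hkey] with t ht
          exact congrFun ht.2 b
        filter_upwards [eventually_all.2 h1] with t ht
        rw [hVk]
        exact funext ht
    · intro j hj
      rw [vel_congr fun i hi => hVU i (by omega)]
      rcases (Nat.lt_succ_iff.1 hj).lt_or_eq with h | rfl
      · exact hU.ne j h
      · filter_upwards [hkey] with t ht using ht.1
    · rw [hVU 0 (by omega)]
      exact hγU
    · intro j hj
      rcases hj.lt_or_eq with h | rfl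
      · rw [hVU j (by omega)]
        exact hU0 j (by omega)
      · rw [hVk]
        exact (congrArg (fun y : (monster n k).Coord (chartOf k a) ×
          ({b : Fin n // b ≠ a (k + 1)} → ℂ) => dir (a (k + 1)) y.2) hG0).trans
          (dir_restrict (hU₀ (k + 1) (by omega) le_rfl))

/-- An active index comes from a baby Monster, whose plane is given by the vanishing of that frame
coordinate. Transporting the velocity from the chart used by the regularity assumption turns
regularity into non-vanishing here. -/
theorem IsRegularCurve.vel_ne_zero {k : ℕ} {σ : ℂ → Point n k} {a : ℕ → Fin n}
    {U : ℕ → ℂ → Fin n → ℂ} (h : IsRegularCurve σ) (hU : Jet k a U)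
    (hσ : ∀ᶠ t in 𝓝 (0 : ℂ), σ t = pt k a fun j => U j t) {c : Fin n}
    (hc : c ∈ act k a fun j => U j 0) : vel a U k 0 c ≠ 0 := by
  obtain ⟨i, F, hF, -, hP⟩ := h
  have hZ := monster_isGood n k
  have h1 : ∀ᶠ t in 𝓝 (0 : ℂ), (monster n k).chart i (F t) =
      (monster n k).chart (chartOf k a) (coordOf k a fun j => U j t) := by
    filter_upwards [hF.2, hσ] with t h1 h2
    rw [← h1, h2]; rfl
  have h2 := (hZ.fderiv_transition_deriv hF.1 h1).self_of_nhds
  rw [(hU.hasDerivAt_coordOf le_rfl).self_of_nhds.deriv] at h2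
  rw [← active_coordOf (hU.norm 0)] at hc
  obtain ⟨S, hS, hxS, hs⟩ := exists_isBaby_of_mem_active _ _ c hc
  intro h0
  have h3 := (hs.mem_plane hxS).2 ⟨_, h0, rfl⟩
  rw [← h2, hZ.mem_plane_transition h1.self_of_nhds] at h3
  exact hP _ ⟨S, hS, by rwa [h1.self_of_nhds], rfl⟩ h3

theorem exists_jet_of_mem_Germ {k : ℕ} {a : ℕ → Fin n} {U₀ : ℕ → Fin n → ℂ}
    (hU₀ : Normalized k a U₀) {γ : ℂ → Fin n → ℂ} (hγ : γ ∈ Germ (pt k a U₀)) :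
    ∃ U, Jet k a U ∧ (∀ᶠ t in 𝓝 (0 : ℂ), γ t = U 0 t) ∧ (∀ j ≤ k, U j 0 = U₀ j) ∧
      ∀ c ∈ act k a U₀, vel a U k 0 c ≠ 0 := by
  obtain ⟨h1, σ, h2, h3, h4⟩ := hγ
  obtain ⟨U, hU, h5, h6, h7⟩ := exists_jet h1 h2 hU₀ h3
  refine ⟨U, hU, h5, h6, fun c hc => h4.vel_ne_zero hU h7 ?_⟩
  rwa [act_congr (fun _ _ _ => rfl) h6]

theorem Jet.isIteratedProlongation {k : ℕ} {a : ℕ → Fin n} {U : ℕ → ℂ → Fin n → ℂ}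
    (hU : Jet k a U) : IsIteratedProlongation (U 0) fun t => pt k a fun j => U j t := by
  induction k with
  | zero => exact Eventually.of_forall fun t => rfl
  | succ k ih =>
    refine ⟨_, ih (hU.mono k.le_succ), ⟨chartOf (k + 1) a, _, hU.analyticAt_coordOf le_rfl,
      Eventually.of_forall fun t => rfl⟩, chartOf k a, _,
      ⟨hU.analyticAt_coordOf k.le_succ, Eventually.of_forall fun t => rfl⟩, ?_⟩
    filter_upwards [hU.ne k k.lt_succ_self, nhdsWithin_le_nhds (hU.rel k k.lt_succ_self),
      nhdsWithin_le_nhds (hU.hasDerivAt_coordOf k.le_succ)] with t h1 h2 h3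
    have h0 : U (k + 1) t ≠ 0 := (hU.norm t).ne_zero (by omega) le_rfl
    rw [h3.deriv, h2, map_smul]
    refine ⟨?_, Projectivization.mk ℂ (U (k + 1) t) h0, ?_, pt_succ (hU.norm t)⟩
    · rw [← map_smul]
      intro h
      have := (map_eq_zero_iff _ ((monster_isGood n k).frame_inj _ _)).1 h
      exact (smul_ne_zero h1 h0) this
    · rw [line_mk]
      exact (Submodule.span_singleton_smul_eq (isUnit_iff_ne_zero.2 h1) _).symm

theorem Jet.mem_Germ {k : ℕ} {a : ℕ → Fin n} {U : ℕ → ℂ → Fin n → ℂ} (hU : Jet (k + 1) a U)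
    (h : ∀ c ∈ act (k + 1) a (fun j => U j 0), vel a U (k + 1) 0 c ≠ 0) :
    U 0 ∈ Germ (pt (k + 1) a fun j => U j 0) := by
  refine ⟨analyticAt_pi_iff.2 (hU.an 0 (by omega)), _, hU.isIteratedProlongation, rfl,
    chartOf (k + 1) a, _, ⟨hU.analyticAt_coordOf le_rfl, Eventually.of_forall fun t => rfl⟩, ?_⟩
  have h1 := (hU.hasDerivAt_coordOf le_rfl).self_of_nhds.deriv
  rw [h1]
  constructor
  · intro h0
    have := (map_eq_zero_iff _ ((monster_isGood n (k + 1)).frame_inj _ _)).1 h0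
    exact h (a (k + 1)) (Or.inl rfl) (congrFun this _)
  · rintro P ⟨S, hS, hxS, rfl⟩ hP
    obtain ⟨c, hc, hs⟩ := hS.exists_isSlice _ _ hxS
    obtain ⟨e, he, h2⟩ := (hs.mem_plane hxS).1 hP
    rw [(monster_isGood n (k + 1)).frame_inj _ _ h2] at he
    rw [active_coordOf (hU.norm 0)] at hc
    exact h c hc he

end

section

/-! ### Rings of functions with prescribed divisibility of derivatives -/

/-- `f` belongs to `tower θ B j` if `f, f'/θ, …` can be formed `j` times with final value
in `B`. -/
def tower (θ : ℂ → ℂ) (B : Set (ℂ → ℂ)) : ℕ → Set (ℂ → ℂ)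
  | 0 => B
  | j + 1 => {f | AnalyticAt ℂ f 0 ∧ ∃ h ∈ tower θ B j, deriv f =ᶠ[𝓝 0] fun t => θ t * h t}

/-- A ring of germs at `0` of analytic functions. -/
structure IsGermRing (B : Set (ℂ → ℂ)) : Prop where
  an : ∀ {f}, f ∈ B → AnalyticAt ℂ f 0
  const : ∀ c : ℂ, (fun _ => c) ∈ B
  add : ∀ {f g}, f ∈ B → g ∈ B → (fun t => f t + g t) ∈ B
  mul : ∀ {f g}, f ∈ B → g ∈ B → (fun t => f t * g t) ∈ B
  congr : ∀ {f g}, f ∈ B → f =ᶠ[𝓝 0] g → g ∈ B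

theorem deriv_mul_eventuallyEq {f g : ℂ → ℂ} (hf : AnalyticAt ℂ f 0) (hg : AnalyticAt ℂ g 0) :
    deriv (fun t => f t * g t) =ᶠ[𝓝 0] fun t => deriv f t * g t + f t * deriv g t := by
  filter_upwards [hf.eventually_analyticAt, hg.eventually_analyticAt] with t h1 h2
  exact deriv_fun_mul h1.differentiableAt h2.differentiableAt

theorem deriv_add_eventuallyEq {f g : ℂ → ℂ} (hf : AnalyticAt ℂ f 0) (hg : AnalyticAt ℂ g 0) :
    deriv (fun t => f t + g t) =ᶠ[𝓝 0] fun t => deriv f t + deriv g t := by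
  filter_upwards [hf.eventually_analyticAt, hg.eventually_analyticAt] with t h1 h2
  exact deriv_fun_add h1.differentiableAt h2.differentiableAt

theorem deriv_sum_eventuallyEq {ι : Type*} (S : Finset ι) {f : ι → ℂ → ℂ}
    (hf : ∀ i, AnalyticAt ℂ (f i) 0) :
    deriv (fun t => ∑ i ∈ S, f i t) =ᶠ[𝓝 0] fun t => ∑ i ∈ S, deriv (f i) t := by
  have h : ∀ᶠ t in 𝓝 (0 : ℂ), ∀ i ∈ S, AnalyticAt ℂ (f i) t :=
    (Finset.eventually_all S).2 fun i _ => (hf i).eventually_analyticAt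
  filter_upwards [h] with t ht
  exact deriv_fun_sum fun i hi => (ht i hi).differentiableAt

/-- Analytic germs may be cancelled by a function that does not vanish off the origin. -/
theorem eventually_eq_of_mul_eq {θ f g : ℂ → ℂ} (hθ : ∀ᶠ t in 𝓝[≠] (0 : ℂ), θ t ≠ 0)
    (hf : AnalyticAt ℂ f 0) (hg : AnalyticAt ℂ g 0)
    (h : ∀ᶠ t in 𝓝 (0 : ℂ), θ t * f t = θ t * g t) : f =ᶠ[𝓝 0] g := by
  refine (hf.frequently_eq_iff_eventually_eq hg).1 (Eventually.frequently ?_)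
  filter_upwards [hθ, nhdsWithin_le_nhds h] with t h1 h2 using mul_left_cancel₀ h1 h2

namespace IsGermRing

variable {B : Set (ℂ → ℂ)} (hB : IsGermRing B)
include hB

theorem sum {ι : Type*} (S : Finset ι) {f : ι → ℂ → ℂ} (hf : ∀ i ∈ S, f i ∈ B) :
    (fun t => ∑ i ∈ S, f i t) ∈ B := by
  classical
  induction S using Finset.induction_on with
  | empty => simpa using hB.const 0
  | insert i S hi ih =>
    simp only [Finset.sum_insert hi]
    exact hB.add (hf i (Finset.mem_insert_self i S))
      (ih fun j hj => hf j (Finset.mem_insert_of_mem hj))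

theorem neg {f : ℂ → ℂ} (hf : f ∈ B) : (fun t => - f t) ∈ B := by
  simpa using hB.mul (hB.const (-1)) hf

theorem sub {f g : ℂ → ℂ} (hf : f ∈ B) (hg : g ∈ B) : (fun t => f t - g t) ∈ B := by
  simpa [sub_eq_add_neg] using hB.add hf (hB.neg hg)

/-- The product rule leaves undifferentiated factors, which must themselves lie in `B`; this is
where the inclusion is needed. -/
theorem tower_one {θ : ℂ → ℂ} (h : tower θ B 1 ⊆ B) : IsGermRing (tower θ B 1) where
  an hf := hf.1
  const c := ⟨analyticAt_const, _, hB.const 0, by simp⟩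
  add {f g} hf hg := by
    obtain ⟨h1, k, hk, h2⟩ := hf
    obtain ⟨h3, l, hl, h4⟩ := hg
    refine ⟨h1.add h3, _, hB.add hk hl, ?_⟩
    filter_upwards [h2, h4, deriv_add_eventuallyEq h1 h3] with t e1 e2 e3
    rw [e3, e1, e2]; ring
  mul {f g} hf hg := by
    have hf' := h hf
    have hg' := h hg
    obtain ⟨h1, k, hk, h2⟩ := hf
    obtain ⟨h3, l, hl, h4⟩ := hg
    refine ⟨h1.mul h3, _, hB.add (hB.mul hk hg') (hB.mul hf' hl), ?_⟩
    filter_upwards [h2, h4, deriv_mul_eventuallyEq h1 h3] with t e1 e2 e3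
    rw [e3, e1, e2]; ring
  congr {f g} hf hfg := by
    obtain ⟨h1, k, hk, h2⟩ := hf
    exact ⟨h1.congr hfg, k, hk, hfg.symm.deriv.trans h2⟩

theorem tower_aux {θ : ℂ → ℂ} (h : tower θ B 1 ⊆ B) :
    ∀ j, IsGermRing (tower θ B j) ∧ tower θ B (j + 1) ⊆ tower θ B j
  | 0 => ⟨hB, h⟩
  | j + 1 => by
    obtain ⟨h1, h2⟩ := tower_aux h j
    refine ⟨h1.tower_one h2, ?_⟩
    rintro f ⟨hf, k, hk, h3⟩
    exact ⟨hf, k, h2 hk, h3⟩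

theorem tower {θ : ℂ → ℂ} (h : tower θ B 1 ⊆ B) (j : ℕ) : IsGermRing (tower θ B j) :=
  (hB.tower_aux h j).1

theorem tower_anti {θ : ℂ → ℂ} (h : MonsterTower.tower θ B 1 ⊆ B) {i j : ℕ} (hij : i ≤ j) :
    MonsterTower.tower θ B j ⊆ MonsterTower.tower θ B i := by
  induction hij with
  | refl => exact subset_rfl
  | step _ ih => exact (hB.tower_aux h _).2.trans ih

end IsGermRing

/-- The germs at `0` of analytic functions. -/
def analyticGerms : Set (ℂ → ℂ) := {f | AnalyticAt ℂ f 0}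

theorem isGermRing_analyticGerms : IsGermRing analyticGerms where
  an h := h
  const _ := analyticAt_const
  add h h' := AnalyticAt.add h h'
  mul h h' := AnalyticAt.mul h h'
  congr h h' := AnalyticAt.congr h h'

theorem tower_analyticGerms_subset (θ : ℂ → ℂ) : tower θ analyticGerms 1 ⊆ analyticGerms :=
  fun _ h => h.1

variable {n : ℕ}

/-- The partial derivative of `g` with respect to the `b`-th coordinate, along `γ`. -/
def partialAlong (g : (Fin n → ℂ) → ℂ) (γ : ℂ → Fin n → ℂ) (b : Fin n) (t : ℂ) : ℂ :=
  fderiv ℂ g (γ t) (Pi.single b 1)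

theorem analyticAt_fderiv_single {g : (Fin n → ℂ) → ℂ} {x : Fin n → ℂ} (hg : AnalyticAt ℂ g x)
    (b : Fin n) : AnalyticAt ℂ (fun z => fderiv ℂ g z (Pi.single b 1)) x :=
  ((ContinuousLinearMap.apply ℂ ℂ (Pi.single b (1 : ℂ) : Fin n → ℂ)).analyticAt _).comp hg.fderiv

theorem fderiv_eq_sum (g : (Fin n → ℂ) → ℂ) (x v : Fin n → ℂ) :
    fderiv ℂ g x v = ∑ b, fderiv ℂ g x (Pi.single b 1) * v b := by
  conv_lhs => rw [pi_eq_sum_univ' v, map_sum]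
  refine Finset.sum_congr rfl fun b _ => ?_
  rw [map_smul, smul_eq_mul, mul_comm]

theorem deriv_comp_eventuallyEq {g : (Fin n → ℂ) → ℂ} {γ : ℂ → Fin n → ℂ}
    (hγ : ∀ b, AnalyticAt ℂ (fun t => γ t b) 0) (hg : AnalyticAt ℂ g (γ 0)) :
    deriv (fun t => g (γ t)) =ᶠ[𝓝 0]
      fun t => ∑ b, partialAlong g γ b t * deriv (fun t => γ t b) t := by
  have h1 : AnalyticAt ℂ γ 0 := analyticAt_pi_iff.2 hγ
  filter_upwards [h1.continuousAt.eventually hg.eventually_analyticAt,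
    eventually_all.2 fun b => (hγ b).eventually_analyticAt] with t h2 h3
  have h4 : HasDerivAt γ (fun b => deriv (fun t => γ t b) t) t :=
    hasDerivAt_pi.2 fun b => (h3 b).differentiableAt.hasDerivAt
  refine (h2.differentiableAt.hasFDerivAt.comp_hasDerivAt t h4).deriv.trans ?_
  rw [fderiv_eq_sum]
  rfl

/-- Curves `U 0` whose first `s` derivatives `U 1, …, U s` with respect to the coordinate `a`
are analytic, `X` being the derivative of that coordinate, and such that the derivatives of
`U s` and `X` are `η` times the functions `w`, which admit `m` derivatives with respect to `η`. -/
structure Tangency (s m : ℕ) (a : Fin n) (U : ℕ → ℂ → Fin n → ℂ) (X η : ℂ → ℂ)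
    (w : ℂ → Fin n → ℂ) : Prop where
  an : ∀ j ≤ s, ∀ b, AnalyticAt ℂ (fun t => U j t b) 0
  X_ne : ∀ᶠ t in 𝓝[≠] (0 : ℂ), X t ≠ 0
  deriv_base : ∀ᶠ t in 𝓝 (0 : ℂ), deriv (fun t => U 0 t a) t = X t
  deriv_block : ∀ j < s, ∀ b, b ≠ a →
    ∀ᶠ t in 𝓝 (0 : ℂ), deriv (fun t => U j t b) t = X t * U (j + 1) t b
  deriv_last : ∀ b, b ≠ a → ∀ᶠ t in 𝓝 (0 : ℂ), deriv (fun t => U s t b) t = η t * w t b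
  X_eq : ∀ᶠ t in 𝓝 (0 : ℂ), X t = η t * w t a
  w_mem : ∀ b, (fun t => w t b) ∈ tower η analyticGerms m

namespace Tangency

variable {s m : ℕ} {a : Fin n} {U : ℕ → ℂ → Fin n → ℂ} {X η : ℂ → ℂ} {w : ℂ → Fin n → ℂ}
  (h : Tangency s m a U X η w)
include h

theorem η_ne : ∀ᶠ t in 𝓝[≠] (0 : ℂ), η t ≠ 0 := by
  filter_upwards [h.X_ne, nhdsWithin_le_nhds h.X_eq] with t h1 h2 h3
  exact h1 (by rw [h2, h3, zero_mul])

omit h in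
theorem isGermRing_η (η : ℂ → ℂ) (j : ℕ) : IsGermRing (tower η analyticGerms j) :=
  isGermRing_analyticGerms.tower (tower_analyticGerms_subset η) j

omit h in
theorem tower_η_anti (η : ℂ → ℂ) {i j : ℕ} (hij : i ≤ j) :
    tower η analyticGerms j ⊆ tower η analyticGerms i :=
  isGermRing_analyticGerms.tower_anti (tower_analyticGerms_subset η) hij

/-- Since `X = η * w a`, a derivative divisible by `X` is divisible by `η`, with quotient multiplied
by `w a`. That factor has only `m` derivatives, exactly what membership at stage `m + 1` demands of
a quotient. -/
theorem tower_X_subset :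
    tower X (tower η analyticGerms (m + 1)) 1 ⊆ tower η analyticGerms (m + 1) := by
  rintro f ⟨hf, k, hk, h1⟩
  refine ⟨hf, fun t => w t a * k t, (isGermRing_η η m).mul (h.w_mem a)
    (tower_η_anti η m.le_succ hk), ?_⟩
  filter_upwards [h1, h.X_eq] with t h1 h2
  rw [h1, h2]; ring

theorem isGermRing_X (j : ℕ) : IsGermRing (tower X (tower η analyticGerms (m + 1)) j) :=
  (isGermRing_η η (m + 1)).tower h.tower_X_subset j

theorem tower_X_anti {i j : ℕ} (hij : i ≤ j) :
    tower X (tower η analyticGerms (m + 1)) j ⊆ tower X (tower η analyticGerms (m + 1)) i :=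
  (isGermRing_η η (m + 1)).tower_anti h.tower_X_subset hij

/-- Block `s - i` has `i` derivatives with respect to the coordinate `a`, the last being block `s`.
That block admits `m + 1` derivatives with respect to `η`, the first of which is `w`. -/
theorem block_mem {i : ℕ} (hi : i ≤ s) {b : Fin n} (hb : b ≠ a) :
    (fun t => U (s - i) t b) ∈ tower X (tower η analyticGerms (m + 1)) i := by
  induction i with
  | zero => exact ⟨h.an _ (Nat.sub_le _ _) b, _, h.w_mem b, h.deriv_last b hb⟩
  | succ i ih =>
    refine ⟨h.an _ (Nat.sub_le _ _) b, _, ih (by omega), ?_⟩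
    have := h.deriv_block (s - (i + 1)) (by omega) b hb
    rwa [show s - (i + 1) + 1 = s - i by omega] at this

theorem deriv_comp (hs : 1 ≤ s) {f : (Fin n → ℂ) → ℂ} (hf : AnalyticAt ℂ f (U 0 0)) :
    deriv (fun t => f (U 0 t)) =ᶠ[𝓝 0] fun t => X t * (partialAlong f (U 0) a t +
      ∑ b ∈ Finset.univ.erase a, partialAlong f (U 0) b t * U 1 t b) := by
  filter_upwards [deriv_comp_eventuallyEq (h.an 0 (by omega)) hf, h.deriv_base,
    (Finset.eventually_all (Finset.univ.erase a)).2 fun b hb =>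
      h.deriv_block 0 (by omega) b (Finset.ne_of_mem_erase hb)] with t h1 h2 h3
  rw [h1, ← Finset.add_sum_erase _ _ (Finset.mem_univ a), h2, mul_add, Finset.mul_sum]
  congr 1
  · ring
  · refine Finset.sum_congr rfl fun b hb => ?_
    rw [h3 b hb]; ring

/-- By the chain rule, a derivative along the curve involves partial derivatives of `f` and the
block `U 1`, which has one derivative fewer. So functions on the ambient space inherit `s`
derivatives from the blocks. -/
theorem comp_mem (hs : 1 ≤ s) {i : ℕ} (hi : i ≤ s) {f : (Fin n → ℂ) → ℂ}
    (hf : AnalyticAt ℂ f (U 0 0)) :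
    (fun t => f (U 0 t)) ∈ tower X (tower η analyticGerms (m + 1)) i := by
  have han : ∀ f : (Fin n → ℂ) → ℂ, AnalyticAt ℂ f (U 0 0) →
      AnalyticAt ℂ (fun t => f (U 0 t)) 0 := fun f hf =>
    hf.comp (analyticAt_pi_iff.2 (h.an 0 (by omega)))
  have hU1 : ∀ b, b ≠ a →
      (fun t => U 1 t b) ∈ tower X (tower η analyticGerms (m + 1)) (s - 1) := fun b hb => by
    have := h.block_mem (i := s - 1) (by omega) hb
    rwa [show s - (s - 1) = 1 by omega] at this
  induction i generalizing f with
  | zero =>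
    -- At the bottom stage the same chain rule argument is run for derivatives with respect to `η`,
    -- the factor `w a` being absorbed.
    have key : ∀ l ≤ m + 1, ∀ f : (Fin n → ℂ) → ℂ, AnalyticAt ℂ f (U 0 0) →
        (fun t => f (U 0 t)) ∈ tower η analyticGerms l := by
      intro l
      induction l with
      | zero => exact fun _ f hf => han f hf
      | succ l ih =>
        intro hl f hf
        have hR := isGermRing_η η l
        refine ⟨han f hf, _, hR.mul (tower_η_anti η (by omega) (h.w_mem a))
          (hR.add (ih (by omega) _ (analyticAt_fderiv_single hf a))
            (hR.sum (Finset.univ.erase a) fun b hb =>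
              hR.mul (ih (by omega) _ (analyticAt_fderiv_single hf b))
                (tower_η_anti η (by omega) (h.tower_X_anti (Nat.zero_le _)
                  (hU1 b (Finset.ne_of_mem_erase hb)))))), ?_⟩
        filter_upwards [h.deriv_comp hs hf, h.X_eq] with t h1 h2
        rw [h1, h2, mul_assoc]
        rfl
    exact key _ le_rfl f hf
  | succ i ih =>
    have hR := h.isGermRing_X i
    refine ⟨han f hf, _, hR.add (ih (by omega) (analyticAt_fderiv_single hf a))
      (hR.sum (Finset.univ.erase a) fun b hb =>
        hR.mul (ih (by omega) (analyticAt_fderiv_single hf b))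
          (h.tower_X_anti (by omega) (hU1 b (Finset.ne_of_mem_erase hb)))), ?_⟩
    exact h.deriv_comp hs hf

variable {g : (Fin n → ℂ) → ℂ} (hg : AnalyticAt ℂ g (U 0 0))
include hg

theorem partialAlong_mem (hs : 1 ≤ s) (b : Fin n) :
    partialAlong g (U 0) b ∈ tower X (tower η analyticGerms (m + 1)) s :=
  h.comp_mem hs le_rfl (analyticAt_fderiv_single hg b)

theorem exists_deriv_partialAlong (hs : 1 ≤ s) :
    ∃ p : Fin n → ℂ → ℂ, (∀ b, p b ∈ tower X (tower η analyticGerms (m + 1)) (s - 1)) ∧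
      ∀ b, deriv (partialAlong g (U 0) b) =ᶠ[𝓝 0] fun t => X t * p b t := by
  have : ∀ b, ∃ p ∈ tower X (tower η analyticGerms (m + 1)) (s - 1),
      deriv (partialAlong g (U 0) b) =ᶠ[𝓝 0] fun t => X t * p t := by
    intro b
    obtain ⟨s, rfl⟩ := Nat.exists_eq_add_of_le' hs
    exact (h.partialAlong_mem hg hs b).2
  choose p hp hp' using this
  exact ⟨p, hp, hp'⟩

variable (hgU : ∀ᶠ t in 𝓝 (0 : ℂ), g (U 0 t) = 0)
include hgU

theorem sum_block_one (hs : 1 ≤ s) :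
    (fun t => - partialAlong g (U 0) a t) =ᶠ[𝓝 0]
      fun t => ∑ b ∈ Finset.univ.erase a, partialAlong g (U 0) b t * U 1 t b := by
  have h0 : deriv (fun t => g (U 0 t)) =ᶠ[𝓝 0] fun _ => 0 := by
    have h1 : (fun t => g (U 0 t)) =ᶠ[𝓝 0] fun _ => 0 := hgU
    simpa using h1.deriv
  have han : ∀ b, AnalyticAt ℂ (partialAlong g (U 0) b) 0 :=
    fun b => (h.isGermRing_X s).an (h.partialAlong_mem hg hs b)
  refine eventually_eq_of_mul_eq h.X_ne (han a).neg (Finset.analyticAt_fun_sum _ fun b _ =>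
    (han b).mul (h.an 1 hs b)) ?_
  filter_upwards [h0, h.deriv_comp hs hg] with t h1 h2
  rw [h2] at h1
  linear_combination -h1

/-- For `i = 0` the sum is minus a partial derivative of `g`, because `g` vanishes on the curve.
Differentiating with respect to the coordinate `a` replaces `U (i + 1)` by `U (i + 2)` and adds
terms from the partial derivatives, which lie in the right ring. -/
theorem sum_block_mem (hs : 1 ≤ s) {i : ℕ} (hi : i < s) :
    (fun t => ∑ b ∈ Finset.univ.erase a, partialAlong g (U 0) b t * U (i + 1) t b) ∈
      tower X (tower η analyticGerms (m + 1)) (s - i) := by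
  have hG := h.partialAlong_mem hg hs
  have han : ∀ b, AnalyticAt ℂ (partialAlong g (U 0) b) 0 :=
    fun b => (h.isGermRing_X s).an (hG b)
  induction i with
  | zero =>
    exact (h.isGermRing_X _).congr ((h.isGermRing_X s).neg (hG a)) (h.sum_block_one hg hgU hs)
  | succ i ih =>
    have ih' := ih (by omega)
    rw [show s - i = s - (i + 1) + 1 by omega] at ih'
    obtain ⟨h1, k, hk, h2⟩ := ih'
    obtain ⟨p, hp, hp'⟩ := h.exists_deriv_partialAlong hg hs
    have hR := h.isGermRing_X (s - (i + 1))
    -- The function obtained by solving the differentiated relation for the sum over the next block.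
    have hmem : (fun t => k t - ∑ b ∈ Finset.univ.erase a, p b t * U (i + 1) t b) ∈
        tower X (tower η analyticGerms (m + 1)) (s - (i + 1)) := by
      refine hR.sub hk (hR.sum _ fun b hb => hR.mul (h.tower_X_anti (by omega) (hp b)) ?_)
      have := h.block_mem (i := s - (i + 1)) (by omega) (Finset.ne_of_mem_erase hb)
      rwa [show s - (s - (i + 1)) = i + 1 by omega] at this
    refine hR.congr hmem (eventually_eq_of_mul_eq h.X_ne (hR.an hmem)
      (Finset.analyticAt_fun_sum _ fun b _ => (han b).mul (h.an _ (by omega) b)) ?_)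
    filter_upwards [h2, deriv_sum_eventuallyEq (Finset.univ.erase a)
        (fun b => (han b).mul (h.an (i + 1) (by omega) b)),
      eventually_all.2 fun b => deriv_mul_eventuallyEq (han b) (h.an (i + 1) (by omega) b),
      eventually_all.2 hp', (Finset.eventually_all (Finset.univ.erase a)).2 fun b hb =>
        h.deriv_block (i + 1) (by omega) b (Finset.ne_of_mem_erase hb)] with t e1 e2 e3 e4 e5
    have e6 : ∑ b ∈ Finset.univ.erase a, deriv (fun t => partialAlong g (U 0) b t *
        U (i + 1) t b) t = X t * k t := e2.symm.trans e1
    rw [mul_sub, ← e6, Finset.mul_sum, Finset.mul_sum, ← Finset.sum_sub_distrib]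
    refine Finset.sum_congr rfl fun b hb => ?_
    rw [e3 b, e4 b, e5 b hb]; ring

/-- Vectors of the first block are annihilated by the functions vanishing on the curve. -/
theorem fderiv_block_one (hs : 1 ≤ s) (ha : U 1 0 a = 1) :
    fderiv ℂ g (U 0 0) (U 1 0) = 0 := by
  have h1 := (h.sum_block_one hg hgU hs).self_of_nhds
  rw [fderiv_eq_sum, ← Finset.add_sum_erase _ _ (Finset.mem_univ a), ha, mul_one]
  dsimp only [partialAlong] at h1
  rw [← h1]
  ring

/-- Functions vanishing on the curve give a relation between the functions `w`. -/
theorem exists_relation (hs : 1 ≤ s) :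
    ∃ k ∈ tower η analyticGerms (m + 1),
      (fun t => ∑ b ∈ Finset.univ.erase a, partialAlong g (U 0) b t * w t b) =ᶠ[𝓝 0]
        fun t => w t a * k t := by
  have hG := h.partialAlong_mem hg hs
  have han : ∀ b, AnalyticAt ℂ (partialAlong g (U 0) b) 0 :=
    fun b => (h.isGermRing_X s).an (hG b)
  have h0 := h.sum_block_mem hg hgU hs (i := s - 1) (by omega)
  rw [show s - (s - 1) = 0 + 1 by omega, show s - 1 + 1 = s by omega] at h0
  obtain ⟨h1, k, hk, h2⟩ := h0
  obtain ⟨p, hp, hp'⟩ := h.exists_deriv_partialAlong hg hs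
  have hR := h.isGermRing_X 0
  have hmem : (fun t => k t - ∑ b ∈ Finset.univ.erase a, p b t * U s t b) ∈
      tower X (tower η analyticGerms (m + 1)) 0 :=
    hR.sub hk (hR.sum _ fun b hb => hR.mul (h.tower_X_anti (Nat.zero_le _) (hp b))
      (h.block_mem (i := 0) (by omega) (Finset.ne_of_mem_erase hb)))
  have hw : ∀ b, AnalyticAt ℂ (fun t => w t b) 0 := fun b => (isGermRing_η η m).an (h.w_mem b)
  refine ⟨_, hmem, eventually_eq_of_mul_eq h.η_ne
    (Finset.analyticAt_fun_sum _ fun b _ => (han b).mul (hw b)) ((hw a).mul (hR.an hmem)) ?_⟩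
  filter_upwards [h2, deriv_sum_eventuallyEq (Finset.univ.erase a)
      (fun b => (han b).mul (h.an s le_rfl b)),
    eventually_all.2 fun b => deriv_mul_eventuallyEq (han b) (h.an s le_rfl b),
    eventually_all.2 hp', (Finset.eventually_all (Finset.univ.erase a)).2 fun b hb =>
      h.deriv_last b (Finset.ne_of_mem_erase hb), h.X_eq] with t e1 e2 e3 e4 e5 e7
  have e6 : ∑ b ∈ Finset.univ.erase a, deriv (fun t => partialAlong g (U 0) b t *
      U s t b) t = X t * k t := e2.symm.trans e1
  have e8 : η t * (w t a * (k t - ∑ b ∈ Finset.univ.erase a, p b t * U s t b)) =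
      X t * k t - X t * ∑ b ∈ Finset.univ.erase a, p b t * U s t b := by
    rw [e7]; ring
  rw [e8, ← e6, Finset.mul_sum, Finset.mul_sum, ← Finset.sum_sub_distrib]
  refine Finset.sum_congr rfl fun b hb => ?_
  rw [e3 b, e4 b, e5 b hb]; ring

/-- If `w a` vanishes at the origin, the vector `w` is annihilated by the functions vanishing on
the curve. -/
theorem fderiv_last (hs : 1 ≤ s) (ha : w 0 a = 0) : fderiv ℂ g (U 0 0) (w 0) = 0 := by
  obtain ⟨k, -, h1⟩ := h.exists_relation hg hgU hs
  have h2 := h1.self_of_nhds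
  dsimp only at h2
  rw [ha, zero_mul] at h2
  rw [fderiv_eq_sum, ← Finset.add_sum_erase _ _ (Finset.mem_univ a), ha, mul_zero, zero_add]
  exact h2

end Tangency

end

/-! ### The third tangent vector -/

section

variable {n : ℕ}

theorem deriv_sub_eventuallyEq {f g : ℂ → ℂ} (hf : AnalyticAt ℂ f 0) (hg : AnalyticAt ℂ g 0) :
    deriv (fun t => f t - g t) =ᶠ[𝓝 0] fun t => deriv f t - deriv g t := by
  filter_upwards [hf.eventually_analyticAt, hg.eventually_analyticAt] with t h1 h2
  exact deriv_fun_sub h1.differentiableAt h2.differentiableAt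

namespace Tangency

variable {s m : ℕ} {a : Fin n} {U : ℕ → ℂ → Fin n → ℂ} {X η : ℂ → ℂ} {w : ℂ → Fin n → ℂ}
  (h : Tangency s m a U X η w) {g : (Fin n → ℂ) → ℂ} (hg : AnalyticAt ℂ g (U 0 0))
  (hgU : ∀ᶠ t in 𝓝 (0 : ℂ), g (U 0 t) = 0)
include h hg

theorem analyticAt_partialAlong (b : Fin n) : AnalyticAt ℂ (partialAlong g (U 0) b) 0 :=
  (analyticAt_fderiv_single hg b).comp (analyticAt_pi_iff.2 (h.an 0 (Nat.zero_le _)))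

/-- These derivatives are multiples of `X = η * w a`, which vanishes at the origin. So
differentiating a relation at `0` acts only on the second factors. -/
theorem deriv_partialAlong_zero (hs : 1 ≤ s) (ha : w 0 a = 0) (b : Fin n) :
    deriv (partialAlong g (U 0) b) 0 = 0 := by
  obtain ⟨p, -, hp⟩ := h.exists_deriv_partialAlong hg hs
  rw [(hp b).self_of_nhds]
  dsimp only
  rw [h.X_eq.self_of_nhds, ha, mul_zero, zero_mul]

/-- The derivative at `0` of a combination of partial derivatives. -/
theorem deriv_sum_partialAlong (hs : 1 ≤ s) (ha : w 0 a = 0) {z : ℂ → Fin n → ℂ}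
    (hz : ∀ b, AnalyticAt ℂ (fun t => z t b) 0) :
    deriv (fun t => ∑ b ∈ Finset.univ.erase a, partialAlong g (U 0) b t * z t b) 0 =
      ∑ b ∈ Finset.univ.erase a, partialAlong g (U 0) b 0 * deriv (fun t => z t b) 0 := by
  have hG := h.analyticAt_partialAlong hg
  rw [(deriv_sum_eventuallyEq (Finset.univ.erase a) fun b => (hG b).fun_mul (hz b)).self_of_nhds]
  dsimp only
  refine Finset.sum_congr rfl fun b _ => ?_
  rw [(deriv_mul_eventuallyEq (hG b) (hz b)).self_of_nhds]
  dsimp only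
  rw [h.deriv_partialAlong_zero hg hs ha]
  ring

omit h hg in
theorem fderiv_eq_sum_erase (v : Fin n → ℂ) (hv : v a = 0) :
    fderiv ℂ g (U 0 0) v = ∑ b ∈ Finset.univ.erase a, partialAlong g (U 0) b 0 * v b := by
  rw [fderiv_eq_sum, ← Finset.add_sum_erase _ _ (Finset.mem_univ a), hv, mul_zero, zero_add]
  rfl

include hgU

/-- If `w a` vanishes to second order, the derivative of `w` at the origin is annihilated by the
functions vanishing on the curve. -/
theorem fderiv_deriv_last (hs : 1 ≤ s) (ha : w 0 a = 0) (ha' : deriv (fun t => w t a) 0 = 0) :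
    fderiv ℂ g (U 0 0) (fun b => deriv (fun t => w t b) 0) = 0 := by
  have hw : ∀ b, AnalyticAt ℂ (fun t => w t b) 0 := fun b => (isGermRing_η η m).an (h.w_mem b)
  obtain ⟨k, hk, h1⟩ := h.exists_relation hg hgU hs
  have h2 := h1.deriv.self_of_nhds
  rw [h.deriv_sum_partialAlong hg hs ha hw,
    (deriv_mul_eventuallyEq (hw a) hk.1).self_of_nhds] at h2
  dsimp only at h2
  rw [ha, ha', zero_mul, zero_mul,
    add_zero] at h2
  rwa [fderiv_eq_sum_erase _ ha']

/-- The case in which `w a` vanishes to first order, the derivative of `w` being `ω z`. -/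
theorem fderiv_deriv_quotient (hs : 1 ≤ s) (ha : w 0 a = 0) {ω ζ : ℂ → ℂ} {z : ℂ → Fin n → ℂ}
    (hω : AnalyticAt ℂ ω 0) (hω0 : ω 0 ≠ 0) (hζ : AnalyticAt ℂ ζ 0) (hζ0 : ζ 0 = 0)
    (hηω : ∀ᶠ t in 𝓝 (0 : ℂ), η t = ω t * ζ t)
    (hz : ∀ b, AnalyticAt ℂ (fun t => z t b) 0) (hza : ∀ t, z t a = 1)
    (hwz : ∀ b, ∀ᶠ t in 𝓝 (0 : ℂ), deriv (fun t => w t b) t = ω t * z t b) :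
    fderiv ℂ g (U 0 0) (fun b => deriv (fun t => z t b) 0) = 0 := by
  have hG := h.analyticAt_partialAlong hg
  have hw : ∀ b, AnalyticAt ℂ (fun t => w t b) 0 := fun b => (isGermRing_η η m).an (h.w_mem b)
  obtain ⟨k, ⟨hk, K, hK, hkK⟩, h1⟩ := h.exists_relation hg hgU hs
  obtain ⟨p, hp, hGp⟩ := h.exists_deriv_partialAlong hg hs
  have hp' : ∀ b, AnalyticAt ℂ (p b) 0 := fun b => (h.isGermRing_X _).an (hp b)
  have hK' : AnalyticAt ℂ K 0 := (isGermRing_η η m).an hK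
  have hS : AnalyticAt ℂ (fun t => ∑ b ∈ Finset.univ.erase a, p b t * w t b) 0 :=
    Finset.analyticAt_fun_sum _ fun b _ => (hp' b).mul (hw b)
  have hT : AnalyticAt ℂ (fun t => ∑ b ∈ Finset.univ.erase a, partialAlong g (U 0) b t * z t b) 0 :=
    Finset.analyticAt_fun_sum _ fun b _ => (hG b).mul (hz b)
  have hR : AnalyticAt ℂ (fun t => w t a * (ζ t * (K t - ∑ b ∈ Finset.univ.erase a,
      p b t * w t b))) 0 := (hw a).mul (hζ.mul (hK'.sub hS))
  -- The relation differentiated once and divided by the unit `ω`. The extra term carries the factor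
  -- `w a * ζ`, a product of two functions vanishing at `0`, so it does not contribute to the next
  -- derivative there.
  have h2 : (fun t => ∑ b ∈ Finset.univ.erase a, partialAlong g (U 0) b t * z t b) =ᶠ[𝓝 0]
      fun t => k t + w t a * (ζ t * (K t - ∑ b ∈ Finset.univ.erase a, p b t * w t b)) := by
    refine eventually_eq_of_mul_eq (θ := ω) ?_ hT (hk.add hR) ?_
    · exact nhdsWithin_le_nhds (hω.continuousAt.eventually_ne hω0)
    filter_upwards [h1.deriv, deriv_sum_eventuallyEq (Finset.univ.erase a)
        (fun b => (hG b).fun_mul (hw b)), eventually_all.2 fun b => deriv_mul_eventuallyEq (hG b) (hw b),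
      eventually_all.2 hGp, eventually_all.2 hwz, deriv_mul_eventuallyEq (hw a) hk, hkK, hηω,
      h.X_eq] with t e1 e2 e3 e4 e5 e6 e7 e8 e9
    have e10 : ∑ b ∈ Finset.univ.erase a, deriv (fun t => partialAlong g (U 0) b t *
        w t b) t = ω t * ∑ b ∈ Finset.univ.erase a, partialAlong g (U 0) b t * z t b +
          X t * ∑ b ∈ Finset.univ.erase a, p b t * w t b := by
      rw [Finset.mul_sum, Finset.mul_sum, ← Finset.sum_add_distrib]
      refine Finset.sum_congr rfl fun b _ => ?_
      rw [e3 b, e4 b, e5 b]; ring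
    have e11 := e10.symm.trans (e2.symm.trans (e1.trans e6))
    rw [e5 a, hza, e7, e9, e8] at e11
    linear_combination e11
  have h3 := h2.deriv.self_of_nhds
  rw [h.deriv_sum_partialAlong hg hs ha hz, (deriv_add_eventuallyEq hk hR).self_of_nhds] at h3
  dsimp only at h3
  rw [hkK.self_of_nhds,
    (deriv_mul_eventuallyEq (hw a) (hζ.fun_mul (hK'.fun_sub hS))).self_of_nhds] at h3
  dsimp only at h3
  rw [hηω.self_of_nhds, ha, hζ0] at h3
  rw [fderiv_eq_sum_erase (a := a) _ (by simp [hza]), h3]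
  ring

/-- The case of iterated derivatives of `w` with respect to `η`. -/
theorem fderiv_iterated (hs : 1 ≤ s) (hm : 1 ≤ m) (ha : w 0 a = 0) {D : ℕ → ℂ → Fin n → ℂ}
    {ω : ℂ → ℂ} {z : ℂ → Fin n → ℂ} (hD0 : D 0 = w)
    (hD : ∀ j ≤ m, ∀ b, (fun t => D j t b) ∈ tower η analyticGerms (m - j))
    (hD' : ∀ j < m, ∀ b, ∀ᶠ t in 𝓝 (0 : ℂ), deriv (fun t => D j t b) t = η t * D (j + 1) t b)
    (hη0 : η 0 = 0) (hω0 : ω 0 ≠ 0)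
    (hDz : ∀ b, deriv (fun t => D m t b) 0 = ω 0 * z 0 b) (hza : z 0 a = 1) :
    fderiv ℂ g (U 0 0) (D 1 0 a • z 0 - D 1 0) = 0 := by
  have hG := h.analyticAt_partialAlong hg
  obtain ⟨k, ⟨hk, K, hK, hkK⟩, h1⟩ := h.exists_relation hg hgU hs
  obtain ⟨p, hp, hGp⟩ := h.exists_deriv_partialAlong hg hs
  have hDan : ∀ j ≤ m, ∀ b, AnalyticAt ℂ (fun t => D j t b) 0 :=
    fun j hj b => (isGermRing_η η _).an (hD j hj b)
  have hp' : ∀ b, p b ∈ tower η analyticGerms (m + 1) :=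
    fun b => h.tower_X_anti (Nat.zero_le _) (hp b)
  -- The defect of the relation with `w` replaced by its `j`-th derivative with respect to `η`. The
  -- function `r j` collects the terms in which a coefficient was differentiated instead, so that `f
  -- (j + 1)` is `r j` plus the derivative of `f j` divided by `η`.
  let f : ℕ → ℂ → ℂ := fun j t =>
    (∑ b ∈ Finset.univ.erase a, partialAlong g (U 0) b t * D j t b) - D j t a * k t
  let r : ℕ → ℂ → ℂ := fun j t =>
    D j t a * K t - w t a * ∑ b ∈ Finset.univ.erase a, p b t * D j t b
  have hfan : ∀ j ≤ m, AnalyticAt ℂ (f j) 0 := fun j hj =>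
    (Finset.analyticAt_fun_sum _ fun b _ => (hG b).mul (hDan j hj b)).sub ((hDan j hj a).mul hk)
  have hr : ∀ j ≤ m, r j ∈ tower η analyticGerms (m - j) := by
    intro j hj
    have hR := isGermRing_η η (m - j)
    exact hR.sub (hR.mul (hD j hj a) (tower_η_anti η (by omega) hK))
      (hR.mul (tower_η_anti η (by omega) (h.w_mem a)) (hR.sum _ fun b _ =>
        hR.mul (tower_η_anti η (by omega) (hp' b)) (hD j hj b)))
  have hrec : ∀ j < m, deriv (f j) =ᶠ[𝓝 0] fun t => η t * (f (j + 1) t - r j t) := by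
    intro j hj
    have hj' := hj.le
    filter_upwards [deriv_sub_eventuallyEq (Finset.analyticAt_fun_sum (Finset.univ.erase a)
        fun b _ => (hG b).fun_mul (hDan j hj' b)) ((hDan j hj' a).fun_mul hk),
      deriv_sum_eventuallyEq (Finset.univ.erase a) (fun b => (hG b).fun_mul (hDan j hj' b)),
      eventually_all.2 fun b => deriv_mul_eventuallyEq (hG b) (hDan j hj' b),
      eventually_all.2 hGp, eventually_all.2 (hD' j hj), deriv_mul_eventuallyEq (hDan j hj' a) hk,
      hkK, h.X_eq] with t e1 e2 e3 e4 e5 e6 e7 e9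
    have e10 : ∑ b ∈ Finset.univ.erase a, deriv (fun t => partialAlong g (U 0) b t *
        D j t b) t = η t * ∑ b ∈ Finset.univ.erase a, partialAlong g (U 0) b t * D (j + 1) t b +
          X t * ∑ b ∈ Finset.univ.erase a, p b t * D j t b := by
      rw [Finset.mul_sum, Finset.mul_sum, ← Finset.sum_add_distrib]
      refine Finset.sum_congr rfl fun b _ => ?_
      rw [e3 b, e4 b, e5 b]; ring
    refine e1.trans ?_
    rw [e2, e10, e6, e5 a, e7, e9]
    simp only [f, r]
    ring
  have hf0 : f 0 =ᶠ[𝓝 0] fun _ => 0 := by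
    filter_upwards [h1] with t e1
    simp only [f, hD0, e1, sub_self]
  have hstep : ∀ j < m, ∀ q ∈ tower η analyticGerms (m - j),
      deriv (f j) =ᶠ[𝓝 0] (fun t => η t * q t) → f (j + 1) =ᶠ[𝓝 0] fun t => q t + r j t := by
    intro j hj q hq hfq
    refine eventually_eq_of_mul_eq h.η_ne (hfan _ hj)
      (((isGermRing_η η _).an hq).add ((isGermRing_η η _).an (hr j hj.le))) ?_
    filter_upwards [hrec j hj, hfq] with t e1 e2
    rw [e1] at e2
    linear_combination e2
  -- Each step costs one derivative with respect to `η`. Starting from `m + 1`, exactly one is left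
  -- for `f m`, so its derivative is still divisible by `η`.
  have hfmem : ∀ j, j ≤ m → f j ∈ tower η analyticGerms (m + 1 - j) := by
    intro j
    induction j with
    | zero => exact fun _ => (isGermRing_η η _).congr ((isGermRing_η η _).const 0) hf0.symm
    | succ j ih =>
      intro hj
      have h2 := ih (by omega)
      rw [show m + 1 - j = m - j + 1 by omega] at h2
      obtain ⟨-, q, hq, hfq⟩ := h2
      rw [show m + 1 - (j + 1) = m - j by omega]
      exact (isGermRing_η η _).congr ((isGermRing_η η _).add hq (hr j (by omega)))
        (hstep j hj q hq hfq).symm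
  -- As `f 0` vanishes identically, `f 1` is `r 0`, a multiple of `w a`.
  have hC2 : f 1 0 = 0 := by
    have h2 := hstep 0 hm (fun _ => 0) ((isGermRing_η η _).const 0) (by
      simpa using hf0.deriv)
    rw [h2.self_of_nhds]
    simp [r, hD0, ha]
  -- The derivative of `f m` vanishes at `0` together with `η`, and so does that of `k`. What
  -- remains gives the value of the differential on `z 0` minus its `a` component. Combined with
  -- `hC2`, eliminating `k 0` yields the vector in the conclusion.
  have hC1 : ∑ b ∈ Finset.univ.erase a, partialAlong g (U 0) b 0 * z 0 b = k 0 := by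
    have h2 := hfmem m le_rfl
    rw [show m + 1 - m = 0 + 1 by omega] at h2
    obtain ⟨-, q, -, hfq⟩ := h2
    have h3 := hfq.self_of_nhds
    dsimp only at h3
    rw [hη0, zero_mul] at h3
    have h4 : deriv (f m) 0 = _ := deriv_fun_sub
      (Finset.analyticAt_fun_sum (Finset.univ.erase a)
        fun b _ => (hG b).fun_mul (hDan m le_rfl b)).differentiableAt
      ((hDan m le_rfl a).fun_mul hk).differentiableAt
    have h5 := h.deriv_sum_partialAlong hg hs ha (z := D m) (hDan m le_rfl)
    have h6 := (deriv_mul_eventuallyEq (hDan m le_rfl a) hk).self_of_nhds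
    have h7 : deriv k 0 = 0 := by
      rw [hkK.self_of_nhds]
      dsimp only
      rw [hη0, zero_mul]
    dsimp only at h6
    rw [h7, mul_zero, add_zero, hDz, hza] at h6
    simp only [hDz] at h5
    have h8 : ∑ b ∈ Finset.univ.erase a, partialAlong g (U 0) b 0 * (ω 0 * z 0 b) =
        ω 0 * 1 * k 0 := by
      rw [← h5, ← h6, ← sub_eq_zero]
      exact h4.symm.trans h3
    refine mul_left_cancel₀ hω0 ?_
    rw [mul_one] at h8
    rw [Finset.mul_sum, ← h8]
    exact Finset.sum_congr rfl fun b _ => by ring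
  rw [fderiv_eq_sum_erase (a := a) _ (by simp [hza])]
  simp only [Pi.sub_apply, Pi.smul_apply, smul_eq_mul, mul_sub, Finset.sum_sub_distrib]
  have h9 : ∑ b ∈ Finset.univ.erase a, partialAlong g (U 0) b 0 * D 1 0 b = D 1 0 a * k 0 :=
    sub_eq_zero.1 hC2
  rw [h9, ← hC1, Finset.mul_sum, sub_eq_zero]
  exact Finset.sum_congr rfl fun b _ => by ring

end Tangency

end

/-! ### Lower bounds for the embedding dimension -/

section

variable {n : ℕ}

/-- The vectors annihilated by the differentials at `γ 0` of all the analytic functions that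
vanish on the curve germ `γ`. -/
def zariskiTangent (γ : ℂ → Fin n → ℂ) : Set (Fin n → ℂ) :=
  {v | ∀ g : (Fin n → ℂ) → ℂ, AnalyticAt ℂ g (γ 0) → (∀ᶠ t in 𝓝 (0 : ℂ), g (γ t) = 0) →
    fderiv ℂ g (γ 0) v = 0}

theorem liesInSubmanifold_self (γ : ℂ → Fin n → ℂ) : LiesInSubmanifold γ n :=
  ⟨le_rfl, id, analyticAt_id, by simpa using Function.bijective_id,
    Eventually.of_forall fun _ j hj => absurd j.2 (by omega)⟩

theorem embDim_le_of_liesIn {γ : ℂ → Fin n → ℂ} {d : ℕ} (h : LiesInSubmanifold γ d) :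
    embDim γ ≤ d := Nat.sInf_le h

/-- The straightened coordinates of index at least `d` vanish on the curve, so the derivative of `ψ`
sends the three vectors into the span of the first `d` coordinates, and it is injective. -/
theorem three_le_embDim {γ : ℂ → Fin n → ℂ} {v : Fin 3 → Fin n → ℂ}
    (hv : ∀ i, v i ∈ zariskiTangent γ) (hli : LinearIndependent ℂ v) : 3 ≤ embDim γ := by
  refine le_csInf ⟨n, liesInSubmanifold_self γ⟩ ?_
  rintro d ⟨hd, ψ, hψ, hbij, hγ⟩
  have h1 : ∀ i (j : Fin n), d ≤ j.1 → fderiv ℂ ψ (γ 0) (v i) j = 0 := by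
    intro i j hj
    have h2 : AnalyticAt ℂ (fun x => ψ x j) (γ 0) := analyticAt_pi_iff.1 hψ j
    have h3 := hv i _ h2 (by filter_upwards [hγ] with t ht using ht j hj)
    have h4 : HasFDerivAt (fun x => ψ x j) _ (γ 0) :=
      hasFDerivAt_pi'.1 hψ.differentiableAt.hasFDerivAt j
    rw [h4.fderiv] at h3
    exact h3
  have h5 : LinearIndependent ℂ
      fun i (j : Fin d) => fderiv ℂ ψ (γ 0) (v i) (Fin.castLE hd j) := by
    rw [Fintype.linearIndependent_iff] at hli ⊢
    intro c hc
    refine hli c (hbij.1 ?_)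
    rw [map_zero, map_sum]
    ext j
    by_cases hj : d ≤ j.1
    · simp [h1 _ j hj]
    · have h6 := congrFun hc ⟨j, by omega⟩
      simpa [Fin.castLE] using h6
  simpa using h5.fintype_card_le_finrank

theorem three_le_embDim_of_vectors {γ : ℂ → Fin n → ℂ} {v₁ v₂ v₃ : Fin n → ℂ}
    (h₁ : v₁ ∈ zariskiTangent γ) (h₂ : v₂ ∈ zariskiTangent γ) (h₃ : v₃ ∈ zariskiTangent γ)
    {a b d : Fin n} (h₁a : v₁ a ≠ 0) (h₂a : v₂ a = 0) (h₂b : v₂ b ≠ 0) (h₃a : v₃ a = 0)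
    (h₃b : v₃ b = 0) (h₃d : v₃ d ≠ 0) : 3 ≤ embDim γ := by
  refine three_le_embDim (v := ![v₁, v₂, v₃]) (fun i => by fin_cases i <;> assumption) ?_
  rw [Fintype.linearIndependent_iff]
  intro c hc
  simp only [Fin.sum_univ_three, Matrix.cons_val_zero, Matrix.cons_val_one, Matrix.cons_val] at hc
  have ea := congrFun hc a
  have eb := congrFun hc b
  have ed := congrFun hc d
  simp only [Pi.add_apply, Pi.smul_apply, smul_eq_mul, Pi.zero_apply, h₂a, h₃a, h₃b, mul_zero,
    add_zero, mul_eq_zero, h₁a, or_false] at ea eb ed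
  simp only [ea, zero_mul, zero_add, mul_eq_zero, h₂b, or_false] at eb ed
  simp only [eb, zero_mul, zero_add, mul_eq_zero, h₃d, or_false] at ed
  intro i
  fin_cases i <;> assumption

/-- While the chart index stays equal to `b`, the velocity in that direction is copied from level to
level. A run of equal indices thus means iterated differentiation with respect to one function. -/
theorem vel_eq_of_const {α : ℕ → Fin n} {U : ℕ → ℂ → Fin n → ℂ} {j l : ℕ} {b : Fin n}
    (hjl : j ≤ l) (h : ∀ i, j < i → i ≤ l → α i = b) (t : ℂ) :
    vel α U l t b = vel α U j t b := by
  induction l, hjl using Nat.le_induction with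
  | base => rfl
  | succ l hl ih =>
    rw [← ih fun i h1 h2 => h i h1 (by omega)]
    have := vel_succ_self α U l t
    rwa [h (l + 1) (by omega) le_rfl] at this

namespace Jet

variable {k s m : ℕ} {α : ℕ → Fin n} {U : ℕ → ℂ → Fin n → ℂ} {a b c d : Fin n}

theorem deriv_zero (h : Jet k α U) (hk : 0 < k) (b : Fin n) :
    ∀ᶠ t in 𝓝 (0 : ℂ), deriv (fun t => U 0 t b) t = vel α U 0 t (α 1) * U 1 t b := by
  filter_upwards [h.rel 0 hk] with t ht
  exact congrFun ht b

theorem deriv_succ (h : Jet k α U) {j : ℕ} (hj : j + 1 < k) (hb : b ≠ α (j + 1)) :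
    ∀ᶠ t in 𝓝 (0 : ℂ),
      deriv (fun t => U (j + 1) t b) t = vel α U (j + 1) t (α (j + 2)) * U (j + 2) t b := by
  filter_upwards [h.rel (j + 1) hj] with t ht
  rw [← vel_succ_of_ne hb]
  exact congrFun ht b

theorem vel_eq (h : Jet k α U) {j : ℕ} (hj : j < k) (b : Fin n) :
    ∀ᶠ t in 𝓝 (0 : ℂ), vel α U j t b = vel α U j t (α (j + 1)) * U (j + 1) t b := by
  filter_upwards [h.rel j hj] with t ht using congrFun ht b

/-- The run of `s` indices `a` makes the blocks derivatives with respect to the coordinate `a`. The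
run of `m + 1` indices `b` makes `U (s + 2), …, U (s + m + 1)` iterated `η`-derivatives of `U (s +
1)`, away from the entry `b`, which is constant. -/
theorem tangency (h : Jet k α U) (hs : 1 ≤ s) (hk : s + m + 1 ≤ k)
    (ha : ∀ j, 1 ≤ j → j ≤ s → α j = a) (hb : ∀ j, s < j → j ≤ s + m + 1 → α j = b) :
    Tangency s m a U (fun t => vel α U 0 t a) (fun t => vel α U s t b) (U (s + 1)) := by
  obtain ⟨r, rfl⟩ := Nat.exists_eq_add_of_le' hs
  have hva : ∀ j ≤ r + 1, ∀ t, vel α U j t a = vel α U 0 t a := fun j hj t =>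
    vel_eq_of_const (Nat.zero_le j) (fun i h1 h2 => ha i h1 (by omega)) t
  have hvb : ∀ j, r + 1 ≤ j → j ≤ r + 1 + m + 1 → ∀ t, vel α U j t b = vel α U (r + 1) t b :=
    fun j h1 h2 t => vel_eq_of_const h1 (fun i h3 h4 => hb i h3 (by omega)) t
  refine ⟨fun j hj b => h.an j (by omega) b, ?_,
    Eventually.of_forall fun t => rfl, ?_, ?_, ?_, ?_⟩
  · have := h.ne 0 (by omega)
    rwa [ha _ le_rfl (by omega)] at this
  · rintro (_ | j) hj b hb
    · have := h.deriv_zero (by omega) b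
      rwa [ha _ le_rfl (by omega)] at this
    · have := h.deriv_succ (j := j) (b := b) (by omega) (by rwa [ha _ (by omega) (by omega)])
      rw [ha _ (by omega) (by omega)] at this
      filter_upwards [this] with t ht
      rw [ht, hva _ (by omega)]
  · intro c hc
    have := h.deriv_succ (j := r) (b := c) (by omega) (by rwa [ha _ (by omega) (by omega)])
    rwa [hb _ (by omega) (by omega)] at this
  · have := h.vel_eq (j := r + 1) (by omega) a
    rw [hb _ (by omega) (by omega)] at this
    filter_upwards [this] with t ht
    rw [← ht, hva _ le_rfl]
  · have key : ∀ i ≤ m, ∀ c, (fun t => U (r + 1 + 1 + (m - i)) t c) ∈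
        tower (fun t => vel α U (r + 1) t b) analyticGerms i := by
      intro i
      induction i with
      | zero => exact fun _ c => h.an _ (by omega) c
      | succ i ih =>
        intro hi c
        by_cases hc : c = b
        · have h1 : ∀ t, U (r + 1 + 1 + (m - (i + 1))) t c = 1 := by
            intro t
            have := h.norm t (r + 1 + 1 + (m - (i + 1))) (by omega) (by omega)
            rwa [hb _ (by omega) (by omega), ← hc] at this
          simp only [h1]
          exact (Tangency.isGermRing_η _ _).const 1
        · refine ⟨h.an _ (by omega) c, _, ih (by omega) c, ?_⟩
          have := h.deriv_succ (j := r + 1 + (m - (i + 1))) (b := c) (by omega)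
            (by rwa [hb _ (by omega) (by omega)])
          rw [hb _ (by omega) (by omega)] at this
          rw [show r + 1 + 1 + (m - (i + 1)) = r + 1 + (m - (i + 1)) + 1 by omega]
          filter_upwards [this] with t ht
          rw [ht, show r + 1 + (m - (i + 1)) + 2 = r + 1 + 1 + (m - i) by omega,
            hvb _ (by omega) (by omega)]
    intro c
    have := key m le_rfl c
    rwa [Nat.sub_self, add_zero] at this

theorem mem_zariskiTangent (h : Jet k α U) (hs : 1 ≤ s) (hk : s + m + 1 ≤ k)
    (ha : ∀ j, 1 ≤ j → j ≤ s → α j = a) (hb : ∀ j, s < j → j ≤ s + m + 1 → α j = b)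
    (h0 : U (s + 1) 0 a = 0) :
    U 1 0 ∈ zariskiTangent (U 0) ∧ U (s + 1) 0 ∈ zariskiTangent (U 0) ∧
      U 1 0 a = 1 ∧ U (s + 1) 0 b = 1 := by
  have hT := h.tangency hs hk ha hb
  have h1 : U 1 0 a = 1 := by
    have := h.norm 0 1 le_rfl (by omega)
    rwa [ha _ le_rfl hs] at this
  have h2 : U (s + 1) 0 b = 1 := by
    have := h.norm 0 (s + 1) (by omega) (by omega)
    rwa [hb _ (by omega) (by omega)] at this
  exact ⟨fun g hg hgU => hT.fderiv_block_one hg hgU hs h1,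
    fun g hg hgU => hT.fderiv_last hg hgU hs h0, h1, h2⟩

/-- Curves through the points with two successive vertical directions. -/
theorem three_le_embDim_VL (h : Jet (s + 2) (ix s 0 a b c) U) (hs : 1 ≤ s) (hab : a ≠ b)
    (h1 : U (s + 1) 0 a = 0) (h2 : U (s + 2) 0 a = 0) (hdb : d ≠ b)
    (hd : U (s + 2) 0 d ≠ 0) (hω : vel (ix s 0 a b c) U (s + 2) 0 c ≠ 0) : 3 ≤ embDim (U 0) := by
  have ha : ∀ j, 1 ≤ j → j ≤ s → ix s 0 a b c j = a := fun j _ h => ix_left h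
  have hb : ∀ j, s < j → j ≤ s + 0 + 1 → ix s 0 a b c j = b := fun j h h' => ix_mid h h'
  have hc : ix s 0 a b c (s + 2) = c := ix_right (by omega)
  obtain ⟨hv1, hv2, e1, e2⟩ := h.mem_zariskiTangent (m := 0) hs (by omega) ha hb h1
  have hω' : vel (ix s 0 a b c) U (s + 1) 0 c ≠ 0 := by
    rwa [← vel_eq_of_const (Nat.le_succ _) (fun i h3 h4 => by
      rw [show i = s + 2 by omega, hc]) 0]
  have hder : ∀ x, x ≠ b → deriv (fun t => U (s + 1) t x) 0 =
      vel (ix s 0 a b c) U (s + 1) 0 c * U (s + 2) 0 x := by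
    intro x hx
    have := (h.deriv_succ (j := s) (b := x) (by omega)
      (by rwa [hb _ (by omega) (by omega)])).self_of_nhds
    rwa [hc] at this
  have hderb : deriv (fun t => U (s + 1) t b) 0 = 0 := by
    have : ∀ t, U (s + 1) t b = 1 := fun t => by
      have := h.norm t (s + 1) (by omega) (by omega)
      rwa [hb _ (by omega) (by omega)] at this
    simp [this]
  have h0 : deriv (fun t => U (s + 1) t a) 0 = 0 := by rw [hder a hab, h2, mul_zero]
  exact three_le_embDim_of_vectors hv1 hv2 (fun g hg hgU =>
    (h.tangency (m := 0) hs (by omega) ha hb).fderiv_deriv_last hg hgU hs h1 h0)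
    (a := a) (b := b) (d := d) (by simp [e1]) h1 (by simp [e2]) h0 hderb
    (by rw [hder d hdb]; exact mul_ne_zero hω' hd)

/-- Curves through the generic points of the class `R ⋯ RVVR`. -/
theorem three_le_embDim_VVR (h : Jet (s + 3) (ix s 0 a b a) U) (hs : 1 ≤ s) (hab : a ≠ b)
    (h1 : U (s + 1) 0 a = 0) (h2 : U (s + 2) 0 b = 0) (hda : d ≠ a) (hdb : d ≠ b)
    (hd : U (s + 3) 0 d ≠ 0) (hω : vel (ix s 0 a b a) U (s + 3) 0 a ≠ 0) : 3 ≤ embDim (U 0) := by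
  have ha : ∀ j, 1 ≤ j → j ≤ s → ix s 0 a b a j = a := fun j _ h => ix_left h
  have hb : ∀ j, s < j → j ≤ s + 0 + 1 → ix s 0 a b a j = b := fun j h h' => ix_mid h h'
  have hc : ∀ j, s + 1 < j → ix s 0 a b a j = a := fun j h => ix_right (by omega)
  obtain ⟨hv1, hv2, e1, e2⟩ := h.mem_zariskiTangent (m := 0) hs (by omega) ha hb h1
  have hT := h.tangency (m := 0) hs (by omega) ha hb
  have hva : ∀ t, vel (ix s 0 a b a) U (s + 2) t a = vel (ix s 0 a b a) U (s + 1) t a :=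
    fun t => vel_eq_of_const (by omega) (fun i h3 h4 => hc i (by omega)) t
  have hω' : vel (ix s 0 a b a) U (s + 1) 0 a ≠ 0 := by
    rwa [← vel_eq_of_const (l := s + 3) (by omega) (fun i h3 h4 => hc i h3) 0]
  have hone : ∀ t, U (s + 2) t a = 1 := fun t => by
    have := h.norm t (s + 2) (by omega) (by omega)
    rwa [hc _ (by omega)] at this
  -- The entry `b` is reset because `w b` is constantly `1` and has derivative zero, whereas the
  -- block itself carries there the quotient of `η` by the new velocity, used below as `ζ`.
  let z : ℂ → Fin n → ℂ := fun t => Function.update (U (s + 2) t) b 0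
  have hzb : ∀ t, z t b = 0 := fun t => Function.update_self ..
  have hz : ∀ t x, x ≠ b → z t x = U (s + 2) t x := fun t x hx => Function.update_of_ne hx ..
  have hzan : ∀ x, AnalyticAt ℂ (fun t => z t x) 0 := by
    intro x
    by_cases hx : x = b
    · simp only [hx, hzb]; exact analyticAt_const
    · simp only [hz _ x hx]; exact h.an _ (by omega) x
  have hwz : ∀ x, ∀ᶠ t in 𝓝 (0 : ℂ), deriv (fun t => U (s + 1) t x) t =
      vel (ix s 0 a b a) U (s + 1) t a * z t x := by
    intro x
    by_cases hx : x = b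
    · have : ∀ t, U (s + 1) t b = 1 := fun t => by
        have := h.norm t (s + 1) (by omega) (by omega)
        rwa [hb _ (by omega) (by omega)] at this
      simp [hx, this, hzb]
    · have := h.deriv_succ (j := s) (b := x) (by omega) (by rwa [hb _ (by omega) (by omega)])
      rw [hc _ (by omega)] at this
      simpa only [hz _ x hx] using this
  have hη : ∀ᶠ t in 𝓝 (0 : ℂ), vel (ix s 0 a b a) U s t b =
      vel (ix s 0 a b a) U (s + 1) t a * U (s + 2) t b := by
    have := h.vel_eq (j := s + 1) (by omega) b
    rw [hc _ (by omega)] at this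
    filter_upwards [this] with t ht
    rw [← ht]
    exact (vel_eq_of_const (Nat.le_succ s) (fun i h3 h4 => hb i (by omega) (by omega)) t).symm
  have hdz : ∀ x, x ≠ a → x ≠ b → deriv (fun t => z t x) 0 =
      vel (ix s 0 a b a) U (s + 1) 0 a * U (s + 3) 0 x := by
    intro x hxa hxb
    simp only [hz _ x hxb]
    have := (h.deriv_succ (j := s + 1) (b := x) (by omega)
      (by rwa [hc _ (by omega)])).self_of_nhds
    rwa [hc _ (by omega), hva] at this
  refine three_le_embDim_of_vectors hv1 hv2 (fun g hg hgU =>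
    hT.fderiv_deriv_quotient hg hgU hs h1 (h.analyticAt_vel (by omega) a) hω'
      (h.an (s + 2) (by omega) b) h2 hη hzan (fun t => (hz t a hab).trans (hone t)) hwz)
    (a := a) (b := b) (d := d) (by simp [e1]) h1 (by simp [e2]) ?_ ?_
    (by rw [hdz d hda hdb]; exact mul_ne_zero hω' hd)
  · simp only [hz _ a hab, hone, deriv_const]
  · simp only [hzb, deriv_const]

/-- Curves through the generic points of the class `R ⋯ RVR ⋯ RVRR`. -/
theorem three_le_embDim_VRVRR (h : Jet (s + m + 4) (ix s m a b a) U) (hs : 1 ≤ s) (hm : 1 ≤ m)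
    (hab : a ≠ b) (h1 : U (s + 1) 0 a = 0) (h2 : U (s + m + 2) 0 b = 0) (hdb : d ≠ b)
    (hd : U (s + m + 2) 0 d * U (s + 2) 0 a ≠ U (s + 2) 0 d)
    (hω : vel (ix s m a b a) U (s + m + 4) 0 a ≠ 0) : 3 ≤ embDim (U 0) := by
  have ha : ∀ j, 1 ≤ j → j ≤ s → ix s m a b a j = a := fun j _ h => ix_left h
  have hb : ∀ j, s < j → j ≤ s + m + 1 → ix s m a b a j = b := fun j h h' => ix_mid h h'
  have hc : ∀ j, s + m + 1 < j → ix s m a b a j = a := fun j h => ix_right (by omega)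
  obtain ⟨hv1, hv2, e1, e2⟩ := h.mem_zariskiTangent hs (by omega) ha hb h1
  have hT := h.tangency hs (by omega) ha hb
  have hω' : vel (ix s m a b a) U (s + m + 1) 0 a ≠ 0 := by
    rwa [← vel_eq_of_const (l := s + m + 4) (by omega) (fun i h3 h4 => hc i h3) 0]
  have hone : U (s + m + 2) 0 a = 1 := by
    have := h.norm 0 (s + m + 2) (by omega) (by omega)
    rwa [hc _ (by omega)] at this
  have honeb : ∀ j, s < j → j ≤ s + m + 1 → ∀ t, U j t b = 1 := fun j h3 h4 t => by
    have := h.norm t j (by omega) (by omega)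
    rwa [hb _ h3 h4] at this
  have hvb : ∀ j, s ≤ j → j ≤ s + m + 1 → ∀ t,
      vel (ix s m a b a) U j t b = vel (ix s m a b a) U s t b :=
    fun j h3 h4 t => vel_eq_of_const h3 (fun i h5 h6 => hb i h5 (by omega)) t
  -- True `η`-derivatives of `U (s + 1)`: the later blocks have entry `1` at `b` by normalization,
  -- where the derivative of the constant `1` is `0`.
  let D : ℕ → ℂ → Fin n → ℂ := fun j t => match j with
    | 0 => U (s + 1) t
    | j + 1 => Function.update (U (s + 1 + (j + 1)) t) b 0
  have hDb : ∀ j t, D (j + 1) t b = 0 := fun j t => Function.update_self ..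
  have hD : ∀ j t x, x ≠ b → D j t x = U (s + 1 + j) t x := by
    rintro (_ | j) t x hx
    · rfl
    · exact Function.update_of_ne hx ..
  have hDderiv : ∀ j, ∀ t, deriv (fun t => D j t b) t = 0 := by
    rintro (_ | j) t
    · have : ∀ t, D 0 t b = 1 := honeb _ (by omega) (by omega)
      simp [this]
    · simp [hDb]
  have hDD : ∀ j < m, ∀ x, ∀ᶠ t in 𝓝 (0 : ℂ),
      deriv (fun t => D j t x) t = vel (ix s m a b a) U s t b * D (j + 1) t x := by
    intro j hj x
    by_cases hx : x = b
    · simp [hx, hDderiv, hDb]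
    · have := h.deriv_succ (j := s + j) (b := x) (by omega)
        (by rwa [hb _ (by omega) (by omega)])
      rw [hb _ (by omega) (by omega)] at this
      simp only [hD _ _ x hx]
      rw [show s + 1 + j = s + j + 1 by omega]
      filter_upwards [this] with t ht
      rw [ht, hvb _ (by omega) (by omega), show s + 1 + (j + 1) = s + j + 2 by omega]
  have hDan : ∀ j ≤ m, ∀ x, AnalyticAt ℂ (fun t => D j t x) 0 := by
    intro j hj x
    by_cases hx : x = b
    · rcases j with _ | j
      · exact h.an _ (by omega) x
      · simp only [hx, hDb]; exact analyticAt_const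
    · simp only [hD _ _ x hx]; exact h.an _ (by omega) x
  have hDmem : ∀ i ≤ m, ∀ x, (fun t => D (m - i) t x) ∈
      tower (fun t => vel (ix s m a b a) U s t b) analyticGerms i := by
    intro i
    induction i with
    | zero => exact fun _ x => hDan _ le_rfl x
    | succ i ih =>
      intro hi x
      refine ⟨hDan _ (Nat.sub_le _ _) x, _, ih (by omega) x, ?_⟩
      have := hDD (m - (i + 1)) (by omega) x
      rwa [show m - (i + 1) + 1 = m - i by omega] at this
  let z : ℂ → Fin n → ℂ := fun t => Function.update (U (s + m + 2) t) b 0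
  have hzb : ∀ t, z t b = 0 := fun t => Function.update_self ..
  have hz : ∀ t x, x ≠ b → z t x = U (s + m + 2) t x := fun t x hx => Function.update_of_ne hx ..
  have hDz : ∀ x, deriv (fun t => D m t x) 0 =
      vel (ix s m a b a) U (s + m + 1) 0 a * z 0 x := by
    intro x
    by_cases hx : x = b
    · simp [hx, hDderiv, hzb]
    · have := (h.deriv_succ (j := s + m) (b := x) (by omega)
        (by rwa [hb _ (by omega) (by omega)])).self_of_nhds
      rw [hc _ (by omega)] at this
      simp only [hD _ _ x hx, hz _ x hx]
      rw [show s + 1 + m = s + m + 1 by omega]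
      exact this
  -- The second `V` of the code means `U (s + m + 2) 0 b = 0`, and this entry is the ratio of `η` to
  -- the next velocity.
  have hη : vel (ix s m a b a) U s 0 b = 0 := by
    have := (h.vel_eq (j := s + m + 1) (by omega) b).self_of_nhds
    rwa [hvb _ (by omega) (by omega), h2, mul_zero] at this
  have hD1 : ∀ x, x ≠ b → D 1 0 x = U (s + 2) 0 x := fun x hx => hD 1 0 x hx
  refine three_le_embDim_of_vectors hv1 hv2 (fun g hg hgU =>
    hT.fderiv_iterated hg hgU hs hm h1 (D := D)
      (ω := fun t => vel (ix s m a b a) U (s + m + 1) t a) (z := z) rfl (fun j hj x => ?_) hDD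
      hη hω' hDz ((hz 0 a hab).trans hone))
    (a := a) (b := b) (d := d) (by simp [e1]) h1 (by simp [e2]) ?_ ?_ ?_
  · have := hDmem (m - j) (Nat.sub_le _ _) x
    rwa [show m - (m - j) = j by omega] at this
  · simp [hz _ a hab, hone]
  · simp [hzb, hDb]
  · simp only [Pi.sub_apply, Pi.smul_apply, smul_eq_mul, hz _ d hdb, hD1 d hdb, hD1 a hab]
    rw [mul_comm]
    exact sub_ne_zero.2 hd

end Jet

end

/-! ### Upper bounds from graphs over few coordinates -/

section

variable {n : ℕ}

theorem embDim_congr {γ γ' : ℂ → Fin n → ℂ} (h : ∀ᶠ t in 𝓝 (0 : ℂ), γ t = γ' t) :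
    embDim γ = embDim γ' := by
  have key : ∀ {γ γ' : ℂ → Fin n → ℂ}, (∀ᶠ t in 𝓝 (0 : ℂ), γ t = γ' t) → ∀ d,
      LiesInSubmanifold γ d → LiesInSubmanifold γ' d := by
    rintro γ γ' h d ⟨hd, ψ, h1, h2, h3⟩
    rw [h.self_of_nhds] at h1 h2
    refine ⟨hd, ψ, h1, h2, ?_⟩
    filter_upwards [h, h3] with t ht h3
    rwa [← ht]
  unfold embDim
  congr 1
  ext d
  exact ⟨key h d, key (h.mono fun _ => Eq.symm) d⟩

/-- `LiesInSubmanifold` asks the last coordinates to vanish, so the coordinates in `S` must be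
relabelled to come first. -/
theorem exists_perm_of_card {S : Finset (Fin n)} : ∃ e : Equiv.Perm (Fin n), ∀ j : Fin n,
    S.card ≤ j.1 → e j ∉ S := by
  have h1 : Fintype.card {j : Fin n // j.1 < S.card} = Fintype.card {d // d ∈ S} := by
    have h2 : S.card ≤ n := by simpa using S.card_le_univ
    rw [Fintype.card_coe, Fintype.card_subtype, Fin.card_filter_val_lt, min_eq_right h2]
  obtain ⟨f⟩ := Fintype.card_eq.1 h1
  exact ⟨f.extendSubtype, fun j hj => f.extendSubtype_not_mem j (by omega)⟩

/-- A curve germ in the graph of an analytic function of the coordinates in `S` has embedding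
dimension at most the number of these coordinates. -/
theorem embDim_le_card {γ : ℂ → Fin n → ℂ} (S : Finset (Fin n)) {F : Fin n → (Fin n → ℂ) → ℂ}
    (hF : ∀ d ∉ S, AnalyticAt ℂ (F d) (γ 0))
    (hFS : ∀ d ∉ S, ∀ e ∉ S, ∀ (x : Fin n → ℂ) (t : ℂ),
      F d (x + t • Pi.single e 1) = F d x)
    (hγ : ∀ d ∉ S, ∀ᶠ t in 𝓝 (0 : ℂ), γ t d = F d (γ t)) : embDim γ ≤ S.card := by
  obtain ⟨e, he⟩ := exists_perm_of_card (S := S)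
  -- Subtracting the graph functions straightens the graph. The derivative is triangular, because `F
  -- d` does not depend on the coordinates outside `S`.
  let ψ₀ : (Fin n → ℂ) → Fin n → ℂ := fun x d => if d ∈ S then x d else x d - F d x
  have hx : ∀ d x, AnalyticAt ℂ (fun x : Fin n → ℂ => x d) x := fun d x =>
    (ContinuousLinearMap.proj (R := ℂ) (φ := fun _ : Fin n => ℂ) d).analyticAt x
  have hψ₀ : ∀ d, AnalyticAt ℂ (fun x => ψ₀ x d) (γ 0) := by
    intro d
    by_cases hd : d ∈ S
    · simpa only [ψ₀, hd, if_true] using hx d _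
    · simpa only [ψ₀, hd, if_false] using (hx d _).fun_sub (hF d hd)
  have hψ : AnalyticAt ℂ (fun x j => ψ₀ x (e j)) (γ 0) := analyticAt_pi_iff.2 fun j => hψ₀ (e j)
  refine embDim_le_of_liesIn ⟨by simpa using S.card_le_univ, fun x j => ψ₀ x (e j), hψ, ?_, ?_⟩
  · have hinj : Function.Injective (fderiv ℂ (fun x j => ψ₀ x (e j)) (γ 0)) := by
      refine (injective_iff_map_eq_zero _).2 fun v hv => ?_
      have h1 : ∀ d, fderiv ℂ (fun x => ψ₀ x d) (γ 0) v = 0 := by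
        intro d
        have h2 : HasFDerivAt (fun x => ψ₀ x (e (e.symm d))) _ (γ 0) :=
          hasFDerivAt_pi'.1 hψ.differentiableAt.hasFDerivAt (e.symm d)
        rw [e.apply_symm_apply] at h2
        rw [h2.fderiv]
        exact congrFun hv (e.symm d)
      have hproj : ∀ d, HasFDerivAt (fun x : Fin n → ℂ => x d)
          (ContinuousLinearMap.proj (R := ℂ) (φ := fun _ : Fin n => ℂ) d) (γ 0) :=
        fun d => (ContinuousLinearMap.proj (R := ℂ) (φ := fun _ : Fin n => ℂ) d).hasFDerivAt
      have h3 : ∀ d ∈ S, v d = 0 := by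
        intro d hd
        have h4 := h1 d
        simp only [ψ₀, hd, if_true] at h4
        rw [(hproj d).fderiv] at h4
        exact h4
      ext d
      by_cases hd : d ∈ S
      · exact h3 d hd
      have h4 := h1 d
      simp only [ψ₀, hd, if_false] at h4
      rw [((hproj d).fun_sub (hF d hd).differentiableAt.hasFDerivAt).fderiv] at h4
      have h5 : fderiv ℂ (F d) (γ 0) v = 0 := by
        rw [fderiv_eq_sum]
        refine Finset.sum_eq_zero fun b _ => ?_
        by_cases hb : b ∈ S
        · rw [h3 b hb, mul_zero]
        · rw [← (hF d hd).differentiableAt.lineDeriv_eq_fderiv, lineDeriv]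
          simp [hFS d hd b hb]
      have h6 : v d - fderiv ℂ (F d) (γ 0) v = 0 := h4
      rwa [h5, sub_zero] at h6
    exact ⟨hinj, LinearMap.injective_iff_surjective.1 hinj⟩
  · have h1 : ∀ᶠ t in 𝓝 (0 : ℂ), ∀ d, d ∉ S → γ t d = F d (γ t) :=
      eventually_all.2 fun d => eventually_imp_distrib_left.2 (hγ d)
    filter_upwards [h1] with t ht j hj
    simp only [ψ₀, he j hj, if_false, ht _ (he j hj), sub_self]

/-- A curve germ whose coordinates are analytic combinations of `1` and two of them, with
coefficients depending on a third, has embedding dimension at most `3`. -/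
theorem embDim_le_three {γ : ℂ → Fin n → ℂ} {a b c : Fin n}
    (h : ∀ d, d ≠ a → d ≠ b → d ≠ c → ∃ p q r : ℂ → ℂ, AnalyticAt ℂ p (γ 0 a) ∧
      AnalyticAt ℂ q (γ 0 a) ∧ AnalyticAt ℂ r (γ 0 a) ∧
      ∀ᶠ t in 𝓝 (0 : ℂ), γ t d = p (γ t a) + q (γ t a) * γ t b + r (γ t a) * γ t c) :
    embDim γ ≤ 3 := by
  choose! p q r hp hq hr hγ using h
  have hx : ∀ d x, AnalyticAt ℂ (fun x : Fin n → ℂ => x d) x := fun d x =>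
    (ContinuousLinearMap.proj (R := ℂ) (φ := fun _ : Fin n => ℂ) d).analyticAt x
  refine (embDim_le_card {a, b, c}
    (F := fun d x => p d (x a) + q d (x a) * x b + r d (x a) * x c) ?_ ?_ ?_).trans
    Finset.card_le_three
  · intro d hd
    simp only [Finset.mem_insert, Finset.mem_singleton, not_or] at hd
    have hc : ∀ {f : ℂ → ℂ}, AnalyticAt ℂ f (γ 0 a) →
        AnalyticAt ℂ (fun x : Fin n → ℂ => f (x a)) (γ 0) := fun hf =>
      AnalyticAt.fun_comp hf (hx a _)
    exact ((hc (hp d hd.1 hd.2.1 hd.2.2)).fun_add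
      ((hc (hq d hd.1 hd.2.1 hd.2.2)).fun_mul (hx b _))).fun_add
      ((hc (hr d hd.1 hd.2.1 hd.2.2)).fun_mul (hx c _))
  · intro d hd e he x t
    simp only [Finset.mem_insert, Finset.mem_singleton, not_or] at he
    simp [Ne.symm he.1, Ne.symm he.2.1, Ne.symm he.2.2]
  · intro d hd
    simp only [Finset.mem_insert, Finset.mem_singleton, not_or] at hd
    exact hγ d hd.1 hd.2.1 hd.2.2

end

section

/-! ### Analytic germs in one variable -/

theorem exists_eq_mul_of_eq_zero {f : ℂ → ℂ} (hf : AnalyticAt ℂ f 0) (h0 : f 0 = 0) :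
    ∃ g, AnalyticAt ℂ g 0 ∧ ∀ t, f t = t * g t := by
  obtain ⟨p, hp⟩ := hf
  refine ⟨dslope f 0, ⟨_, hp.has_fpower_series_dslope_fslope⟩, fun t => ?_⟩
  have := sub_smul_dslope f 0 t
  simpa [h0] using this.symm

theorem eventually_ne_zero : ∀ᶠ t in 𝓝[≠] (0 : ℂ), t ≠ 0 := eventually_mem_nhdsWithin

/-- Divisibility of the solutions of Euler's equation. -/
theorem exists_eq_pow_mul_of_euler {c : ℕ} {M : ℂ → ℂ} (hM : AnalyticAt ℂ M 0) {j : ℕ} :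
    ∀ {N : ℕ} {L : ℂ → ℂ}, 0 < N → AnalyticAt ℂ L 0 →
      (∀ᶠ t in 𝓝 (0 : ℂ), N * L t + c * t * deriv L t = t ^ j * M t) →
      ∃ K, AnalyticAt ℂ K 0 ∧ (∀ᶠ t in 𝓝 (0 : ℂ), L t = t ^ j * K t) ∧
        (N + c * j) * K 0 = M 0 := by
  induction j with
  | zero =>
    intro N L hN hL h
    exact ⟨L, hL, by simp, by simpa using h.self_of_nhds⟩
  | succ j ih =>
    intro N L hN hL h
    have h0 : L 0 = 0 := by
      have h1 := h.self_of_nhds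
      have h2 : (N : ℂ) ≠ 0 := Nat.cast_ne_zero.2 hN.ne'
      simpa [h2] using h1
    obtain ⟨P, hP, hLP⟩ := exists_eq_mul_of_eq_zero hL h0
    -- Writing `L = t * P` and cancelling `t` gives the same type of equation with `N` raised by `c`
    -- and `j` lowered by one; the constant accumulates to `N + c * j`.
    have h1 : (fun t => (N + c : ℕ) * P t + c * t * deriv P t) =ᶠ[𝓝 0] fun t => t ^ j * M t := by
      refine eventually_eq_of_mul_eq eventually_ne_zero ?_ ?_ ?_
      · exact (analyticAt_const.fun_mul hP).fun_add
          ((analyticAt_const.fun_mul analyticAt_id).fun_mul hP.deriv)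
      · exact (analyticAt_id.fun_pow j).fun_mul hM
      have h2 : L = fun t => t * P t := funext hLP
      filter_upwards [h, deriv_mul_eventuallyEq analyticAt_id hP] with t e1 e2
      have e3 : deriv L t = P t + t * deriv P t := by
        rw [h2]
        refine e2.trans ?_
        simp
      rw [e3, hLP] at e1
      push_cast
      rw [pow_succ] at e1
      linear_combination e1
    obtain ⟨K, hK, h2, h3⟩ := ih (by omega) hP h1
    refine ⟨K, hK, ?_, ?_⟩
    · filter_upwards [h2] with t ht
      rw [hLP, ht]; ring
    · rw [← h3]; push_cast; ring

/-- A function whose derivative vanishes to order `j`. -/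
theorem exists_eq_add_pow_mul {f h : ℂ → ℂ} (hf : AnalyticAt ℂ f 0) (hh : AnalyticAt ℂ h 0) {j : ℕ}
    (hfh : ∀ᶠ t in 𝓝 (0 : ℂ), deriv f t = t ^ j * h t) :
    ∃ K, AnalyticAt ℂ K 0 ∧ (∀ᶠ t in 𝓝 (0 : ℂ), f t = f 0 + t ^ (j + 1) * K t) ∧
      (1 + j) * K 0 = h 0 := by
  obtain ⟨L, hL, hfL⟩ := exists_eq_mul_of_eq_zero (hf.fun_sub analyticAt_const (g := fun _ => f 0))
    (sub_self _)
  have h1 : f = fun t => t * L t + f 0 := funext fun t => by rw [← hfL]; ring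
  obtain ⟨K, hK, h2, h3⟩ := exists_eq_pow_mul_of_euler (c := 1) (N := 1) hh one_pos hL (by
    filter_upwards [hfh, deriv_mul_eventuallyEq analyticAt_id hL] with t e1 e2
    rw [← e1, h1, deriv_add_const]
    refine Eq.trans ?_ e2.symm
    simp)
  refine ⟨K, hK, ?_, by simpa using h3⟩
  filter_upwards [h2] with t ht
  conv_lhs => rw [h1]
  dsimp only
  rw [ht]; ring

theorem exists_analyticAt_hasSum {c : ℕ → ℂ} {r : NNReal} (hr : 0 < r) {C : ℝ}
    (h : ∀ i, ‖c i‖ * (r : ℝ) ^ i ≤ C) :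
    ∃ K, AnalyticAt ℂ K 0 ∧ ∀ᶠ z in 𝓝 (0 : ℂ), HasSum (fun i => z ^ i * c i) (K z) := by
  let p := FormalMultilinearSeries.ofScalars ℂ c
  have hp : 0 < p.radius := by
    refine lt_of_lt_of_le (ENNReal.coe_pos.2 hr) (p.le_radius_of_bound C fun i => ?_)
    rw [FormalMultilinearSeries.ofScalars_norm]
    exact h i
  have h1 := (p.hasFPowerSeriesOnBall hp).hasFPowerSeriesAt
  refine ⟨p.sum, h1.analyticAt, ?_⟩
  filter_upwards [hasFPowerSeriesAt_iff.1 h1] with z hz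
  simpa [p, FormalMultilinearSeries.coeff_ofScalars] using hz

theorem tendsto_cube : Tendsto (fun t : ℂ => t ^ 3) (𝓝 0) (𝓝 0) := by
  have : ContinuousAt (fun t : ℂ => t ^ 3) 0 := by fun_prop
  simpa [ContinuousAt] using this

/-- The power series is split by residues of the exponents modulo 3. The three subseries inherit a
geometric bound, with radius `r ^ 3`. -/
theorem exists_decomposition {f : ℂ → ℂ} (hf : AnalyticAt ℂ f 0) :
    ∃ K : Fin 3 → ℂ → ℂ, (∀ i, AnalyticAt ℂ (K i) 0) ∧
      ∀ᶠ t in 𝓝 (0 : ℂ), f t = K 0 (t ^ 3) + t * K 1 (t ^ 3) + t ^ 2 * K 2 (t ^ 3) := by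
  obtain ⟨p, hp⟩ := hf
  obtain ⟨r, hr, hrp⟩ := ENNReal.lt_iff_exists_nnreal_btwn.1 hp.radius_pos
  have hr0 : 0 < r := by exact_mod_cast hr
  obtain ⟨C, -, hC⟩ := p.norm_mul_pow_le_of_lt_radius hrp
  have h1 : ∀ j : Fin 3, ∃ K, AnalyticAt ℂ K 0 ∧
      ∀ᶠ z in 𝓝 (0 : ℂ), HasSum (fun i => z ^ i * p.coeff (j + 3 * i)) (K z) := by
    intro j
    refine exists_analyticAt_hasSum (r := r ^ 3) (C := C / r ^ (j : ℕ)) (pow_pos hr0 3) fun i => ?_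
    have h2 := hC (j + 3 * i)
    have h3 : (0 : ℝ) < r ^ (j : ℕ) := pow_pos (by exact_mod_cast hr0) _
    rw [FormalMultilinearSeries.norm_apply_eq_norm_coef] at h2
    rw [le_div_iff₀ h3]
    refine le_trans (le_of_eq ?_) h2
    push_cast
    ring
  choose K hK hKs using h1
  refine ⟨K, hK, ?_⟩
  filter_upwards [hasFPowerSeriesAt_iff.1 hp, tendsto_cube.eventually (hKs 0),
    tendsto_cube.eventually (hKs 1), tendsto_cube.eventually (hKs 2)] with t h1 h2 h3 h4
  rw [zero_add] at h1
  rw [← h1.tsum_eq, Nat.sumByResidueClasses h1.summable 3, ← h2.tsum_eq, ← h3.tsum_eq,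
    ← h4.tsum_eq, ← tsum_mul_left, ← tsum_mul_left]
  refine (Fin.sum_univ_three _).trans ?_
  congr 1
  · congr 1
    all_goals
      refine tsum_congr fun i => ?_
      simp only [smul_eq_mul]
    · change t ^ (0 + 3 * i) * p.coeff (0 + 3 * i) = (t ^ 3) ^ i * p.coeff (0 + 3 * i)
      ring
    · change t ^ (1 + 3 * i) * p.coeff (1 + 3 * i) = t * ((t ^ 3) ^ i * p.coeff (1 + 3 * i))
      ring
  · refine tsum_congr fun i => ?_
    change t ^ (2 + 3 * i) * p.coeff (2 + 3 * i) = t ^ 2 * ((t ^ 3) ^ i * p.coeff (2 + 3 * i))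
    ring

theorem eventually_eq_zero_of_comp_cube {K : ℂ → ℂ} (hK : AnalyticAt ℂ K 0)
    (h : ∀ᶠ t in 𝓝 (0 : ℂ), K (t ^ 3) = 0) : ∀ᶠ z in 𝓝 (0 : ℂ), K z = 0 := by
  refine hK.eventually_eq_zero_or_eventually_ne_zero.resolve_right fun h1 => ?_
  have h2 : Tendsto (fun t : ℂ => t ^ 3) (𝓝[≠] 0) (𝓝[≠] 0) := by
    refine tendsto_nhdsWithin_iff.2 ⟨tendsto_cube.mono_left nhdsWithin_le_nhds, ?_⟩
    filter_upwards [eventually_ne_zero] with t ht using pow_ne_zero 3 ht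
  obtain ⟨t, ht, ht'⟩ := ((h2.eventually h1).and (nhdsWithin_le_nhds h)).exists
  exact ht ht'

/-- Substituting `ζ t` with `ζ` a primitive cube root of unity leaves `t³` fixed and multiplies the
three terms by `1, ζ, ζ²`. Suitable weighted averages over the three substitutions isolate each
term. -/
theorem decomposition_unique {K L : Fin 3 → ℂ → ℂ} (hK : ∀ i, AnalyticAt ℂ (K i) 0)
    (hL : ∀ i, AnalyticAt ℂ (L i) 0)
    (h : ∀ᶠ t in 𝓝 (0 : ℂ), K 0 (t ^ 3) + t * K 1 (t ^ 3) + t ^ 2 * K 2 (t ^ 3) =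
      L 0 (t ^ 3) + t * L 1 (t ^ 3) + t ^ 2 * L 2 (t ^ 3)) (i : Fin 3) :
    ∀ᶠ z in 𝓝 (0 : ℂ), K i z = L i z := by
  have hz := Complex.isPrimitiveRoot_exp 3 (by norm_num)
  set ζ := Complex.exp (2 * Real.pi * Complex.I / (3 : ℕ))
  have h1 : ζ ^ 3 = 1 := hz.pow_eq_one
  have h2 : 1 + ζ + ζ ^ 2 = 0 := by
    have := hz.geom_sum_eq_zero (by norm_num)
    simpa [Finset.sum_range_succ] using this
  have hlim : ∀ c : ℂ, Tendsto (fun t : ℂ => c * t) (𝓝 0) (𝓝 0) := fun c => by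
    have : ContinuousAt (fun t : ℂ => c * t) 0 := by fun_prop
    simpa [ContinuousAt] using this
  have key : ∀ᶠ t in 𝓝[≠] (0 : ℂ), ∀ i, K i (t ^ 3) - L i (t ^ 3) = 0 := by
    filter_upwards [nhdsWithin_le_nhds h, nhdsWithin_le_nhds ((hlim ζ).eventually h),
      nhdsWithin_le_nhds ((hlim (ζ ^ 2)).eventually h), eventually_ne_zero] with t e0 e1 e2 ht
    have c1 : (ζ * t) ^ 3 = t ^ 3 := by rw [mul_pow, h1, one_mul]
    have c2 : (ζ ^ 2 * t) ^ 3 = t ^ 3 := by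
      rw [mul_pow, ← pow_mul, mul_comm 2 3, pow_mul, h1, one_pow, one_mul]
    rw [c1] at e1
    rw [c2] at e2
    have h3 : ζ ^ 4 = ζ := by rw [pow_succ, h1, one_mul]
    intro i
    fin_cases i
    · refine mul_left_cancel₀ (three_ne_zero (α := ℂ)) ?_
      simp only [Fin.zero_eta, mul_zero]
      linear_combination e0 + e1 + e2 -
        (t * (K 1 (t ^ 3) - L 1 (t ^ 3)) + t ^ 2 * (K 2 (t ^ 3) - L 2 (t ^ 3))) * h2 -
        (t ^ 2 * (K 2 (t ^ 3) - L 2 (t ^ 3))) * h3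
    · refine mul_left_cancel₀ (mul_ne_zero (three_ne_zero (α := ℂ)) ht) ?_
      simp only [Fin.mk_one, mul_zero]
      linear_combination e0 + ζ ^ 2 * e1 + ζ * e2 -
        ((K 0 (t ^ 3) - L 0 (t ^ 3)) + t ^ 2 * (K 2 (t ^ 3) - L 2 (t ^ 3))) * h2 -
        (2 * t * (K 1 (t ^ 3) - L 1 (t ^ 3))) * h1 -
        (t ^ 2 * (K 2 (t ^ 3) - L 2 (t ^ 3))) * (h3 + ζ ^ 2 * h1)
    · refine mul_left_cancel₀ (mul_ne_zero (three_ne_zero (α := ℂ)) (pow_ne_zero 2 ht)) ?_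
      simp only [Fin.reduceFinMk, mul_zero]
      linear_combination e0 + ζ * e1 + ζ ^ 2 * e2 -
        ((K 0 (t ^ 3) - L 0 (t ^ 3)) + t * (K 1 (t ^ 3) - L 1 (t ^ 3))) * h2 -
        (t * (K 1 (t ^ 3) - L 1 (t ^ 3))) * h3 -
        (t ^ 2 * (K 2 (t ^ 3) - L 2 (t ^ 3))) * (2 + ζ ^ 3) * h1
  have h3 : ∀ᶠ t in 𝓝 (0 : ℂ), K i (t ^ 3) - L i (t ^ 3) = 0 := by
    have hcube : AnalyticAt ℂ (fun t : ℂ => t ^ 3) 0 := analyticAt_id.fun_pow 3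
    have h4 : AnalyticAt ℂ (fun t => K i (t ^ 3) - L i (t ^ 3)) 0 :=
      (AnalyticAt.fun_comp (by simpa using hK i) hcube).fun_sub
        (AnalyticAt.fun_comp (by simpa using hL i) hcube)
    exact (h4.frequently_zero_iff_eventually_zero).1 (key.mono fun t ht => ht i).frequently
  filter_upwards [eventually_eq_zero_of_comp_cube ((hK i).fun_sub (hL i)) h3] with z hz
  exact sub_eq_zero.1 hz

end

/-! ### Parts of a function modulo `t³` and their behaviour under integration -/

section

/-- `f` is the sum of a function of `t³`, of `t ^ (3 i + 1)` times the function `B` of `t³` and of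
`t ^ (3 j + 2)` times the function `C` of `t³`. -/
def HasParts (i j : ℕ) (f B C : ℂ → ℂ) : Prop :=
  AnalyticAt ℂ B 0 ∧ AnalyticAt ℂ C 0 ∧ ∃ A, AnalyticAt ℂ A 0 ∧
    ∀ᶠ t in 𝓝 (0 : ℂ), f t = A (t ^ 3) + t * ((t ^ 3) ^ i * B (t ^ 3)) +
      t ^ 2 * ((t ^ 3) ^ j * C (t ^ 3))

theorem HasParts.add {i j : ℕ} {f g B C B' C' : ℂ → ℂ} (hf : HasParts i j f B C)
    (hg : HasParts i j g B' C') :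
    HasParts i j (fun t => f t + g t) (fun t => B t + B' t) (fun t => C t + C' t) := by
  obtain ⟨hB, hC, A, hA, h⟩ := hf
  obtain ⟨hB', hC', A', hA', h'⟩ := hg
  refine ⟨hB.fun_add hB', hC.fun_add hC', _, hA.fun_add hA', ?_⟩
  filter_upwards [h, h'] with t e e'
  rw [e, e']; ring

theorem HasParts.const_mul {i j : ℕ} {f B C : ℂ → ℂ} (c : ℂ) (hf : HasParts i j f B C) :
    HasParts i j (fun t => c * f t) (fun t => c * B t) (fun t => c * C t) := by
  obtain ⟨hB, hC, A, hA, h⟩ := hf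
  refine ⟨analyticAt_const.fun_mul hB, analyticAt_const.fun_mul hC, fun z => c * A z,
    analyticAt_const.fun_mul hA, ?_⟩
  filter_upwards [h] with t e
  rw [e]; ring

theorem HasParts.congr {i j : ℕ} {f g B C : ℂ → ℂ} (hf : HasParts i j f B C)
    (h : ∀ᶠ t in 𝓝 (0 : ℂ), g t = f t) : HasParts i j g B C := by
  obtain ⟨hB, hC, A, hA, h'⟩ := hf
  refine ⟨hB, hC, A, hA, ?_⟩
  filter_upwards [h, h'] with t e e'
  rw [e, e']

theorem analyticAt_comp_cube {K : ℂ → ℂ} (hK : AnalyticAt ℂ K 0) :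
    AnalyticAt ℂ (fun t => K (t ^ 3)) 0 :=
  AnalyticAt.fun_comp (by simpa using hK) (analyticAt_id.fun_pow 3)

theorem deriv_comp_cube {K : ℂ → ℂ} (hK : AnalyticAt ℂ K 0) :
    ∀ᶠ t in 𝓝 (0 : ℂ), deriv (fun t => K (t ^ 3)) t = 3 * t ^ 2 * deriv K (t ^ 3) := by
  filter_upwards [tendsto_cube.eventually hK.eventually_analyticAt] with t ht
  have h1 : HasDerivAt (fun t : ℂ => t ^ 3) (3 * t ^ 2) t := by simpa using hasDerivAt_pow 3 t
  have h2 := ht.differentiableAt.hasDerivAt.comp t h1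
  rw [mul_comm]
  exact h2.deriv

theorem deriv_pow_comp_cube {K : ℂ → ℂ} (hK : AnalyticAt ℂ K 0) (N : ℕ) :
    ∀ᶠ t in 𝓝 (0 : ℂ), deriv (fun t => t ^ (N + 1) * K (t ^ 3)) t =
      t ^ N * ((N + 1) * K (t ^ 3) + 3 * t ^ 3 * deriv K (t ^ 3)) := by
  filter_upwards [deriv_comp_cube hK, deriv_mul_eventuallyEq (analyticAt_id.fun_pow (N + 1))
    (analyticAt_comp_cube hK)] with t e1 e2
  refine e2.trans ?_
  rw [e1]
  simp only [id, deriv_pow_field, Nat.cast_add, Nat.cast_one, Nat.add_sub_cancel]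
  ring

/-- Integration with respect to `t³`. -/
theorem HasParts.integrate {i j : ℕ} {f g B C : ℂ → ℂ} (hg : HasParts i j g B C)
    (hf : AnalyticAt ℂ f 0) (hfg : ∀ᶠ t in 𝓝 (0 : ℂ), deriv f t = 3 * t ^ 2 * g t) :
    ∃ B' C', HasParts (i + 1) (j + 1) f B' C' ∧ (1 + 3 * (i + 1)) * B' 0 = 3 * B 0 ∧
      (2 + 3 * (j + 1)) * C' 0 = 3 * C 0 := by
  obtain ⟨hB, hC, A, hA, hg⟩ := hg
  obtain ⟨K, hK, hfK⟩ := exists_decomposition hf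
  have hid : AnalyticAt ℂ (fun t : ℂ => t) 0 := analyticAt_id
  have hder : ∀ᶠ t in 𝓝 (0 : ℂ), deriv f t = 3 * t ^ 2 * deriv (K 0) (t ^ 3) +
      (K 1 (t ^ 3) + 3 * t ^ 3 * deriv (K 1) (t ^ 3)) +
      t * (2 * K 2 (t ^ 3) + 3 * t ^ 3 * deriv (K 2) (t ^ 3)) := by
    have h0 : f =ᶠ[𝓝 0] fun t => (K 0 (t ^ 3) + t ^ (0 + 1) * K 1 (t ^ 3)) +
        t ^ (1 + 1) * K 2 (t ^ 3) := by
      filter_upwards [hfK] with t ht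
      rw [ht]; ring
    have a0 := analyticAt_comp_cube (hK 0)
    have a1 := (hid.fun_pow (0 + 1)).fun_mul (analyticAt_comp_cube (hK 1))
    have a2 := (hid.fun_pow (1 + 1)).fun_mul (analyticAt_comp_cube (hK 2))
    filter_upwards [h0.deriv, deriv_comp_cube (hK 0), deriv_pow_comp_cube (hK 1) 0,
      deriv_pow_comp_cube (hK 2) 1, deriv_add_eventuallyEq a0 a1,
      deriv_add_eventuallyEq (a0.fun_add a1) a2] with t e0 e1 e2 e3 e4 e5
    rw [e0, e5, e4, e1, e2, e3]
    push_cast; ring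
  have hpow : ∀ N : ℕ, AnalyticAt ℂ (fun t : ℂ => t ^ N) 0 := fun N => hid.fun_pow N
  -- Comparing the components of `deriv f` and `3 * t ^ 2 * g`: the factor `t ^ 2` turns the `t`
  -- part of `g` into the component free of `t`, and its `t ^ 2` part into the `t` component, each
  -- gaining a factor `t³`. The first two comparisons are Euler equations for `K 1` and `K 2`.
  have huniq := decomposition_unique
    (K := ![fun z => K 1 z + 3 * z * deriv (K 1) z, fun z => 2 * K 2 z + 3 * z * deriv (K 2) z,
      fun z => 3 * deriv (K 0) z])
    (L := ![fun z => 3 * z ^ (i + 1) * B z, fun z => 3 * z ^ (j + 1) * C z, fun z => 3 * A z])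
    (fun l => by
      fin_cases l
      · exact (hK 1).fun_add ((analyticAt_const.fun_mul hid).fun_mul (hK 1).deriv)
      · exact (analyticAt_const.fun_mul (hK 2)).fun_add
          ((analyticAt_const.fun_mul hid).fun_mul (hK 2).deriv)
      · exact analyticAt_const.fun_mul (hK 0).deriv)
    (fun l => by
      fin_cases l
      · exact (analyticAt_const.fun_mul (hpow _)).fun_mul hB
      · exact (analyticAt_const.fun_mul (hpow _)).fun_mul hC
      · exact analyticAt_const.fun_mul hA)
    (by
      filter_upwards [hder, hfg, hg] with t e1 e2 e3
      rw [e2, e3] at e1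
      simp only [Matrix.cons_val_zero, Matrix.cons_val_one, Matrix.cons_val]
      linear_combination -e1)
  have h1 := huniq 0
  have h2 := huniq 1
  simp only [Matrix.cons_val_zero, Matrix.cons_val_one] at h1 h2
  obtain ⟨B', hB', e1, e2⟩ := exists_eq_pow_mul_of_euler (c := 3) (N := 1) (j := i + 1)
    (analyticAt_const.fun_mul hB (f := fun _ => 3)) one_pos (hK 1) (by
      filter_upwards [h1] with z hz
      push_cast
      linear_combination hz)
  obtain ⟨C', hC', e3, e4⟩ := exists_eq_pow_mul_of_euler (c := 3) (N := 2) (j := j + 1)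
    (analyticAt_const.fun_mul hC (f := fun _ => 3)) two_pos (hK 2) (by
      filter_upwards [h2] with z hz
      push_cast
      linear_combination hz)
  refine ⟨B', C', ⟨hB', hC', K 0, hK 0, ?_⟩, by push_cast at e2; exact e2, by
    push_cast at e4; exact e4⟩
  filter_upwards [hfK, tendsto_cube.eventually e1, tendsto_cube.eventually e3] with t e5 e6 e7
  rw [e5, e6, e7]

/-- The factors depend only on `i`, `j` and `s`, hence the quantifier order: the same `κ` and `μ`
serve for all entries, so a determinant of leading parts is just multiplied by `κ * μ`. -/
theorem HasParts.iterate_integrate (i j s : ℕ) : ∃ κ μ : ℂ, κ ≠ 0 ∧ μ ≠ 0 ∧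
    ∀ (f : ℕ → ℂ → ℂ) (B C : ℂ → ℂ), HasParts i j (f s) B C →
      (∀ l < s, AnalyticAt ℂ (f l) 0) →
      (∀ l < s, ∀ᶠ t in 𝓝 (0 : ℂ), deriv (f l) t = 3 * t ^ 2 * f (l + 1) t) →
      ∃ B' C', HasParts (i + s) (j + s) (f 0) B' C' ∧ B' 0 = κ * B 0 ∧ C' 0 = μ * C 0 := by
  induction s with
  | zero => exact ⟨1, 1, one_ne_zero, one_ne_zero, fun f B C h _ _ => ⟨B, C, h, by simp, by simp⟩⟩
  | succ s ih =>
    obtain ⟨κ, μ, hκ, hμ, ih⟩ := ih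
    have h1 : (1 + 3 * ((i + s : ℕ) + 1) : ℂ) ≠ 0 := by
      have : ((1 + 3 * (i + s + 1) : ℕ) : ℂ) ≠ 0 := Nat.cast_ne_zero.2 (by omega)
      exact_mod_cast this
    have h2 : (2 + 3 * ((j + s : ℕ) + 1) : ℂ) ≠ 0 := by
      have : ((2 + 3 * (j + s + 1) : ℕ) : ℂ) ≠ 0 := Nat.cast_ne_zero.2 (by omega)
      exact_mod_cast this
    refine ⟨3 * κ / (1 + 3 * ((i + s : ℕ) + 1)), 3 * μ / (2 + 3 * ((j + s : ℕ) + 1)),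
      div_ne_zero (mul_ne_zero three_ne_zero hκ) h1, div_ne_zero (mul_ne_zero three_ne_zero hμ) h2,
      fun f B C h hf hd => ?_⟩
    obtain ⟨B₁, C₁, h3, h4, h5⟩ := ih (fun l => f (l + 1)) B C h (fun l hl => hf _ (by omega))
      fun l hl => hd _ (by omega)
    obtain ⟨B₂, C₂, h6, h7, h8⟩ := h3.integrate (hf 0 (by omega)) (hd 0 (by omega))
    refine ⟨B₂, C₂, h6, ?_, ?_⟩
    · rw [div_mul_eq_mul_div, eq_div_iff h1, mul_comm, h7, h4]; ring
    · rw [div_mul_eq_mul_div, eq_div_iff h2, mul_comm, h8, h5]; ring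

/-- Solving for a function in terms of two independent ones. -/
theorem HasParts.exists_combination {i j : ℕ} {f₁ f₂ f B₁ C₁ B₂ C₂ B C : ℂ → ℂ}
    (h₁ : HasParts i j f₁ B₁ C₁) (h₂ : HasParts i j f₂ B₂ C₂) (h : HasParts i j f B C)
    (hdet : B₁ 0 * C₂ 0 - B₂ 0 * C₁ 0 ≠ 0) :
    ∃ p q r : ℂ → ℂ, AnalyticAt ℂ p 0 ∧ AnalyticAt ℂ q 0 ∧ AnalyticAt ℂ r 0 ∧
      ∀ᶠ t in 𝓝 (0 : ℂ), f t = p (t ^ 3) + q (t ^ 3) * f₁ t + r (t ^ 3) * f₂ t := by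
  obtain ⟨hB₁, hC₁, A₁, hA₁, h₁⟩ := h₁
  obtain ⟨hB₂, hC₂, A₂, hA₂, h₂⟩ := h₂
  obtain ⟨hB, hC, A, hA, h⟩ := h
  have hD : AnalyticAt ℂ (fun z => B₁ z * C₂ z - B₂ z * C₁ z) 0 :=
    (hB₁.fun_mul hC₂).fun_sub (hB₂.fun_mul hC₁)
  -- Cramer's rule for the `t` and `t ^ 2` parts; the common powers of `t³` do not matter.
  have hq : AnalyticAt ℂ (fun z => (B z * C₂ z - B₂ z * C z) / (B₁ z * C₂ z - B₂ z * C₁ z)) 0 :=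
    ((hB.fun_mul hC₂).fun_sub (hB₂.fun_mul hC)).fun_div hD hdet
  have hr : AnalyticAt ℂ (fun z => (B₁ z * C z - B z * C₁ z) / (B₁ z * C₂ z - B₂ z * C₁ z)) 0 :=
    ((hB₁.fun_mul hC).fun_sub (hB.fun_mul hC₁)).fun_div hD hdet
  refine ⟨_, _, _, (hA.fun_sub (hq.fun_mul hA₁)).fun_sub (hr.fun_mul hA₂), hq, hr, ?_⟩
  filter_upwards [h₁, h₂, h, tendsto_cube.eventually (hD.continuousAt.eventually_ne hdet)]
    with t e1 e2 e3 e4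
  rw [e1, e2, e3]
  generalize t ^ 3 = z at *
  have h1 : (B z * C₂ z - B₂ z * C z) / (B₁ z * C₂ z - B₂ z * C₁ z) * B₁ z +
      (B₁ z * C z - B z * C₁ z) / (B₁ z * C₂ z - B₂ z * C₁ z) * B₂ z = B z := by
    rw [div_mul_eq_mul_div, div_mul_eq_mul_div, ← add_div, div_eq_iff e4]; ring
  have h2 : (B z * C₂ z - B₂ z * C z) / (B₁ z * C₂ z - B₂ z * C₁ z) * C₁ z +
      (B₁ z * C z - B z * C₁ z) / (B₁ z * C₂ z - B₂ z * C₁ z) * C₂ z = C z := by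
    rw [div_mul_eq_mul_div, div_mul_eq_mul_div, ← add_div, div_eq_iff e4]; ring
  linear_combination -t * z ^ i * h1 - t ^ 2 * z ^ j * h2

end

/-! ### The coordinate in which the base function is a cube -/

section

/-- After dividing by its value at `0`, the function is near `1`, where the logarithm is analytic.
-/
theorem exists_cube_root {K : ℂ → ℂ} (hK : AnalyticAt ℂ K 0) (h0 : K 0 ≠ 0) :
    ∃ ρ, AnalyticAt ℂ ρ 0 ∧ ρ 0 ≠ 0 ∧ ∀ᶠ t in 𝓝 (0 : ℂ), ρ t ^ 3 = K t := by
  obtain ⟨r, hr⟩ := IsAlgClosed.exists_pow_nat_eq (K 0) (n := 3) (by norm_num)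
  have hr0 : r ≠ 0 := by
    rintro rfl
    exact h0 (by rw [← hr]; norm_num)
  have h1 : AnalyticAt ℂ (fun t => K t / K 0) 0 := hK.fun_div analyticAt_const h0
  have h2 : K 0 / K 0 ∈ Complex.slitPlane := by rw [div_self h0]; exact Complex.one_mem_slitPlane
  refine ⟨fun t => r * Complex.exp (Complex.log (K t / K 0) / 3),
    analyticAt_const.fun_mul (((h1.clog h2).fun_div analyticAt_const three_ne_zero).cexp),
    mul_ne_zero hr0 (Complex.exp_ne_zero _), ?_⟩
  filter_upwards [hK.continuousAt.eventually_ne h0] with t ht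
  rw [mul_pow, hr, ← Complex.exp_nat_mul]
  push_cast
  rw [mul_div_cancel₀ _ three_ne_zero, Complex.exp_log (div_ne_zero ht h0), mul_div_cancel₀ _ h0]

/-- A coordinate in which a function with a critical point of order two is a cube. -/
theorem exists_cube_coordinate {x ξ : ℂ → ℂ} (hx : AnalyticAt ℂ x 0) (hξ : AnalyticAt ℂ ξ 0)
    (hξ0 : ξ 0 ≠ 0) (h : ∀ᶠ t in 𝓝 (0 : ℂ), deriv x t = t ^ 2 * ξ t) :
    ∃ φ χ τ : ℂ → ℂ, AnalyticAt ℂ χ 0 ∧ χ 0 ≠ 0 ∧ (∀ t, φ t = t * χ t) ∧ AnalyticAt ℂ τ 0 ∧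
      τ 0 = 0 ∧ (∀ᶠ t in 𝓝 (0 : ℂ), φ (τ t) = t) ∧ ∀ᶠ t in 𝓝 (0 : ℂ), x (φ t) = x 0 + t ^ 3 := by
  obtain ⟨K, hK, hxK, hK0⟩ := exists_eq_add_pow_mul hx hξ h
  have hK1 : K 0 ≠ 0 := by
    rintro h1
    rw [h1, mul_zero] at hK0
    exact hξ0 hK0.symm
  obtain ⟨ρ, hρ, hρ0, hρK⟩ := exists_cube_root hK hK1
  -- The new parameter is `τ = t * ρ t`, whose cube is `x - x 0`; `φ` will be its local inverse.
  have hτ : AnalyticAt ℂ (fun t => t * ρ t) 0 := analyticAt_id.fun_mul hρ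
  have hτ' : deriv (fun t => t * ρ t) 0 ≠ 0 := by
    have h1 : deriv (fun t => t * ρ t) 0 = deriv id (0 : ℂ) * ρ 0 + id 0 * deriv ρ 0 :=
      (deriv_mul_eventuallyEq analyticAt_id hρ).self_of_nhds
    rw [h1]
    simpa using hρ0
  set φ := hτ.hasStrictDerivAt.localInverse _ _ _ hτ'
  have hφan : AnalyticAt ℂ φ 0 := by
    have := hτ.analyticAt_localInverse hτ'
    rwa [zero_mul] at this
  have hφl : ∀ᶠ t in 𝓝 (0 : ℂ), φ (t * ρ t) = t :=
    HasStrictDerivAt.eventually_left_inverse hτ.hasStrictDerivAt hτ'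
  have hφr : ∀ᶠ t in 𝓝 (0 : ℂ), φ t * ρ (φ t) = t := by
    have := HasStrictDerivAt.eventually_right_inverse hτ.hasStrictDerivAt hτ'
    rwa [zero_mul] at this
  have hφ0 : φ 0 = 0 := by simpa using hφl.self_of_nhds
  obtain ⟨χ, hχ, hφχ⟩ := exists_eq_mul_of_eq_zero hφan hφ0
  have hφt : Tendsto φ (𝓝 0) (𝓝 0) := by
    have := hφan.continuousAt
    rwa [ContinuousAt, hφ0] at this
  refine ⟨φ, χ, fun t => t * ρ t, hχ, ?_, hφχ, hτ, zero_mul _, hφl, ?_⟩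
  · have h1 : (fun t => χ t * ρ (φ t)) =ᶠ[𝓝 0] fun _ => 1 := by
      refine eventually_eq_of_mul_eq eventually_ne_zero
        (hχ.fun_mul (AnalyticAt.fun_comp (by rwa [hφ0]) hφan)) analyticAt_const ?_
      filter_upwards [hφr] with t ht
      rw [← mul_assoc, ← hφχ, ht, mul_one]
    have h2 := h1.self_of_nhds
    exact left_ne_zero_of_mul (ne_of_eq_of_ne h2 one_ne_zero)
  · filter_upwards [hφt.eventually hxK, hφt.eventually hρK, hφr] with t e1 e2 e3
    rw [e1, ← e2, ← mul_pow, e3]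

section Parts

variable {F G : ℂ → ℂ} {c e : ℂ} (hG : AnalyticAt ℂ G 0)
include hG

theorem exists_hasParts_one (h : ∀ᶠ t in 𝓝 (0 : ℂ), F t = c + t ^ 1 * G t) :
    ∃ B C, HasParts 0 0 F B C ∧ B 0 = G 0 := by
  obtain ⟨K, hK, hGK⟩ := exists_decomposition hG
  refine ⟨K 0, K 1, ⟨hK 0, hK 1, fun z => c + z * K 2 z,
    analyticAt_const.fun_add (analyticAt_id.fun_mul (hK 2)), ?_⟩, ?_⟩
  · filter_upwards [h, hGK] with t e1 e2
    rw [e1, e2]; ring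
  · simpa using hGK.self_of_nhds.symm

/-- There is no linear term, so the `t` part starts at `t ^ 4`, which permits `i = 1`. The primed
version below keeps `i = 0`, in order to be comparable with functions of order one. -/
theorem exists_hasParts_two (h : ∀ᶠ t in 𝓝 (0 : ℂ), F t = c + t ^ 2 * G t) :
    ∃ B C, HasParts 1 0 F B C ∧ C 0 = G 0 := by
  obtain ⟨K, hK, hGK⟩ := exists_decomposition hG
  refine ⟨K 2, K 0, ⟨hK 2, hK 0, fun z => c + z * K 1 z,
    analyticAt_const.fun_add (analyticAt_id.fun_mul (hK 1)), ?_⟩, ?_⟩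
  · filter_upwards [h, hGK] with t e1 e2
    rw [e1, e2]; ring
  · simpa using hGK.self_of_nhds.symm

theorem exists_hasParts_two' (h : ∀ᶠ t in 𝓝 (0 : ℂ), F t = c + t ^ 2 * G t) :
    ∃ B C, HasParts 0 0 F B C ∧ B 0 = 0 ∧ C 0 = G 0 := by
  obtain ⟨B, C, ⟨hB, hC, A, hA, h1⟩, h2⟩ := exists_hasParts_two hG h
  refine ⟨fun z => z * B z, C, ⟨analyticAt_id.fun_mul hB, hC, A, hA, ?_⟩, zero_mul _, h2⟩
  filter_upwards [h1] with t e1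
  rw [e1]; ring

/-- The cubic term belongs to the part depending on `t³` alone, so the leading information sits
entirely in the `t ^ 4` coefficient. -/
theorem exists_hasParts_four (h : ∀ᶠ t in 𝓝 (0 : ℂ), F t = c + e * t ^ 3 + t ^ 4 * G t) :
    ∃ B C, HasParts 1 0 F B C ∧ B 0 = G 0 ∧ C 0 = 0 := by
  obtain ⟨K, hK, hGK⟩ := exists_decomposition hG
  refine ⟨K 0, fun z => z * K 1 z, ⟨hK 0, analyticAt_id.fun_mul (hK 1),
    fun z => (c + e * z) + z ^ 2 * K 2 z,
    (analyticAt_const.fun_add (analyticAt_const.fun_mul analyticAt_id)).fun_add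
      ((analyticAt_id.fun_pow 2).fun_mul (hK 2)), ?_⟩, ?_, zero_mul _⟩
  · filter_upwards [h, hGK] with t e1 e2
    rw [e1, e2]; ring
  · simpa using hGK.self_of_nhds.symm

end Parts

variable {n : ℕ}

/-- Curves for which the coordinate `a` has a critical point of order two and the last block is
spanned by two functions and the functions of that coordinate. -/
theorem Tangency.embDim_le_three {s m : ℕ} {a : Fin n} {U : ℕ → ℂ → Fin n → ℂ} {X η ξ : ℂ → ℂ}
    {w : ℂ → Fin n → ℂ} (h : Tangency s m a U X η w) (hξ : AnalyticAt ℂ ξ 0) (hξ0 : ξ 0 ≠ 0)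
    (hX : ∀ᶠ t in 𝓝 (0 : ℂ), X t = t ^ 2 * ξ t) {i j : ℕ} {b d : Fin n} (hb : b ≠ a) (hd : d ≠ a)
    (htop : ∀ φ χ : ℂ → ℂ, AnalyticAt ℂ χ 0 → χ 0 ≠ 0 → (∀ t, φ t = t * χ t) →
      (∀ᶠ t in 𝓝 (0 : ℂ), U 0 (φ t) a = U 0 0 a + t ^ 3) →
      (∃ B₁ C₁ B₂ C₂, HasParts i j (fun t => U s (φ t) b) B₁ C₁ ∧
        HasParts i j (fun t => U s (φ t) d) B₂ C₂ ∧ B₁ 0 * C₂ 0 - B₂ 0 * C₁ 0 ≠ 0) ∧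
      ∀ e, e ≠ a → ∃ B C, HasParts i j (fun t => U s (φ t) e) B C) :
    embDim (U 0) ≤ 3 := by
  obtain ⟨φ, χ, τ, hχ, hχ0, hφχ, hτ, hτ0, hφτ, hφx⟩ :=
    exists_cube_coordinate (h.an 0 (Nat.zero_le _) a) hξ hξ0 (by
      filter_upwards [h.deriv_base, hX] with t e1 e2
      rw [e1, e2])
  obtain ⟨⟨B₁, C₁, B₂, C₂, hp₁, hp₂, hdet⟩, hp⟩ := htop φ χ hχ hχ0 hφχ hφx
  have hφan : AnalyticAt ℂ φ 0 := by
    rw [show φ = fun t => t * χ t from funext hφχ]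
    exact analyticAt_id.fun_mul hχ
  have hφ0 : φ 0 = 0 := by rw [hφχ, zero_mul]
  have hφt : Tendsto φ (𝓝 0) (𝓝 0) := by
    have := hφan.continuousAt
    rwa [ContinuousAt, hφ0] at this
  have han : ∀ l ≤ s, ∀ e, AnalyticAt ℂ (fun t => U l (φ t) e) 0 := fun l hl e =>
    AnalyticAt.fun_comp (g := fun t => U l t e) (f := φ) (by rw [hφ0]; exact h.an l hl e) hφan
  have hchain : ∀ l ≤ s, ∀ e, ∀ᶠ t in 𝓝 (0 : ℂ),
      deriv (fun t => U l (φ t) e) t = deriv (fun t => U l t e) (φ t) * deriv φ t := by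
    intro l hl e
    filter_upwards [hφt.eventually (h.an l hl e).eventually_analyticAt,
      hφan.eventually_analyticAt] with t e1 e2
    exact (e1.differentiableAt.hasDerivAt.comp t e2.differentiableAt.hasDerivAt).deriv
  -- In the new parameter the velocity of the coordinate `a` is that of `t³`, so each block is an
  -- integral of the next with respect to `t³`.
  have hXφ : ∀ᶠ t in 𝓝 (0 : ℂ), X (φ t) * deriv φ t = 3 * t ^ 2 := by
    have h1 : (fun t => U 0 (φ t) a) =ᶠ[𝓝 0] fun t => U 0 0 a + t ^ 3 := hφx
    filter_upwards [h1.deriv, hchain 0 (Nat.zero_le _) a, hφt.eventually h.deriv_base]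
      with t e1 e2 e3
    rw [← e3, ← e2, e1]
    simp
  obtain ⟨κ, μ, hκ, hμ, hint⟩ := HasParts.iterate_integrate i j s
  have hbase : ∀ e, e ≠ a → ∀ B C, HasParts i j (fun t => U s (φ t) e) B C →
      ∃ B' C', HasParts (i + s) (j + s) (fun t => U 0 (φ t) e) B' C' ∧ B' 0 = κ * B 0 ∧
        C' 0 = μ * C 0 := by
    intro e he B C hBC
    refine hint (fun l t => U l (φ t) e) B C hBC (fun l hl => han l hl.le e) fun l hl => ?_
    filter_upwards [hchain l hl.le e, hφt.eventually (h.deriv_block l hl e he), hXφ]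
      with t e1 e2 e3
    rw [e1, e2, ← e3]; ring
  obtain ⟨B₁', C₁', h1, h2, h3⟩ := hbase b hb _ _ hp₁
  obtain ⟨B₂', C₂', h4, h5, h6⟩ := hbase d hd _ _ hp₂
  have hdet' : B₁' 0 * C₂' 0 - B₂' 0 * C₁' 0 ≠ 0 := by
    rw [h2, h3, h5, h6]
    have := mul_ne_zero (mul_ne_zero hκ hμ) hdet
    convert this using 1
    ring
  refine MonsterTower.embDim_le_three (a := a) (b := b) (c := d) fun e hea _ _ => ?_
  obtain ⟨B, C, hBC⟩ := hp e hea
  obtain ⟨B', C', h7, -, -⟩ := hbase e hea _ _ hBC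
  obtain ⟨p, q, r, hp', hq', hr', hpqr⟩ := h1.exists_combination h4 h7 hdet'
  have hshift : ∀ {f : ℂ → ℂ}, AnalyticAt ℂ f 0 →
      AnalyticAt ℂ (fun z => f (z - U 0 0 a)) (U 0 0 a) := fun hf =>
    AnalyticAt.fun_comp (by rwa [sub_self]) (analyticAt_id.fun_sub analyticAt_const)
  refine ⟨_, _, _, hshift hp', hshift hq', hshift hr', ?_⟩
  -- The relation was found in the parameter that makes the coordinate a cube; composing with `τ`
  -- brings it back to the original one.
  have hτt : Tendsto τ (𝓝 0) (𝓝 0) := by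
    have := hτ.continuousAt
    rwa [ContinuousAt, hτ0] at this
  filter_upwards [hφτ, hτt.eventually hpqr, hτt.eventually hφx] with t e1 e2 e3
  rw [e1] at e2 e3
  rw [e3, add_sub_cancel_left, e2]

end

/-! ### Upper bounds for `RˢVT` and `RˢVVR` -/

section

variable {n : ℕ}

theorem exists_eq_add_mul_deriv {f h : ℂ → ℂ} (hf : AnalyticAt ℂ f 0) (hh : AnalyticAt ℂ h 0)
    (hfh : ∀ᶠ t in 𝓝 (0 : ℂ), deriv f t = h t) :
    ∃ K, AnalyticAt ℂ K 0 ∧ (∀ᶠ t in 𝓝 (0 : ℂ), f t = f 0 + t ^ 1 * K t) ∧ K 0 = h 0 := by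
  obtain ⟨K, h1, h2, h3⟩ := exists_eq_add_pow_mul (j := 0) hf hh (by simpa using hfh)
  exact ⟨K, h1, h2, by simpa using h3⟩

theorem eventually_comp_mul {F G φ χ : ℂ → ℂ} {c : ℂ} {m : ℕ} (hG : AnalyticAt ℂ G 0)
    (hχ : AnalyticAt ℂ χ 0) (hφ : ∀ t, φ t = t * χ t)
    (h : ∀ᶠ t in 𝓝 (0 : ℂ), F t = c + t ^ m * G t) :
    ∃ K, AnalyticAt ℂ K 0 ∧ (∀ᶠ t in 𝓝 (0 : ℂ), F (φ t) = c + t ^ m * K t) ∧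
      K 0 = χ 0 ^ m * G 0 := by
  have hφ0 : φ 0 = 0 := by rw [hφ, zero_mul]
  have hφan : AnalyticAt ℂ φ 0 := by
    rw [show φ = fun t => t * χ t from funext hφ]
    exact analyticAt_id.fun_mul hχ
  have hφt : Tendsto φ (𝓝 0) (𝓝 0) := by
    have := hφan.continuousAt
    rwa [ContinuousAt, hφ0] at this
  refine ⟨fun t => χ t ^ m * G (φ t), (hχ.fun_pow m).fun_mul
    (AnalyticAt.fun_comp (by rwa [hφ0]) hφan), ?_, by dsimp only; rw [hφ0]⟩
  filter_upwards [hφt.eventually h] with t e1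
  rw [e1, hφ, mul_pow]
  ring

namespace Jet

variable {s : ℕ} {U : ℕ → ℂ → Fin n → ℂ} {a b d : Fin n}

/-- Both `a` and `b` are active, so regularity gives `η 0 ≠ 0` and a simple zero of `U (s + 2)` at
the entry `a`. Hence `w a`, and with it `X`, vanishes to order exactly two. The entry `b` of block
`s` has order one, and the entry `d`, corrected by a multiple of it, order two, so they supply the
`t` and `t ^ 2` parts. -/
theorem embDim_le_three_VT (h : Jet (s + 2) (ix s 0 a b b) U) (hs : 1 ≤ s) (hab : a ≠ b)
    (h1 : U (s + 1) 0 a = 0) (h2 : U (s + 2) 0 a = 0) (hda : d ≠ a) (hdb : d ≠ b)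
    (hd : U (s + 2) 0 d ≠ 0) (hva : vel (ix s 0 a b b) U (s + 2) 0 a ≠ 0)
    (hvb : vel (ix s 0 a b b) U (s + 2) 0 b ≠ 0) : embDim (U 0) ≤ 3 := by
  have ha : ∀ j, 1 ≤ j → j ≤ s → ix s 0 a b b j = a := fun j _ h => ix_left h
  have hb : ∀ j, s < j → ix s 0 a b b j = b := fun j h => ix_self h
  have hT := h.tangency (m := 0) hs (by omega) ha fun j h _ => hb j h
  have hη : ∀ j, s ≤ j → ∀ t, vel (ix s 0 a b b) U j t b = vel (ix s 0 a b b) U s t b :=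
    fun j hj t => vel_eq_of_const hj (fun i h3 _ => hb i h3) t
  set η : ℂ → ℂ := fun t => vel (ix s 0 a b b) U s t b with hη_def
  have hηan : AnalyticAt ℂ η 0 := h.analyticAt_vel (by omega) b
  have hη0 : η 0 ≠ 0 := by rwa [hη _ (by omega)] at hvb
  have hw : ∀ x, x ≠ b → ∀ᶠ t in 𝓝 (0 : ℂ),
      deriv (fun t => U (s + 1) t x) t = η t * U (s + 2) t x := by
    intro x hx
    have := h.deriv_succ (j := s) (b := x) (by omega) (by rwa [hb _ (by omega)])
    rw [hb _ (by omega)] at this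
    filter_upwards [this] with t ht
    rw [ht, hη _ (by omega)]
  have hz : deriv (fun t => U (s + 2) t a) 0 ≠ 0 := by
    rwa [← vel_succ_of_ne (a := ix s 0 a b b) (U := U) (j := s + 1)
      (by rwa [hb _ (by omega)])]
  have hone : ∀ t, U (s + 1) t b = 1 := fun t => by
    have := h.norm t (s + 1) (by omega) (by omega)
    rwa [hb _ (by omega)] at this
  have hUan : ∀ j ≤ s + 2, ∀ x, AnalyticAt ℂ (fun t => U j t x) 0 := h.an
  obtain ⟨k, hk, hzk, hk0⟩ := exists_eq_add_mul_deriv (hUan (s + 2) le_rfl a)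
    (hUan (s + 2) le_rfl a).deriv (Eventually.of_forall fun _ => rfl)
  obtain ⟨K, hK, hwK, hK0⟩ := exists_eq_add_pow_mul (j := 1) (hUan (s + 1) (by omega) a)
    (hηan.fun_mul hk) (by
      filter_upwards [hw a hab, hzk] with t e1 e2
      rw [e1, e2, h2]; ring)
  have hKne : K 0 ≠ 0 := by
    rintro h3
    rw [h3, mul_zero, hk0] at hK0
    exact mul_ne_zero hη0 hz hK0.symm
  have hXη : ∀ᶠ t in 𝓝 (0 : ℂ), vel (ix s 0 a b b) U 0 t a = t ^ 2 * (η t * K t) := by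
    filter_upwards [hT.X_eq, hwK] with t e1 e2
    rw [e1, e2, h1]; ring
  obtain ⟨Gb, hGb, hUb, hGb0⟩ := exists_eq_add_mul_deriv (hUan s (by omega) b) hηan (by
    filter_upwards [hT.deriv_last b hab.symm] with t e1
    rw [e1, hone, mul_one])
  -- The multiple of the entry `b` that removes the linear term of the entry `d` of block `s`.
  set c := U (s + 1) 0 d
  obtain ⟨l, hl, hwl, hl0⟩ := exists_eq_add_mul_deriv (hUan (s + 1) (by omega) d)
    (hηan.fun_mul (hUan (s + 2) le_rfl d)) (hw d hdb)
  obtain ⟨Gd, hGd, hUd, hGd0⟩ := exists_eq_add_pow_mul (j := 1)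
    ((hUan s (by omega) d).fun_sub (analyticAt_const.fun_mul (hUan s (by omega) b) (f := fun _ => c)))
    (hηan.fun_mul hl) (by
      filter_upwards [hT.deriv_last b hab.symm, hT.deriv_last d hda, hwl,
        deriv_sub_eventuallyEq (hUan s (by omega) d)
          (analyticAt_const.fun_mul (hUan s (by omega) b) (f := fun _ => c))] with t e1 e2 e3 e4
      rw [e4, deriv_const_mul_field, e1, e2, hone, e3]
      ring)
  have hGdne : Gd 0 ≠ 0 := by
    rintro h3
    rw [h3, mul_zero, hl0] at hGd0
    exact mul_ne_zero hη0 (mul_ne_zero hη0 hd) hGd0.symm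
  refine hT.embDim_le_three (hηan.fun_mul hK) (mul_ne_zero hη0 hKne) hXη (i := 0) (j := 0)
    hab.symm hda fun φ χ hχ hχ0 hφχ hφx => ⟨?_, fun e he => ?_⟩
  · obtain ⟨H, hH, hbH, hH0⟩ := eventually_comp_mul hGb hχ hφχ hUb
    obtain ⟨H', hH', hdH', hH0'⟩ := eventually_comp_mul hGd hχ hφχ hUd
    obtain ⟨B, C, hBC, hB0⟩ := exists_hasParts_one hH hbH
    obtain ⟨B', C', hBC', hB0', hC0'⟩ := exists_hasParts_two' hH' hdH'
    refine ⟨B, C, _, _, hBC, ((hBC.const_mul c).add hBC').congr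
      (Eventually.of_forall fun t => by ring), ?_⟩
    have : B 0 * C' 0 ≠ 0 := by
      rw [hB0, hH0, hC0', hH0', hGb0]
      exact mul_ne_zero (mul_ne_zero (pow_ne_zero _ hχ0) hη0) (mul_ne_zero (pow_ne_zero _ hχ0) hGdne)
    convert this using 1
    rw [hB0']; ring
  · obtain ⟨G, hG, hUG, -⟩ := exists_eq_add_mul_deriv (hUan s (by omega) e)
      (hUan s (by omega) e).deriv (Eventually.of_forall fun _ => rfl)
    obtain ⟨H, hH, heH, -⟩ := eventually_comp_mul hG hχ hφχ hUG
    obtain ⟨B, C, hBC, -⟩ := exists_hasParts_one hH heH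
    exact ⟨B, C, hBC⟩

/-- Here `w a` and `η` both have simple zeros, the latter because `U (s + 3) b ≠ 0`, so `X` again
has order two. The entry `b` of block `s` has order two, and the entry `d` yields a function of
order four after removing a multiple of `b` and a multiple of the coordinate `a` itself. These are
the leading terms of the `t ^ 2` and `t` parts respectively. -/
theorem embDim_le_three_VVR (h : Jet (s + 3) (ix s 0 a b a) U) (hs : 1 ≤ s) (hab : a ≠ b)
    (h1 : U (s + 1) 0 a = 0) (h2 : U (s + 2) 0 b = 0) (hb3 : U (s + 3) 0 b ≠ 0) (hda : d ≠ a)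
    (hdb : d ≠ b) (hd : U (s + 3) 0 d ≠ 0) (hva : vel (ix s 0 a b a) U (s + 3) 0 a ≠ 0) :
    embDim (U 0) ≤ 3 := by
  have ha : ∀ j, 1 ≤ j → j ≤ s → ix s 0 a b a j = a := fun j _ h => ix_left h
  have hb : ∀ j, s < j → j ≤ s + 0 + 1 → ix s 0 a b a j = b := fun j h h' => ix_mid h h'
  have hc : ∀ j, s + 1 < j → ix s 0 a b a j = a := fun j h => ix_right (by omega)
  have hT := h.tangency (m := 0) hs (by omega) ha hb
  have hω : ∀ j, s + 1 ≤ j → ∀ t, vel (ix s 0 a b a) U j t a = vel (ix s 0 a b a) U (s + 1) t a :=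
    fun j hj t => vel_eq_of_const hj (fun i h3 _ => hc i h3) t
  set ω : ℂ → ℂ := fun t => vel (ix s 0 a b a) U (s + 1) t a with hω_def
  have hωan : AnalyticAt ℂ ω 0 := h.analyticAt_vel (by omega) a
  have hω0 : ω 0 ≠ 0 := by rwa [hω _ (by omega)] at hva
  have hUan : ∀ j ≤ s + 3, ∀ x, AnalyticAt ℂ (fun t => U j t x) 0 := h.an
  have hw : ∀ x, x ≠ b → ∀ᶠ t in 𝓝 (0 : ℂ),
      deriv (fun t => U (s + 1) t x) t = ω t * U (s + 2) t x := by
    intro x hx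
    have := h.deriv_succ (j := s) (b := x) (by omega) (by rwa [hb _ (by omega) (by omega)])
    rwa [hc _ (by omega)] at this
  have hz : ∀ x, x ≠ a → ∀ᶠ t in 𝓝 (0 : ℂ),
      deriv (fun t => U (s + 2) t x) t = ω t * U (s + 3) t x := by
    intro x hx
    have := h.deriv_succ (j := s + 1) (b := x) (by omega) (by rwa [hc _ (by omega)])
    rw [hc _ (by omega)] at this
    filter_upwards [this] with t ht
    rw [ht, hω _ (by omega)]
  have hone : ∀ t, U (s + 1) t b = 1 := fun t => by
    have := h.norm t (s + 1) (by omega) (by omega)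
    rwa [hb _ (by omega) (by omega)] at this
  have hone' : ∀ t, U (s + 2) t a = 1 := fun t => by
    have := h.norm t (s + 2) (by omega) (by omega)
    rwa [hc _ (by omega)] at this
  obtain ⟨K₁, hK₁, hwK, hK₁0⟩ := exists_eq_add_mul_deriv (hUan (s + 1) (by omega) a) hωan (by
    filter_upwards [hw a hab] with t e1
    rw [e1, hone', mul_one])
  obtain ⟨K₂, hK₂, hzK, hK₂0⟩ := exists_eq_add_mul_deriv (hUan (s + 2) (by omega) b)
    (hωan.fun_mul (hUan (s + 3) le_rfl b)) (hz b hab.symm)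
  have hK₂ne : K₂ 0 ≠ 0 := by rw [hK₂0]; exact mul_ne_zero hω0 hb3
  have hη : ∀ᶠ t in 𝓝 (0 : ℂ), vel (ix s 0 a b a) U s t b = t * (ω t * K₂ t) := by
    have := h.vel_eq (j := s + 1) (by omega) b
    rw [hc _ (by omega)] at this
    filter_upwards [this, hzK] with t e1 e2
    rw [← vel_eq_of_const (Nat.le_succ s) (fun i h3 h4 => hb i (by omega) (by omega)) t, e1, e2, h2]
    simp only [ω]
    ring
  have hX : ∀ᶠ t in 𝓝 (0 : ℂ), vel (ix s 0 a b a) U 0 t a = t ^ 2 * (ω t * K₂ t * K₁ t) := by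
    filter_upwards [hT.X_eq, hwK, hη] with t e1 e2 e3
    rw [e1, e3, e2, h1]; ring
  have hlast : ∀ e, e ≠ a → ∃ G, AnalyticAt ℂ G 0 ∧
      (∀ᶠ t in 𝓝 (0 : ℂ), U s t e = U s 0 e + t ^ 2 * G t) ∧
        2 * G 0 = ω 0 * K₂ 0 * U (s + 1) 0 e := by
    intro e he
    obtain ⟨G, hG, hUG, hG0⟩ := exists_eq_add_pow_mul (j := 1) (hUan s (by omega) e)
      ((hωan.fun_mul hK₂).fun_mul (hUan (s + 1) (by omega) e)) (by
        filter_upwards [hT.deriv_last e he, hη] with t e1 e2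
        rw [e1, e2]; ring)
    refine ⟨G, hG, hUG, ?_⟩
    rw [← hG0]; push_cast; ring
  obtain ⟨Gb, hGb, hUb, hGb0⟩ := hlast b hab.symm
  have hGbne : Gb 0 ≠ 0 := by
    rintro h3
    rw [h3, mul_zero, hone, mul_one] at hGb0
    exact mul_ne_zero hω0 hK₂ne hGb0.symm
  -- `c` cancels the order two term of the entry `d` against the entry `b`, and `e` cancels its
  -- order three term against the coordinate `a`. The order four coefficient is then non-zero
  -- because `U (s + 3) d ≠ 0`.
  set c := U (s + 1) 0 d
  set e := U (s + 2) 0 d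
  obtain ⟨K₃, hK₃, hzd, hK₃0⟩ := exists_eq_add_mul_deriv (hUan (s + 2) (by omega) d)
    (hωan.fun_mul (hUan (s + 3) le_rfl d)) (hz d hda)
  have han_e : ∀ j ≤ s + 3, ∀ (c : ℂ) x, AnalyticAt ℂ (fun t => c * U j t x) 0 :=
    fun j hj c x => analyticAt_const.fun_mul (hUan j hj x)
  obtain ⟨K₄, hK₄, hV, hK₄0⟩ := exists_eq_add_pow_mul (j := 1)
    ((hUan (s + 1) (by omega) d).fun_sub (han_e (s + 1) (by omega) e a)) (hωan.fun_mul hK₃) (by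
      filter_upwards [hw d hdb, hw a hab, hzd, deriv_sub_eventuallyEq (hUan (s + 1) (by omega) d)
        (han_e (s + 1) (by omega) e a)] with t e1 e2 e3 e4
      rw [e4, deriv_const_mul_field, e1, e2, e3, hone']
      ring)
  obtain ⟨Gd, hGd, hUd, hGd0⟩ := exists_eq_add_pow_mul (j := 3)
    (((hUan s (by omega) d).fun_sub (han_e s (by omega) c b)).fun_sub (han_e 0 (by omega) e a))
    ((hωan.fun_mul hK₂).fun_mul hK₄) (by
      filter_upwards [hT.deriv_last b hab.symm, hT.deriv_last d hda, hT.deriv_base, hT.X_eq, hη, hV,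
        deriv_sub_eventuallyEq (hUan s (by omega) d) (han_e s (by omega) c b),
        deriv_sub_eventuallyEq ((hUan s (by omega) d).fun_sub (han_e s (by omega) c b))
          (han_e 0 (by omega) e a)] with t e1 e2 e3 e4 e5 e6 e7 e8
      rw [e8, e7, deriv_const_mul_field, deriv_const_mul_field, e1, e2, e3, e4, e5, hone]
      rw [h1] at e6
      linear_combination t * (ω t * K₂ t) * e6)
  have hGdne : Gd 0 ≠ 0 := by
    rintro h3
    rw [h3, mul_zero] at hGd0
    have h4 : K₄ 0 ≠ 0 := by
      rintro h5
      rw [h5, mul_zero, hK₃0] at hK₄0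
      exact mul_ne_zero hω0 (mul_ne_zero hω0 hd) hK₄0.symm
    exact mul_ne_zero (mul_ne_zero hω0 hK₂ne) h4 hGd0.symm
  refine hT.embDim_le_three ((hωan.fun_mul hK₂).fun_mul hK₁)
    (mul_ne_zero (mul_ne_zero hω0 hK₂ne) (by rwa [hK₁0])) hX (i := 1) (j := 0)
    hab.symm hda fun φ χ hχ hχ0 hφχ hφx => ⟨?_, fun x hx => ?_⟩
  · obtain ⟨H, hH, hbH, hH0⟩ := eventually_comp_mul hGb hχ hφχ hUb
    obtain ⟨H', hH', hdH', hH0'⟩ := eventually_comp_mul hGd hχ hφχ hUd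
    obtain ⟨B, C, hBC, hC0⟩ := exists_hasParts_two hH hbH
    obtain ⟨B', C', hBC', hB0', hC0'⟩ := exists_hasParts_four hH'
      (F := fun t => U s (φ t) d - c * U s (φ t) b)
      (c := U s 0 d - c * U s 0 b) (e := e) (by
        filter_upwards [hdH', hφx] with t e1 e2
        rw [e2] at e1
        linear_combination e1)
    refine ⟨B, C, _, _, hBC, ((hBC.const_mul c).add hBC').congr
      (Eventually.of_forall fun t => by ring), ?_⟩
    have : -(B' 0 * C 0) ≠ 0 := by
      rw [hB0', hH0', hC0, hH0]
      exact neg_ne_zero.2 (mul_ne_zero (mul_ne_zero (pow_ne_zero _ hχ0) hGdne)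
        (mul_ne_zero (pow_ne_zero _ hχ0) hGbne))
    convert this using 1
    rw [hC0']; ring
  · obtain ⟨G, hG, hUG, -⟩ := hlast x hx
    obtain ⟨H, hH, hxH, -⟩ := eventually_comp_mul hG hχ hφχ hUG
    obtain ⟨B, C, hBC, -⟩ := exists_hasParts_two hH hxH
    exact ⟨B, C, hBC⟩

end Jet

end

/-! ### An explicit curve through each `L` point -/

section

variable {n : ℕ}

theorem exists_primitive {f : ℂ → ℂ} (hf : Differentiable ℂ f) (y : ℂ) :
    ∃ g, Differentiable ℂ g ∧ g 0 = y ∧ ∀ t, deriv g t = f t := by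
  obtain ⟨g, h1, h2⟩ := hf.isExactOn_univ.with_val_at 0 y
  exact ⟨g, fun t => (h2 t trivial).differentiableAt, h1, fun t => (h2 t trivial).deriv⟩

/-- Successive integration of a block of entire functions. -/
theorem exists_integrated_blocks {X : ℂ → ℂ} (hX : Differentiable ℂ X) (a : Fin n)
    (U₀ : ℕ → Fin n → ℂ) (s : ℕ) : ∀ V : ℂ → Fin n → ℂ, (∀ e, Differentiable ℂ fun t => V t e) →
      ∃ W : ℕ → ℂ → Fin n → ℂ, W s = V ∧ (∀ j ≤ s, ∀ e, Differentiable ℂ fun t => W j t e) ∧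
        (∀ j < s, W j 0 = U₀ j) ∧ ∀ j < s, ∀ e t, deriv (fun t => W j t e) t =
          if e = a then (if j = 0 then X t else 0) else X t * W (j + 1) t e := by
  induction s with
  | zero =>
    intro V hV
    refine ⟨fun _ => V, rfl, fun _ _ => hV, ?_, ?_⟩ <;> intro j hj <;> omega
  | succ s ih =>
    intro V hV
    have h1 : ∀ e, ∃ g : ℂ → ℂ, Differentiable ℂ g ∧ g 0 = U₀ s e ∧
        ∀ t, deriv g t = if e = a then (if s = 0 then X t else 0) else X t * V t e := by
      intro e
      refine exists_primitive ?_ _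
      split_ifs
      · exact hX
      · exact differentiable_const 0
      · exact hX.fun_mul (hV e)
    choose g hg hg0 hg' using h1
    obtain ⟨W, h2, h3, h4, h5⟩ := ih (fun t e => g e t) hg
    have h6 : ∀ j ≤ s, Function.update W (s + 1) V j = W j := fun j hj =>
      Function.update_of_ne (by omega) ..
    refine ⟨Function.update W (s + 1) V, Function.update_self .., ?_, ?_, ?_⟩
    · intro j hj e
      rcases Nat.le_succ_iff.1 hj with hj | rfl
      · rw [h6 j hj]; exact h3 j hj e
      · rw [Function.update_self]; exact hV e
    · intro j hj
      rw [h6 j (by omega)]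
      rcases Nat.lt_succ_iff_lt_or_eq.1 hj with hj | rfl
      · exact h4 j hj
      · rw [h2]; exact funext hg0
    · intro j hj e t
      rw [h6 j (by omega)]
      rcases Nat.lt_succ_iff_lt_or_eq.1 hj with hj | rfl
      · rw [h6 (j + 1) (by omega)]; exact h5 j hj e t
      · rw [h2, Function.update_self]; exact hg' e t

theorem eq_add_of_deriv_eq {f g : ℂ → ℂ} (hf : Differentiable ℂ f) (hg : Differentiable ℂ g)
    (h : ∀ t, deriv f t = deriv g t) (t : ℂ) : f t = g t + (f 0 - g 0) := by
  have := is_const_of_deriv_eq_zero (hf.fun_sub hg) (fun t => by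
    rw [deriv_fun_sub (hf t) (hg t), h, sub_self]) t 0
  linear_combination this

/-- Through each point of the class `R ⋯ RVL` there is a regular curve of embedding dimension
at most three. -/
theorem exists_mem_Germ_embDim_le_three {s : ℕ} (hs : 1 ≤ s) {a b c : Fin n} (hab : a ≠ b)
    (hca : c ≠ a) (hcb : c ≠ b) {U₀ : ℕ → Fin n → ℂ} (hU₀ : Normalized (s + 2) (ix s 0 a b c) U₀)
    (h1 : U₀ (s + 1) a = 0) (h2 : U₀ (s + 2) a = 0) (h3 : U₀ (s + 2) b = 0) :
    ∃ γ ∈ Germ (pt (s + 2) (ix s 0 a b c) U₀), embDim γ ≤ 3 := by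
  have ha : ∀ j, j ≤ s → ix s 0 a b c j = a := fun j h => ix_left h
  have hb : ix s 0 a b c (s + 1) = b := ix_mid (by omega) (by omega)
  have hc : ix s 0 a b c (s + 2) = c := ix_right (by omega)
  have e1 : ∀ j, 1 ≤ j → j ≤ s → U₀ j a = 1 := fun j h h' => by
    have := hU₀ j h (by omega)
    rwa [ha j h'] at this
  have e2 : U₀ (s + 1) b = 1 := by
    have := hU₀ (s + 1) (by omega) (by omega)
    rwa [hb] at this
  have e3 : U₀ (s + 2) c = 1 := by
    have := hU₀ (s + 2) (by omega) (by omega)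
    rwa [hc] at this
  -- The top block. At an `L` point the indices `a`, `b` and `c` are all active, so the entries `a`
  -- and `b` must vanish at `0` with non-zero derivative; all other entries are kept constant. The
  -- velocity in the direction `c` is chosen to be `1`, so `T₁` is an integral of `T₂` away from the
  -- entry `b`.
  let T₂ : ℂ → Fin n → ℂ := fun t e => if e = a then t else if e = b then t else U₀ (s + 2) e
  let T₁ : ℂ → Fin n → ℂ := fun t e => if e = a then t ^ 2 / 2 else
    if e = b then 1 else U₀ (s + 1) e + U₀ (s + 2) e * t
  -- The entry `b` of `T₂` fixes the velocity in the direction `b` as `t`, so the velocity of the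
  -- coordinate `a` is `t * T₁ t a`.
  let X : ℂ → ℂ := fun t => t * (t ^ 2 / 2)
  have hXd : Differentiable ℂ X := by fun_prop
  have hT₁d : ∀ e, Differentiable ℂ fun t => T₁ t e := by
    intro e
    simp only [T₁]
    split_ifs <;> fun_prop
  have hT₂d : ∀ e, Differentiable ℂ fun t => T₂ t e := by
    intro e
    simp only [T₂]
    split_ifs <;> fun_prop
  have hV : ∀ e, ∃ g : ℂ → ℂ, Differentiable ℂ g ∧ g 0 = U₀ s e ∧
      ∀ t, deriv g t = if e = a then 0 else t * T₁ t e := by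
    intro e
    refine exists_primitive ?_ _
    split_ifs
    · exact differentiable_const 0
    · exact differentiable_id.fun_mul (hT₁d e)
  choose V hV hV0 hV' using hV
  obtain ⟨W, hWs, hWd, hW0, hW'⟩ :=
    exists_integrated_blocks hXd a U₀ s (fun t e => V e t) hV
  have hWs' : ∀ e t, deriv (fun t => W s t e) t = if e = a then 0 else t * T₁ t e := by
    rw [hWs]; exact hV'
  have hWs0 : ∀ j ≤ s, W j 0 = U₀ j := by
    intro j hj
    rcases hj.lt_or_eq with hj | rfl
    · exact hW0 j hj
    · rw [hWs]; exact funext hV0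
  have hWa : ∀ j, 1 ≤ j → j ≤ s → ∀ t, W j t a = 1 := by
    intro j hj hjs t
    have h4 : ∀ t, deriv (fun t => W j t a) t = 0 := by
      intro t
      rcases hjs.lt_or_eq with hjs | rfl
      · rw [hW' j hjs, if_pos rfl, if_neg (by omega)]
      · rw [hWs', if_pos rfl]
    rw [is_const_of_deriv_eq_zero (hWd j hjs a) h4 t 0, hWs0 j hjs, e1 j hj hjs]
  let U : ℕ → ℂ → Fin n → ℂ := fun j => if j ≤ s then W j else if j = s + 1 then T₁ else T₂
  have hUW : ∀ j, j ≤ s → U j = W j := fun j hj => if_pos hj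
  have hU1 : U (s + 1) = T₁ := by simp [U]
  have hU2 : U (s + 2) = T₂ := by simp [U]
  have hUd : ∀ j ≤ s + 2, ∀ e, Differentiable ℂ fun t => U j t e := by
    intro j hj e
    rcases Nat.lt_trichotomy j (s + 1) with h | rfl | h
    · rw [hUW j (by omega)]; exact hWd j (by omega) e
    · rw [hU1]; exact hT₁d e
    · rw [show j = s + 2 by omega, hU2]; exact hT₂d e
  have hUU₀ : ∀ j ≤ s + 2, U j 0 = U₀ j := by
    intro j hj
    rcases Nat.lt_trichotomy j (s + 1) with h | rfl | h
    · rw [hUW j (by omega)]; exact hWs0 j (by omega)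
    · rw [hU1]
      ext e
      simp only [T₁]
      split_ifs with h4 h5
      · rw [h4, h1]; norm_num
      · rw [h5, e2]
      · ring
    · rw [show j = s + 2 by omega, hU2]
      ext e
      simp only [T₂]
      split_ifs with h4 h5
      · rw [h4, h2]
      · rw [h5, h3]
      · rfl
  have hva : ∀ j ≤ s, ∀ t, vel (ix s 0 a b c) U j t a = X t := by
    intro j hj t
    rw [vel_eq_of_const (Nat.zero_le j) (fun i _ h => ha i (by omega)) t]
    change deriv (fun t => U 0 t a) t = X t
    rw [hUW 0 (by omega), hW' 0 hs, if_pos rfl, if_pos rfl]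
  have hvs : ∀ e, e ≠ a → ∀ t, vel (ix s 0 a b c) U s t e = t * T₁ t e := by
    intro e he t
    obtain ⟨r, rfl⟩ := Nat.exists_eq_add_of_le' hs
    rw [vel_succ_of_ne (by rwa [ha _ le_rfl]), hUW _ le_rfl, hWs', if_neg he]
  have hT₁b : ∀ t, T₁ t b = 1 := fun t => by simp [T₁, hab.symm]
  have hvb : ∀ t, vel (ix s 0 a b c) U (s + 1) t b = t := by
    intro t
    have := vel_succ_self (ix s 0 a b c) U s t
    rw [hb] at this
    rw [this, hvs b hab.symm, hT₁b, mul_one]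
  have hvT : ∀ e, e ≠ b → ∀ t, vel (ix s 0 a b c) U (s + 1) t e = T₂ t e := by
    intro e he t
    rw [vel_succ_of_ne (by rwa [hb]), hU1]
    by_cases hea : e = a
    · have : HasDerivAt (fun t : ℂ => t ^ 2 / 2) t t :=
        ((hasDerivAt_pow 2 t).div_const (2 : ℂ)).congr_deriv (by norm_num)
      simpa only [T₁, T₂, hea, if_true] using this.deriv
    · simp [T₁, T₂, hea, he]
  have hT₂c : ∀ t, T₂ t c = 1 := fun t => by simp [T₂, hca, hcb, e3]
  have hnz : ∀ᶠ t in 𝓝[≠] (0 : ℂ), t ≠ 0 := eventually_ne_zero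
  have hJ : Jet (s + 2) (ix s 0 a b c) U := by
    refine ⟨fun j hj e => (hUd j hj e).analyticAt 0, fun t j h4 h5 => ?_, fun j hj =>
      Eventually.of_forall fun t => ?_, fun j hj => ?_⟩
    · change U j t (ix s 0 a b c j) = 1
      rcases Nat.lt_trichotomy j (s + 1) with h | rfl | h
      · rw [ha j (by omega), hUW j (by omega)]; exact hWa j h4 (by omega) t
      · rw [hb, hU1]; exact hT₁b t
      · rw [show j = s + 2 by omega, hc, hU2]; exact hT₂c t
    · ext e
      rw [Pi.smul_apply, smul_eq_mul]
      rcases Nat.lt_trichotomy j s with h | rfl | h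
      · rw [ha (j + 1) (by omega), hva j h.le, hUW (j + 1) h]
        by_cases he : e = a
        · rw [he, hva j h.le, hWa (j + 1) (by omega) h, mul_one]
        · have h4 : vel (ix s 0 a b c) U j t e = deriv (fun t => W j t e) t := by
            rcases j with _ | j
            · rw [← hUW 0 h.le]; rfl
            · rw [vel_succ_of_ne (by rwa [ha _ h.le]), hUW _ h.le]
          rw [h4, hW' j h, if_neg he]
      · rw [hb, hvs b hab.symm, hU1, hT₁b, mul_one]
        by_cases he : e = a
        · rw [he, hva j le_rfl]; simp [X, T₁]
        · rw [hvs e he]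
      · rw [show j = s + 1 by omega, hc, hU2, hvT c hcb, hT₂c, one_mul]
        by_cases he : e = b
        · rw [he, hvb]; simp [T₂, hab.symm]
        · rw [hvT e he]
    · rcases Nat.lt_trichotomy j s with h | rfl | h
      · rw [ha (j + 1) (by omega)]
        filter_upwards [hnz] with t ht
        rw [hva j h.le]
        exact mul_ne_zero ht (div_ne_zero (pow_ne_zero 2 ht) two_ne_zero)
      · rw [hb]
        filter_upwards [hnz] with t ht
        rwa [hvs b hab.symm, hT₁b, mul_one]
      · rw [show j = s + 1 by omega, hc]
        exact Eventually.of_forall fun t => by rw [hvT c hcb, hT₂c]; exact one_ne_zero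
  refine ⟨U 0, ?_, ?_⟩
  · have h4 : U 0 ∈ Germ (pt (s + 2) (ix s 0 a b c) fun j => U j 0) := by
      refine hJ.mem_Germ fun e he => ?_
      have h5 : vel (ix s 0 a b c) U (s + 2) 0 c = 1 := by
        have := vel_succ_self (ix s 0 a b c) U (s + 1) 0
        rw [hc] at this
        rw [this, hvT c hcb, hT₂c]
      rw [mem_act_succ, hc] at he
      rcases he with rfl | ⟨he, -⟩
      · rw [h5]; exact one_ne_zero
      · rw [act_ix_zero hs ((hJ.norm 0).mono (by omega))
          (by rw [hUU₀ _ (by omega), h1])] at he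
        have h6 : ∀ e, e = b ∨ e = a → vel (ix s 0 a b c) U (s + 2) 0 e ≠ 0 := by
          intro e he
          have hec : e ≠ c := by rcases he with rfl | rfl <;> [exact hcb.symm; exact hca.symm]
          have h7 : (fun t => U (s + 2) t e) = fun t => t := by
            rw [hU2]
            rcases he with rfl | rfl <;> simp [T₂]
          rw [vel_succ_of_ne (by rwa [hc]), h7, deriv_id'']
          exact one_ne_zero
        exact h6 e he
    rwa [pt_congr (fun _ _ _ => rfl) hUU₀] at h4
  · refine embDim_le_three (a := a) (b := b) (c := c) fun d hda hdb hdc => ?_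
    -- Chosen so that `T₁ t d = β * T₁ t b + α * T₁ t c`: `α` matches the linear terms and `β` the
    -- constants.
    set α := U₀ (s + 2) d
    set β := U₀ (s + 1) d - α * U₀ (s + 1) c
    have hx : ∀ t, deriv (fun t => W 0 t a) t = X t := fun t => by
      rw [hW' 0 hs, if_pos rfl, if_pos rfl]
    -- The linear relation at block `s` survives integration with respect to the coordinate `a`, up
    -- to adding a function of that coordinate. Each step replaces `q` by a primitive plus a
    -- constant.
    have key : ∀ i ≤ s, ∃ q : ℂ → ℂ, Differentiable ℂ q ∧ ∀ t, W (s - i) t d =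
        q (W 0 t a) + β * W (s - i) t b + α * W (s - i) t c := by
      intro i
      induction i with
      | zero =>
        intro _
        rw [Nat.sub_zero]
        refine ⟨fun _ => W s 0 d - (β * W s 0 b + α * W s 0 c), differentiable_const _, fun t => ?_⟩
        rw [eq_add_of_deriv_eq (hWd s le_rfl d) (g := fun t => β * W s t b + α * W s t c)
          (((hWd s le_rfl b).const_mul β).fun_add ((hWd s le_rfl c).const_mul α)) (fun t => ?_) t]
        · ring
        · rw [deriv_fun_add (((hWd s le_rfl b).const_mul β) t) (((hWd s le_rfl c).const_mul α) t),
            deriv_const_mul_field, deriv_const_mul_field, hWs', hWs', hWs', if_neg hda,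
            if_neg hab.symm, if_neg hca, hT₁b]
          simp only [T₁, if_neg hda, if_neg hdb, if_neg hca, if_neg hcb, e3, β, α]
          ring
      | succ i ih =>
        intro hi
        obtain ⟨q, hq, hqW⟩ := ih (by omega)
        obtain ⟨Q, hQ, -, hQ'⟩ := exists_primitive hq 0
        set j := s - (i + 1)
        have hj : j < s := by omega
        rw [show s - i = j + 1 by omega] at hqW
        have hQx : Differentiable ℂ fun t => Q (W 0 t a) := hQ.comp (hWd 0 (by omega) a)
        have hQx' : ∀ t, deriv (fun t => Q (W 0 t a)) t = X t * q (W 0 t a) := by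
          intro t
          have := (hQ (W 0 t a)).hasDerivAt.comp t (hWd 0 (by omega) a t).hasDerivAt
          rw [hQ', hx, mul_comm] at this
          exact this.deriv
        have hbc := ((hWd j hj.le b).const_mul β).fun_add ((hWd j hj.le c).const_mul α)
        refine ⟨fun z => Q z + (W j 0 d - (Q (W 0 0 a) + (β * W j 0 b + α * W j 0 c))),
          hQ.add_const _, fun t => ?_⟩
        rw [eq_add_of_deriv_eq (hWd j hj.le d)
          (g := fun t => Q (W 0 t a) + (β * W j t b + α * W j t c))
          (hQx.fun_add hbc) (fun t => ?_) t]
        · ring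
        · rw [deriv_fun_add (hQx t) (hbc t), hQx',
            deriv_fun_add (((hWd j hj.le b).const_mul β) t) (((hWd j hj.le c).const_mul α) t),
            deriv_const_mul_field, deriv_const_mul_field, hW' j hj, hW' j hj, hW' j hj, if_neg hda,
            if_neg hab.symm, if_neg hca, hqW]
          ring
    obtain ⟨q, hq, hqW⟩ := key s le_rfl
    rw [Nat.sub_self] at hqW
    refine ⟨q, fun _ => β, fun _ => α, hq.analyticAt _, analyticAt_const, analyticAt_const,
      Eventually.of_forall fun t => ?_⟩
    rw [hUW 0 (Nat.zero_le s)]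
    exact hqW t

end

/-! ### Combining the bounds at the points of each class -/

section

variable {n : ℕ}

theorem isSpatial_of_mem_classRVL (hn : 3 ≤ n) {s : ℕ} (hs : 1 ≤ s) {p : Point n (s + 2)}
    (hp : p ∈ classRVL n s) : IsSpatial p := by
  obtain ⟨a, b, c, U₀, hab, hca, hcb, hU₀, h1, h2, h3, rfl⟩ :=
    exists_pt_of_mem_classRVL hs hp ⟨0, by omega⟩
  have key : ∀ γ ∈ Germ (pt (s + 2) (ix s 0 a b c) U₀), 3 ≤ embDim γ := by
    intro γ hγ
    obtain ⟨U, hU, hγU, hUU₀, hv⟩ := exists_jet_of_mem_Germ hU₀ hγ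
    have hc : ix s 0 a b c (s + 2) = c := ix_right (by omega)
    have h4 := hU₀ (s + 2) (by omega) le_rfl
    rw [hc] at h4
    rw [embDim_congr hγU]
    exact hU.three_le_embDim_VL hs hab (by rw [hUU₀ _ (by omega), h1])
      (by rw [hUU₀ _ le_rfl, h2]) hcb (by rw [hUU₀ _ le_rfl, h4]; exact one_ne_zero)
      (hv c (mem_act_succ.2 (Or.inl hc.symm)))
  obtain ⟨γ, hγ, hγ3⟩ := exists_mem_Germ_embDim_le_three hs hab hca hcb hU₀ h1 h2 h3
  exact ⟨key, γ, hγ, le_antisymm hγ3 (key γ hγ)⟩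

theorem isPurelySpatial_VT {s : ℕ} (hs : 1 ≤ s) {a b d : Fin n} {U₀ : ℕ → Fin n → ℂ}
    (hab : a ≠ b) (hda : d ≠ a) (hdb : d ≠ b) (hU₀ : Normalized (s + 2) (ix s 0 a b b) U₀)
    (h1 : U₀ (s + 1) a = 0) (h2 : U₀ (s + 2) a = 0) (hd : U₀ (s + 2) d ≠ 0) :
    IsPurelySpatial (pt (s + 2) (ix s 0 a b b) U₀) := by
  intro γ hγ
  obtain ⟨U, hU, hγU, hUU₀, hv⟩ := exists_jet_of_mem_Germ hU₀ hγ
  rw [embDim_congr hγU]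
  have hvb := hv b (mem_act_succ.2 (Or.inl (ix_self (by omega)).symm))
  have hva := hv a (mem_act_succ.2 (Or.inr ⟨by
    rw [act_ix_zero hs (hU₀.mono (by omega)) h1]; simp, h2⟩))
  rw [← hUU₀ _ (by omega)] at h1 h2 hd
  exact le_antisymm (hU.embDim_le_three_VT hs hab h1 h2 hda hdb hd hva hvb)
    (hU.three_le_embDim_VL hs hab h1 h2 hdb hd hvb)

theorem isPurelySpatial_VVR {s : ℕ} (hs : 1 ≤ s) {a b d : Fin n} {U₀ : ℕ → Fin n → ℂ}
    (hab : a ≠ b) (hda : d ≠ a) (hdb : d ≠ b) (hU₀ : Normalized (s + 3) (ix s 0 a b a) U₀)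
    (h1 : U₀ (s + 1) a = 0) (h2 : U₀ (s + 2) b = 0) (hb : U₀ (s + 3) b ≠ 0)
    (hd : U₀ (s + 3) d ≠ 0) : IsPurelySpatial (pt (s + 3) (ix s 0 a b a) U₀) := by
  intro γ hγ
  obtain ⟨U, hU, hγU, hUU₀, hv⟩ := exists_jet_of_mem_Germ hU₀ hγ
  rw [embDim_congr hγU]
  have hva := hv a (mem_act_succ.2 (Or.inl (ix_right (by omega)).symm))
  rw [← hUU₀ _ (by omega)] at h1 h2 hb hd
  exact le_antisymm (hU.embDim_le_three_VVR hs hab h1 h2 hb hda hdb hd hva)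
    (hU.three_le_embDim_VVR hs hab h1 h2 hda hdb hd hva)

theorem three_le_embDim_of_mem_Germ_VRVRR {s m : ℕ} (hs : 1 ≤ s) (hm : 1 ≤ m) {a b d : Fin n}
    {U₀ : ℕ → Fin n → ℂ} (hab : a ≠ b) (hdb : d ≠ b)
    (hU₀ : Normalized (s + m + 4) (ix s m a b a) U₀) (h1 : U₀ (s + 1) a = 0)
    (h2 : U₀ (s + m + 2) b = 0) (hd : U₀ (s + m + 2) d * U₀ (s + 2) a ≠ U₀ (s + 2) d)
    {γ : ℂ → Fin n → ℂ} (hγ : γ ∈ Germ (pt (s + m + 4) (ix s m a b a) U₀)) : 3 ≤ embDim γ := by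
  obtain ⟨U, hU, hγU, hUU₀, hv⟩ := exists_jet_of_mem_Germ hU₀ hγ
  rw [embDim_congr hγU]
  have hva := hv a (mem_act_succ.2 (Or.inl (ix_right (by omega)).symm))
  rw [← hUU₀ _ (by omega)] at h1 h2
  rw [← hUU₀ (s + m + 2) (by omega), ← hUU₀ (s + 2) (by omega)] at hd
  exact hU.three_le_embDim_VRVRR hs hm hab h1 h2 hdb hd hva

end

end MonsterTower

end

theorem mainTheorem5 (n : ℕ) (hn : 3 ≤ n) (s : ℕ) (hs : 1 ≤ s) :
    (∀ p ∈ classRVL n s, IsSpatial p) ∧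
    (∃ U : Set (rvtClass n (s + 2) (Rs s ++ [Letter.V, Letter.T])),
      IsOpen U ∧ Dense U ∧ ∀ p ∈ U, IsPurelySpatial p.1) ∧
    (∃ U : Set (rvtClass n (s + 3) (Rs s ++ [Letter.V, Letter.V, Letter.R])),
      IsOpen U ∧ Dense U ∧ ∀ p ∈ U, IsPurelySpatial p.1) ∧
    (∀ m : ℕ, 1 ≤ m →
      ∃ U : Set (rvtClass n (s + m + 4)
          (Rs s ++ [Letter.V] ++ Rs m ++ [Letter.V, Letter.R, Letter.R])),
        IsOpen U ∧ Dense U ∧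
          (∀ p ∈ U, ∀ γ ∈ Germ p.1, 3 ≤ embDim γ) ∧
          (n = 3 → ∀ p ∈ U, IsPurelySpatial p.1)) := by
  refine ⟨fun p hp => isSpatial_of_mem_classRVL hn hs hp, ?_, ?_, fun m hm => ?_⟩
  · obtain ⟨O, hO, hOd, h⟩ := exists_generic_VT hn hs
    refine ⟨O, hO, hOd, fun p hp => ?_⟩
    obtain ⟨a, b, d, U₀, hab, hda, hdb, hU₀, h1, h2, h3, hpU⟩ := h p hp
    rw [hpU]
    exact isPurelySpatial_VT hs hab hda hdb hU₀ h1 h2 h3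
  · obtain ⟨O, hO, hOd, h⟩ := exists_generic_VVR hn hs
    refine ⟨O, hO, hOd, fun p hp => ?_⟩
    obtain ⟨a, b, d, U₀, hab, hda, hdb, hU₀, h1, h2, h3, h4, hpU⟩ := h p hp
    rw [hpU]
    exact isPurelySpatial_VVR hs hab hda hdb hU₀ h1 h2 h3 h4
  · obtain ⟨O, hO, hOd, h⟩ := exists_generic_VRVRR hn hs hm
    have key : ∀ p ∈ O, ∀ γ ∈ Germ p.1, 3 ≤ embDim γ := by
      intro p hp γ hγ
      obtain ⟨a, b, d, U₀, hab, -, hdb, hU₀, h1, -, h3, h4, hpU⟩ := h p hp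
      rw [hpU] at hγ
      exact three_le_embDim_of_mem_Germ_VRVRR hs hm hab hdb hU₀ h1 h3 h4 hγ
    refine ⟨O, hO, hOd, key, ?_⟩
    rintro rfl p hp γ hγ
    -- When `n = 3` the whole space already is a submanifold of dimension three.
    exact le_antisymm (embDim_le_of_liesIn (liesInSubmanifold_self γ)) (key p hp γ hγ)
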